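/- For $N\ge 1$ let $\lambda_1,\dots,\lambda_N$ be the eigenvalues of the $N\times N$ Gaussian unitary ensemble with weight $e^{-x^2}$, i.e. real random variables with joint density proportional to $\prod_{j=1}^N e^{-\lambda_j^2}\prod_{1\le i<j\le N}(\lambda_j-\lambda_i)^2$ on $\mathbb R^N$, and let $\langle\,\cdot\,\rangle$ denote the average. Put $$\mathrm{Cov}(A,B)=\big\langle (A-\langle A\rangle)(B-\langle B\rangle)\big\rangle,\qquad \bar S_N(k)=\Big\langle\Big|\sum_{j=1}^N e^{ik\lambda_j}\Big|^2\Big\rangle-\Big|\Big\langle\sum_{j=1}^N e^{ik\lambda_j}\Big\rangle\Big|^2\quad(k\in\mathbb R),$$ $$f_N(X)=\sin\Big(2N\big(\sqrt{X(1-X)}+\arcsin\sqrt X\big)-\pi/4\Big)\quad(0<X<1).$$ (a) For every fixed $\tau$ with $0<\tau<1$, as $N\to\infty$, $$\Big\langle\sum_{j=1}^N e^{2i\sqrt{2N}\,\tau\lambda_j}\Big\rangle=(4N\tau^2)^{-1/2}\Big(2\pi\tau\sqrt{1-\tau^2}\Big)^{-1/2}\Big(f_N(\tau^2)+O\big(\tfrac1N\big)\Big).$$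 (b) For every fixed $\tau>0$, $\tau\ne1$, $$\lim_{N\to\infty}\frac1N\,\bar S_N\big(2\sqrt{2N}\,\tau\big)=\begin{cases}\frac2\pi\big(\tau\sqrt{1-\tau^2}+\arcsin\tau\big),&0<\tau<1,\\ 1,&\tau>1.\end{cases}$$ (c) For every fixed $\gamma\in\mathbb R$ and $\tau>0$, $\tau\neq1$, with $k_1=\frac{i\gamma}{2\sqrt{2N}}+2\sqrt{2N}\,\tau$ and $k_2=-\frac{i\gamma}{2\sqrt{2N}}+2\sqrt{2N}\,\tau$, $$\lim_{N\to\infty}\frac1N\,\mathrm{Cov}\Big(\sum_{j=1}^N e^{ik_1\lambda_j},\sum_{j=1}^N e^{-ik_2\lambda_j}\Big)=\begin{cases}\frac{4}{\gamma\pi}\int_0^\tau\sinh\big(\gamma\sqrt{1-s^2}\big)\,ds,&0<\tau<1,\\[4pt] \frac{4}{\gamma\pi}\int_0^1\sinh\big(\gamma\sqrt{1-s^2}\big)\,ds,&\tau>1,\end{cases}$$ where for $\gamma=0$ the quotient $\sinh(\gamma u)/\gamma$ is read as its limit $u$ (so that for $\gamma=0$ the value for $\tau>1$ is $1$). -/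

import Mathlib

open MeasureTheory Filter Topology Asymptotics

noncomputable section

namespace GUE

/-- The unnormalised joint density `∏ⱼ exp(-λⱼ²) · ∏_{i<j} (λⱼ - λᵢ)²` of the eigenvalues of an
`N × N` matrix from the Gaussian unitary ensemble with weight `exp(-x²)`. -/
def weight (N : ℕ) (x : Fin N → ℝ) : ℝ :=
  (∏ j, Real.exp (-(x j) ^ 2)) * ∏ i, ∏ j ∈ Finset.Ioi i, (x j - x i) ^ 2

/-- The joint law of the (unordered) eigenvalues of the `N × N` Gaussian unitary ensemble. -/
def law (N : ℕ) : Measure (Fin N → ℝ) :=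
  volume.withDensity fun x => ENNReal.ofReal (weight N x / ∫ y, weight N y)

/-- The ensemble average `⟨A⟩` of a function of the eigenvalues. -/
def mean (N : ℕ) (A : (Fin N → ℝ) → ℂ) : ℂ :=
  ∫ x, A x ∂(law N)

/-- The covariance `⟨(A - ⟨A⟩) (B - ⟨B⟩)⟩` (bilinear, without complex conjugation). -/
def cov (N : ℕ) (A B : (Fin N → ℝ) → ℂ) : ℂ :=
  mean N fun x => (A x - mean N A) * (B x - mean N B)

/-- The linear statistic `∑ⱼ exp(i k λⱼ)`, for a complex wave number `k`. -/
def expStat (N : ℕ) (k : ℂ) (x : Fin N → ℝ) : ℂ :=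
  ∑ j, Complex.exp (Complex.I * k * (x j : ℂ))

/-- The averaged structure function `⟨|∑ⱼ exp(i k λⱼ)|²⟩ - |⟨∑ⱼ exp(i k λⱼ)⟩|²`. -/
def structureFn (N : ℕ) (k : ℝ) : ℝ :=
  (∫ x, ‖expStat N k x‖ ^ 2 ∂(law N)) - ‖mean N (expStat N k)‖ ^ 2

/-- The phase function `f_N(X) = sin (2N (√(X(1-X)) + arcsin √X) - π/4)`. -/
def oscillation (N : ℕ) (X : ℝ) : ℝ :=
  Real.sin (2 * N * (√(X * (1 - X)) + Real.arcsin (√X)) - Real.pi / 4)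

/-- The bulk scaled wave number `2 √(2N) τ`. -/
def bulkWave (N : ℕ) (τ : ℝ) : ℝ :=
  2 * √(2 * N) * τ

/-- The imaginary shift `i γ / (2 √(2N))`. -/
def bulkShift (N : ℕ) (γ : ℝ) : ℂ :=
  Complex.I * ((γ / (2 * √(2 * N)) : ℝ) : ℂ)

/-- `Cov (∑ⱼ exp(i k₁ λⱼ), ∑ⱼ exp(-i k₂ λⱼ))` at `k₁ = iγ/(2√(2N)) + 2√(2N) τ` and
`k₂ = -iγ/(2√(2N)) + 2√(2N) τ`. -/
def bulkCov (N : ℕ) (γ τ : ℝ) : ℂ :=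
  cov N (expStat N (bulkShift N γ + bulkWave N τ))
    (expStat N (-(-bulkShift N γ + bulkWave N τ)))

/-! The law is a probability measure. -/

theorem weight_nonneg (N : ℕ) (x : Fin N → ℝ) : 0 ≤ weight N x := by
  unfold weight
  positivity

theorem continuous_weight (N : ℕ) : Continuous (weight N) := by
  unfold weight
  fun_prop

theorem integrable_one_dim (M : ℕ) :
    Integrable fun t : ℝ => Real.exp (-t ^ 2) * (1 + t ^ 2) ^ M := by
  have h (k : ℕ) : Integrable fun t : ℝ => t ^ k * Real.exp (-t ^ 2) := by
    have := integrable_rpow_mul_exp_neg_mul_sq (b := 1) one_pos (s := k)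
      (by have := Nat.cast_nonneg (α := ℝ) k; linarith)
    simpa [Real.rpow_natCast] using this
  have h2 : (fun t : ℝ => Real.exp (-t ^ 2) * (1 + t ^ 2) ^ M) = fun t =>
      ∑ m ∈ Finset.range (M + 1), (M.choose m : ℝ) * (t ^ (2 * (M - m)) * Real.exp (-t ^ 2)) := by
    funext t
    rw [add_pow, Finset.mul_sum]
    refine Finset.sum_congr rfl fun m _ => ?_
    rw [pow_mul]
    ring
  rw [h2]
  exact integrable_finsetSum _ fun m _ => (h _).const_mul _

theorem integrable_weight (N : ℕ) : Integrable (weight N) := by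
  set M : ℕ := ∑ i : Fin N, (Finset.Ioi i).card with hM
  have hint : Integrable fun x : Fin N → ℝ =>
      4 ^ M * ∏ j, (Real.exp (-(x j) ^ 2) * (1 + (x j) ^ 2) ^ M) :=
    (Integrable.fintype_prod (𝕜 := ℝ) (fun _ => integrable_one_dim M)).const_mul _
  refine hint.mono' (continuous_weight N).aestronglyMeasurable (Eventually.of_forall fun x => ?_)
  rw [Real.norm_of_nonneg (weight_nonneg N x)]
  set P : ℝ := ∏ j, (1 + (x j) ^ 2) with hP
  have hle (i : Fin N) : (x i) ^ 2 ≤ P := by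
    have h1 : 1 + (x i) ^ 2 ≤ P := by
      rw [hP, ← Finset.mul_prod_erase _ _ (Finset.mem_univ i)]
      refine le_mul_of_one_le_right (by positivity) ?_
      have h3 := Finset.prod_le_prod (s := Finset.univ.erase i) (f := fun _ => (1 : ℝ))
        (g := fun j => 1 + (x j) ^ 2) (fun _ _ => zero_le_one)
        fun j _ => by nlinarith [sq_nonneg (x j)]
      simpa using h3
    linarith
  have hV : ∏ i, ∏ j ∈ Finset.Ioi i, (x j - x i) ^ 2 ≤ (4 * P) ^ M := by
    calc ∏ i, ∏ j ∈ Finset.Ioi i, (x j - x i) ^ 2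
        ≤ ∏ i : Fin N, ∏ _j ∈ Finset.Ioi i, (4 * P) := by
          refine Finset.prod_le_prod (fun i _ => by positivity) fun i _ => ?_
          refine Finset.prod_le_prod (fun j _ => by positivity) fun j _ => ?_
          nlinarith [hle i, hle j, sq_nonneg (x i + x j)]
      _ = (4 * P) ^ M := by
          simp only [Finset.prod_const, hM]
          rw [Finset.prod_pow_eq_pow_sum]
  calc weight N x ≤ (∏ j, Real.exp (-(x j) ^ 2)) * (4 * P) ^ M :=
        mul_le_mul_of_nonneg_left hV (by positivity)
    _ = 4 ^ M * ∏ j, (Real.exp (-(x j) ^ 2) * (1 + (x j) ^ 2) ^ M) := by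
        rw [Finset.prod_mul_distrib, Finset.prod_pow, mul_pow]
        ring

theorem integral_weight_pos (N : ℕ) : 0 < ∫ x, weight N x := by
  rw [integral_pos_iff_support_of_nonneg (weight_nonneg N) (integrable_weight N)]
  refine (continuous_weight N).isOpen_support.measure_pos _ ⟨fun i => (i : ℝ), ?_⟩
  rw [Function.mem_support]
  refine mul_ne_zero (Finset.prod_ne_zero_iff.2 fun j _ => (Real.exp_pos _).ne') ?_
  refine Finset.prod_ne_zero_iff.2 fun i _ => Finset.prod_ne_zero_iff.2 fun j hj => ?_
  have h : i < j := Finset.mem_Ioi.1 hj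
  have h' : ((i : ℕ) : ℝ) < ((j : ℕ) : ℝ) := by exact_mod_cast h
  exact pow_ne_zero _ (sub_ne_zero.2 h'.ne')

instance isProbabilityMeasure_law (N : ℕ) : IsProbabilityMeasure (law N) := by
  constructor
  rw [law, withDensity_apply _ MeasurableSet.univ, Measure.restrict_univ,
    ← ofReal_integral_eq_lintegral_ofReal ((integrable_weight N).div_const _)
      (Eventually.of_forall fun x => div_nonneg (weight_nonneg N x) (integral_weight_pos N).le),
    integral_div, div_self (integral_weight_pos N).ne', ENNReal.ofReal_one]

end GUE

end

namespace GUE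

/-! ### Determinantal averages -/

/-! The joint density is the square of a Slater determinant of Hermite functions, divided by `N!`.
Averages of linear statistics therefore reduce to one-particle matrix elements: the mean is `∑_{i<N}
f_ii`, and the covariance is `∑_{i<N} (fg)_ii - ∑_{i,j<N} f_ij g_ji`.

For the covariance, take `f = exp(√2 c x)` and `g = exp(√2 c̄ x)`. Each product `f_ij g_ji` is then
the nonnegative number `elementSq c i j`, and `(fg)_ii` is its full row sum. What remains is the
total weight of transitions from levels `i < N` to levels `j ≥ N`. A Mehler-type formula
(`hasSum_elementSq`) evaluates `∑ sⁿ rᵐ elementSq c n m` in closed form. At `s = exp(-(i+1)/N)`, `r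
= exp(-j/N)` and in the bulk scaling, `1/N` times this sum tends to the integral of `exp(-(i+1)|p|²)
exp(-j|p - (0,2τ)|²)` against the density `exp(-γx)/π` on the plane (`tendsto_integral_levelFn`).
This is the semiclassical picture: `n/N` becomes the squared radius in phase space, and the
exponential translates phase space by `2τ`. Convergence of these moments, Stone–Weierstrass and the
portmanteau theorem (`tendsto_measureReal_of_tendsto_moments`) show that the rescaled covariance
tends to the measure of the unit disc minus its translate (`phaseMeasure_disc_diff`). That measure
is an integral of chords over `0 < s < τ`; chords are empty beyond `s = 1`, so the limit saturates
at `τ = 1`. The structure function is the case `γ = 0`.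

For the mean, the diagonal matrix elements sum to a Laguerre polynomial, written as the contour
integral of `exp(c² w) (1 + 1/w)^N`. On the circle of radius `1/(2τ)` this is an `N`-th power, up to
the length element. Its modulus on the upper half circle is maximal only at the angle `π/2 + arcsin
τ`. Laplace's method there (`laplace_method`) has error `O(N^{-3/2})`, because the odd corrections
integrate to zero; the main term has size `N^{-1/2}`, so the relative error is `O(1/N)`. The lower
half circle contributes the complex conjugate, which turns the saddle's phase into the sine. -/

open Equiv Finset in
theorem sum_perm_perm_prod_eq_of_single {ι : Type*} [Fintype ι] [DecidableEq ι]
    (M : ι → ι → ι → ℂ) (a : ι)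
    (h : ∀ j, j ≠ a → ∀ i k, M j i k = if i = k then 1 else 0) :
    ∑ σ : Perm ι, ∑ τ : Perm ι, ((Perm.sign σ : ℤ) : ℂ) * ((Perm.sign τ : ℤ) : ℂ) *
      ∏ j, M j (σ j) (τ j) = ∑ σ : Perm ι, M a (σ a) (σ a) := by
  refine sum_congr rfl fun σ _ => ?_
  rw [sum_eq_single σ]
  · have h1 : ((Perm.sign σ : ℤ) : ℂ) * ((Perm.sign σ : ℤ) : ℂ) = 1 := by
      rcases Int.units_eq_one_or (Perm.sign σ) with h | h <;> simp [h]
    rw [h1, one_mul, prod_eq_single a]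
    · intro j _ hj
      simp [h j hj]
    · simp
  · intro τ _ hτ
    -- Permutations that agree off one point agree everywhere, so `τ ≠ σ` produces a vanishing
    -- Kronecker delta at some `j ≠ a`.
    obtain ⟨j, hj, hne⟩ : ∃ j, j ≠ a ∧ σ j ≠ τ j := by
      by_contra! hcon
      apply hτ
      have hinj : ∀ x, x ≠ a → (σ⁻¹ * τ) x = x := fun x hx => by
        rw [Perm.mul_apply, ← hcon x hx, Perm.inv_def, Equiv.symm_apply_apply]
      have hone : σ⁻¹ * τ = 1 := by
        ext x
        by_cases hx : x = a
        · subst hx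
          by_contra hne
          exact hne ((σ⁻¹ * τ).injective (hinj _ hne))
        · exact hinj x hx
      exact (inv_mul_eq_one.1 hone).symm
    rw [prod_eq_zero (mem_univ j) (by rw [h j hj, if_neg hne]), mul_zero]
  · simp

-- `σ⁻¹ * τ` fixes every point outside `{a, b}`, hence preserves `{a, b}`, and is the identity or
-- the transposition.
open Equiv Finset in
theorem perm_eq_or_eq_mul_swap {ι : Type*} [DecidableEq ι] (σ τ : Perm ι) (a b : ι)
    (h : ∀ j, j ≠ a → j ≠ b → σ j = τ j) : τ = σ ∨ τ = σ * swap a b := by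
  set ρ := σ⁻¹ * τ with hρ
  have hfix : ∀ x, x ≠ a → x ≠ b → ρ x = x := fun x hx hy => by
    rw [hρ, Perm.mul_apply, ← h x hx hy, Perm.inv_def, Equiv.symm_apply_apply]
  have key : ρ = 1 ∨ ρ = swap a b := by
    have hmem : ∀ x, (x = a ∨ x = b) → (ρ x = a ∨ ρ x = b) := by
      intro x hx
      by_contra! hcon
      have h3 := ρ.injective (hfix _ hcon.1 hcon.2)
      rw [h3] at hcon
      tauto
    rcases hmem a (Or.inl rfl) with ha | ha
    · left
      ext x
      by_cases hxa : x = a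
      · simp [hxa, ha]
      by_cases hxb : x = b
      · rcases hmem b (Or.inr rfl) with hb | hb
        · exact absurd (ρ.injective (hb.trans ha.symm)) (by rw [← hxb]; exact hxa)
        · simp [hxb, hb]
      · simp [hfix x hxa hxb]
    · right
      ext x
      by_cases hxa : x = a
      · simp [hxa, ha]
      by_cases hxb : x = b
      · rcases hmem b (Or.inr rfl) with hb | hb
        · simp [hxb, hb]
        · exact absurd (ρ.injective (hb.trans ha.symm)) (by rw [← hxb]; exact hxa)
      · simp [hfix x hxa hxb, swap_apply_of_ne_of_ne hxa hxb]
  rcases key with h | h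
  · left
    exact (inv_mul_eq_one.1 (hρ ▸ h)).symm
  · right
    rw [← h, hρ, mul_inv_cancel_left]

-- For each `σ` the Kronecker deltas leave only `τ = σ` and `τ = σ * swap a b`; the sign of the
-- transposition produces the minus in front of the exchange term.
open Equiv Finset in
theorem sum_perm_perm_prod_eq_of_pair {ι : Type*} [Fintype ι] [DecidableEq ι]
    (M : ι → ι → ι → ℂ) (a b : ι) (hab : a ≠ b)
    (h : ∀ j, j ≠ a → j ≠ b → ∀ i k, M j i k = if i = k then 1 else 0) :
    ∑ σ : Perm ι, ∑ τ : Perm ι, ((Perm.sign σ : ℤ) : ℂ) * ((Perm.sign τ : ℤ) : ℂ) *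
      ∏ j, M j (σ j) (τ j) = ∑ σ : Perm ι, (M a (σ a) (σ a) * M b (σ b) (σ b) -
        M a (σ a) (σ b) * M b (σ b) (σ a)) := by
  refine sum_congr rfl fun σ _ => ?_
  have h1 : ((Perm.sign σ : ℤ) : ℂ) * ((Perm.sign σ : ℤ) : ℂ) = 1 := by
    rcases Int.units_eq_one_or (Perm.sign σ) with h | h <;> simp [h]
  have hne : σ ≠ σ * swap a b := by
    intro hcon
    have := congrArg (fun ρ : Perm ι => ρ a) hcon
    simp [hab] at this
  rw [← sum_subset (subset_univ ({σ, σ * swap a b} : Finset (Perm ι))), sum_pair hne]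
  · have hp : ∀ τ : Perm ι, (∀ j, j ≠ a → j ≠ b → σ j = τ j) →
        ∏ j, M j (σ j) (τ j) = M a (σ a) (τ a) * M b (σ b) (τ b) := by
      intro τ hτ
      rw [← prod_subset (subset_univ ({a, b} : Finset ι)), prod_pair hab]
      intro j _ hj
      simp only [mem_insert, mem_singleton, not_or] at hj
      rw [h j hj.1 hj.2, if_pos (hτ j hj.1 hj.2)]
    rw [hp σ (fun _ _ _ => rfl), hp (σ * swap a b) (fun j hja hjb => by
      simp [swap_apply_of_ne_of_ne hja hjb])]
    simp only [Perm.mul_apply, swap_apply_left, swap_apply_right, Perm.sign_mul,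
      Perm.sign_swap hab]
    push_cast
    linear_combination (M a (σ a) (σ a) * M b (σ b) (σ b) -
        M a (σ a) (σ b) * M b (σ b) (σ a)) * h1
  · intro τ _ hτ
    simp only [mem_insert, mem_singleton, not_or] at hτ
    obtain ⟨j, hja, hjb, hj⟩ : ∃ j, j ≠ a ∧ j ≠ b ∧ σ j ≠ τ j := by
      by_contra! hcon
      rcases perm_eq_or_eq_mul_swap σ τ a b hcon with h | h
      · exact hτ.1 h
      · exact hτ.2 h
    rw [prod_eq_zero (mem_univ j) (by rw [h j hja hjb, if_neg hj]), mul_zero]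

/-- The matrix element `∫ f ψᵢ ψⱼ` of a multiplication operator. -/
noncomputable def element (ψ : ℕ → ℝ → ℝ) (f : ℝ → ℂ) (i j : ℕ) : ℂ :=
  ∫ x, f x * ((ψ i x * ψ j x : ℝ) : ℂ)

/-- The Slater determinant of the functions `ψ₀, …, ψ_{N-1}`. -/
noncomputable def slater (ψ : ℕ → ℝ → ℝ) (N : ℕ) (x : Fin N → ℝ) : ℝ :=
  (Matrix.of fun i j : Fin N => ψ i (x j)).det

theorem ofReal_slater_sq (ψ : ℕ → ℝ → ℝ) (N : ℕ) (F : Fin N → ℝ → ℂ) (x : Fin N → ℝ) :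
    (∏ j, F j (x j)) * ((slater ψ N x ^ 2 : ℝ) : ℂ) =
      ∑ σ : Equiv.Perm (Fin N), ∑ τ : Equiv.Perm (Fin N),
        ((Equiv.Perm.sign σ : ℤ) : ℂ) * ((Equiv.Perm.sign τ : ℤ) : ℂ) *
        ∏ j, F j (x j) * ((ψ (σ j) (x j) * ψ (τ j) (x j) : ℝ) : ℂ) := by
  rw [slater, Matrix.det_apply', sq]
  push_cast
  rw [Finset.sum_mul_sum, Finset.mul_sum]
  refine Finset.sum_congr rfl fun σ _ => ?_
  rw [Finset.mul_sum]
  refine Finset.sum_congr rfl fun τ _ => ?_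
  simp only [Finset.prod_mul_distrib, Matrix.of_apply]
  ring

theorem integrable_prod_mul_slater_sq (ψ : ℕ → ℝ → ℝ) (N : ℕ) (F : Fin N → ℝ → ℂ)
    (hF : ∀ j (i k : Fin N), Integrable fun x => F j x * ((ψ i x * ψ k x : ℝ) : ℂ)) :
    Integrable fun x : Fin N → ℝ => (∏ j, F j (x j)) * ((slater ψ N x ^ 2 : ℝ) : ℂ) := by
  simp only [ofReal_slater_sq]
  exact integrable_finsetSum _ fun σ _ => integrable_finsetSum _ fun τ _ =>
    (Integrable.fintype_prod (𝕜 := ℂ)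
      (f := fun j x => F j x * ((ψ (σ j) x * ψ (τ j) x : ℝ) : ℂ))
      (fun j => hF j _ _)).const_mul _

/-- Both determinants are expanded by Leibniz; every term is a product of functions of one variable,
so the integral factorises. -/
theorem integral_prod_mul_slater_sq (ψ : ℕ → ℝ → ℝ) (N : ℕ) (F : Fin N → ℝ → ℂ)
    (hF : ∀ j (i k : Fin N), Integrable fun x => F j x * ((ψ i x * ψ k x : ℝ) : ℂ)) :
    ∫ x : Fin N → ℝ, (∏ j, F j (x j)) * ((slater ψ N x ^ 2 : ℝ) : ℂ) =
      ∑ σ : Equiv.Perm (Fin N), ∑ τ : Equiv.Perm (Fin N),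
        ((Equiv.Perm.sign σ : ℤ) : ℂ) * ((Equiv.Perm.sign τ : ℤ) : ℂ) *
        ∏ j, element ψ (F j) (σ j) (τ j) := by
  have hint : ∀ σ τ : Equiv.Perm (Fin N), Integrable fun x : Fin N → ℝ =>
      ((Equiv.Perm.sign σ : ℤ) : ℂ) * ((Equiv.Perm.sign τ : ℤ) : ℂ) *
        ∏ j, F j (x j) * ((ψ (σ j) (x j) * ψ (τ j) (x j) : ℝ) : ℂ) := fun σ τ =>
    (Integrable.fintype_prod (𝕜 := ℂ)
      (f := fun j x => F j x * ((ψ (σ j) x * ψ (τ j) x : ℝ) : ℂ))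
      (fun j => hF j _ _)).const_mul _
  simp only [ofReal_slater_sq]
  rw [integral_finsetSum _ fun σ _ => integrable_finsetSum _ fun τ _ => hint σ τ]
  refine Finset.sum_congr rfl fun σ _ => ?_
  rw [integral_finsetSum _ fun τ _ => hint σ τ]
  refine Finset.sum_congr rfl fun τ _ => ?_
  rw [integral_const_mul]
  congr 1
  exact integral_fintype_prod_eq_prod (𝕜 := ℂ)
    (fun j x => F j x * ((ψ (σ j) x * ψ (τ j) x : ℝ) : ℂ))

/-- Functions whose matrix elements all converge absolutely. -/
def HasElements (ψ : ℕ → ℝ → ℝ) (f : ℝ → ℂ) : Prop :=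
  ∀ i k : ℕ, Integrable fun x => f x * ((ψ i x * ψ k x : ℝ) : ℂ)

/-- The function `1` is placed in every slot other than `a`, where orthonormality yields Kronecker
deltas. -/
theorem integral_single_mul_slater_sq (ψ : ℕ → ℝ → ℝ) (N : ℕ)
    (hψ : ∀ i k, element ψ (fun _ => 1) i k = if i = k then 1 else 0)
    (h1 : HasElements ψ fun _ => 1) (f : ℝ → ℂ) (hf : HasElements ψ f) (a : Fin N) :
    (Integrable fun x : Fin N → ℝ => f (x a) * ((slater ψ N x ^ 2 : ℝ) : ℂ)) ∧
    ∫ x : Fin N → ℝ, f (x a) * ((slater ψ N x ^ 2 : ℝ) : ℂ) =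
      ∑ σ : Equiv.Perm (Fin N), element ψ f (σ a) (σ a) := by
  set F : Fin N → ℝ → ℂ := Function.update (fun _ _ => 1) a f with hFdef
  have hF : ∀ j (i k : Fin N), Integrable fun x => F j x * ((ψ i x * ψ k x : ℝ) : ℂ) := by
    intro j i k
    by_cases hj : j = a
    · subst hj
      simpa [F] using! hf i k
    · simpa [F, hj] using! h1 i k
  have hprod : ∀ x : Fin N → ℝ, ∏ j, F j (x j) = f (x a) := fun x => by
    rw [Finset.prod_eq_single a]
    · simp [F]
    · intro j _ hj
      simp [F, hj]
    · simp
  refine ⟨by simpa only [hprod] using integrable_prod_mul_slater_sq ψ N F hF, ?_⟩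
  have h := integral_prod_mul_slater_sq ψ N F hF
  simp only [hprod] at h
  rw [h, sum_perm_perm_prod_eq_of_single (fun j i k => element ψ (F j) i k) a]
  · simp [F]
  · intro j hj i k
    simp only [F, Function.update_of_ne hj]
    rw [hψ]
    simp [Fin.ext_iff]

theorem integral_pair_mul_slater_sq (ψ : ℕ → ℝ → ℝ) (N : ℕ)
    (hψ : ∀ i k, element ψ (fun _ => 1) i k = if i = k then 1 else 0)
    (h1 : HasElements ψ fun _ => 1) (f g : ℝ → ℂ) (hf : HasElements ψ f)
    (hg : HasElements ψ g) (a b : Fin N) (hab : a ≠ b) :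
    (Integrable fun x : Fin N → ℝ => f (x a) * g (x b) * ((slater ψ N x ^ 2 : ℝ) : ℂ)) ∧
    ∫ x : Fin N → ℝ, f (x a) * g (x b) * ((slater ψ N x ^ 2 : ℝ) : ℂ) =
      ∑ σ : Equiv.Perm (Fin N), (element ψ f (σ a) (σ a) * element ψ g (σ b) (σ b) -
        element ψ f (σ a) (σ b) * element ψ g (σ b) (σ a)) := by
  set F : Fin N → ℝ → ℂ := Function.update (Function.update (fun _ _ => 1) a f) b g with hFdef
  have hFa : F a = f := by simp [F, hab]
  have hFb : F b = g := by simp [F]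
  have hFj : ∀ j, j ≠ a → j ≠ b → F j = fun _ => 1 := fun j hja hjb => by simp [F, hja, hjb]
  have hF : ∀ j (i k : Fin N), Integrable fun x => F j x * ((ψ i x * ψ k x : ℝ) : ℂ) := by
    intro j i k
    by_cases hja : j = a
    · rw [hja, hFa]; exact hf i k
    by_cases hjb : j = b
    · rw [hjb, hFb]; exact hg i k
    · rw [hFj j hja hjb]; exact h1 i k
  have hprod : ∀ x : Fin N → ℝ, ∏ j, F j (x j) = f (x a) * g (x b) := fun x => by
    rw [← Finset.prod_subset (Finset.subset_univ ({a, b} : Finset (Fin N))),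
      Finset.prod_pair hab, hFa, hFb]
    intro j _ hj
    simp only [Finset.mem_insert, Finset.mem_singleton, not_or] at hj
    rw [hFj j hj.1 hj.2]
  refine ⟨by simpa only [hprod] using integrable_prod_mul_slater_sq ψ N F hF, ?_⟩
  have h := integral_prod_mul_slater_sq ψ N F hF
  simp only [hprod] at h
  rw [h, sum_perm_perm_prod_eq_of_pair (fun j i k => element ψ (F j) i k) a b hab]
  · simp only [hFa, hFb]
  · intro j hja hjb i k
    rw [hFj j hja hjb, hψ]
    simp [Fin.ext_iff]

/-! ### Means and covariances of linear statistics -/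

section Averages

theorem mean_eq_integral_slater (ψ : ℕ → ℝ → ℝ) (N : ℕ)
    (hdens : ∀ x, weight N x / ∫ y, weight N y = slater ψ N x ^ 2 / N.factorial)
    (A : (Fin N → ℝ) → ℂ) :
    mean N A = (∫ x, A x * ((slater ψ N x ^ 2 : ℝ) : ℂ)) / N.factorial := by
  rw [mean, law, integral_withDensity_eq_integral_toReal_smul]
  · rw [div_eq_mul_inv, mul_comm, ← integral_const_mul]
    refine integral_congr_ae (Eventually.of_forall fun x => ?_)
    simp only
    rw [ENNReal.toReal_ofReal (div_nonneg (weight_nonneg N x) (integral_weight_pos N).le),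
      hdens, Complex.real_smul]
    push_cast
    ring
  · exact ((continuous_weight N).div_const _).measurable.ennreal_ofReal
  · exact Eventually.of_forall fun x => ENNReal.ofReal_lt_top

theorem integrable_law_of_slater (ψ : ℕ → ℝ → ℝ) (N : ℕ)
    (hdens : ∀ x, weight N x / ∫ y, weight N y = slater ψ N x ^ 2 / N.factorial)
    (A : (Fin N → ℝ) → ℂ)
    (hA : Integrable fun x => A x * ((slater ψ N x ^ 2 : ℝ) : ℂ)) :
    Integrable A (law N) := by
  rw [law, integrable_withDensity_iff_integrable_smul']
  · refine (hA.mul_const ((N.factorial : ℂ)⁻¹)).congr (Eventually.of_forall fun x => ?_)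
    simp only
    rw [ENNReal.toReal_ofReal (div_nonneg (weight_nonneg N x) (integral_weight_pos N).le),
      hdens, Complex.real_smul]
    push_cast
    ring
  · exact ((continuous_weight N).div_const _).measurable.ennreal_ofReal
  · exact Eventually.of_forall fun x => ENNReal.ofReal_lt_top

theorem mean_linearStat (ψ : ℕ → ℝ → ℝ) (N : ℕ)
    (hdens : ∀ x, weight N x / ∫ y, weight N y = slater ψ N x ^ 2 / N.factorial)
    (hψ : ∀ i k, element ψ (fun _ => 1) i k = if i = k then 1 else 0)
    (h1 : HasElements ψ fun _ => 1) (f : ℝ → ℂ) (hf : HasElements ψ f) :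
    Integrable (fun x : Fin N → ℝ => ∑ a, f (x a)) (law N) ∧
    mean N (fun x => ∑ a, f (x a)) = ∑ i ∈ Finset.range N, element ψ f i i := by
  have hs := fun a => integral_single_mul_slater_sq ψ N hψ h1 f hf a
  constructor
  · refine integrable_law_of_slater ψ N hdens _ ?_
    simp only [Finset.sum_mul]
    exact integrable_finsetSum _ fun a _ => (hs a).1
  · rw [mean_eq_integral_slater ψ N hdens]
    simp only [Finset.sum_mul]
    rw [integral_finsetSum _ fun a _ => (hs a).1]
    simp only [(hs _).2]
    rw [Finset.sum_comm]
    have : ∀ σ : Equiv.Perm (Fin N), ∑ a, element ψ f (σ a) (σ a) =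
        ∑ i ∈ Finset.range N, element ψ f i i := fun σ => by
      rw [Equiv.sum_comp σ (fun i : Fin N => element ψ f i i),
        Finset.sum_range (fun i => element ψ f i i)]
    simp only [this, Finset.sum_const, Finset.card_univ, Fintype.card_perm, Fintype.card_fin,
      nsmul_eq_mul]
    rw [mul_div_cancel_left₀ _ (by exact_mod_cast N.factorial_ne_zero)]

theorem mean_mul_linearStat (ψ : ℕ → ℝ → ℝ) (N : ℕ)
    (hdens : ∀ x, weight N x / ∫ y, weight N y = slater ψ N x ^ 2 / N.factorial)
    (hψ : ∀ i k, element ψ (fun _ => 1) i k = if i = k then 1 else 0)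
    (h1 : HasElements ψ fun _ => 1) (f g : ℝ → ℂ) (hf : HasElements ψ f)
    (hg : HasElements ψ g) (hfg : HasElements ψ fun x => f x * g x) :
    Integrable (fun x : Fin N → ℝ => (∑ a, f (x a)) * ∑ b, g (x b)) (law N) ∧
    mean N (fun x => (∑ a, f (x a)) * ∑ b, g (x b)) =
      ∑ i ∈ Finset.range N, element ψ (fun x => f x * g x) i i +
      ∑ i ∈ Finset.range N, ∑ j ∈ Finset.range N,
        (element ψ f i i * element ψ g j j - element ψ f i j * element ψ g j i) := by
  have hs := fun a => integral_single_mul_slater_sq ψ N hψ h1 _ hfg a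
  have hp := fun a b hab => integral_pair_mul_slater_sq ψ N hψ h1 f g hf hg a b hab
  have hint : ∀ a b, Integrable fun x : Fin N → ℝ =>
      f (x a) * g (x b) * ((slater ψ N x ^ 2 : ℝ) : ℂ) := by
    intro a b
    by_cases hab : a = b
    · subst hab; exact (hs a).1
    · exact (hp a b hab).1
  -- At `a = b` the bracket cancels identically, so one formula covers coincident and distinct
  -- indices and the double sums can run unrestricted.
  have hval : ∀ a b, ∫ x : Fin N → ℝ, f (x a) * g (x b) * ((slater ψ N x ^ 2 : ℝ) : ℂ) =
      (if a = b then ∑ σ : Equiv.Perm (Fin N),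
        element ψ (fun x => f x * g x) (σ a) (σ a) else 0) +
      ∑ σ : Equiv.Perm (Fin N), (element ψ f (σ a) (σ a) * element ψ g (σ b) (σ b) -
        element ψ f (σ a) (σ b) * element ψ g (σ b) (σ a)) := by
    intro a b
    by_cases hab : a = b
    · subst hab
      rw [(hs a).2]
      simp
    · rw [(hp a b hab).2]
      simp [hab]
  constructor
  · refine integrable_law_of_slater ψ N hdens _ ?_
    simp only [Finset.sum_mul_sum]
    simp only [Finset.sum_mul]
    exact integrable_finsetSum _ fun a _ => integrable_finsetSum _ fun b _ => hint a b
  · rw [mean_eq_integral_slater ψ N hdens]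
    simp only [Finset.sum_mul_sum]
    simp only [Finset.sum_mul]
    rw [integral_finsetSum _ fun a _ => integrable_finsetSum _ fun b _ => hint a b]
    simp_rw [integral_finsetSum _ fun b _ => hint _ b, hval]
    simp only [Finset.sum_add_distrib, Finset.sum_ite_eq, Finset.mem_univ, if_true]
    have e1 : ∑ a, ∑ σ : Equiv.Perm (Fin N), element ψ (fun x => f x * g x) (σ a) (σ a) =
        N.factorial * ∑ i ∈ Finset.range N, element ψ (fun x => f x * g x) i i := by
      rw [Finset.sum_comm]
      have : ∀ σ : Equiv.Perm (Fin N), ∑ a, element ψ (fun x => f x * g x) (σ a) (σ a) =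
          ∑ i ∈ Finset.range N, element ψ (fun x => f x * g x) i i := fun σ => by
        rw [Equiv.sum_comp σ (fun i : Fin N => element ψ (fun x => f x * g x) i i),
          Finset.sum_range (fun i => element ψ (fun x => f x * g x) i i)]
      simp only [this, Finset.sum_const, Finset.card_univ, Fintype.card_perm, Fintype.card_fin,
        nsmul_eq_mul]
    have e2 : ∑ a : Fin N, ∑ b : Fin N, ∑ σ : Equiv.Perm (Fin N),
        (element ψ f (σ a) (σ a) * element ψ g (σ b) (σ b) -
          element ψ f (σ a) (σ b) * element ψ g (σ b) (σ a)) =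
        N.factorial * ∑ i ∈ Finset.range N, ∑ j ∈ Finset.range N,
        (element ψ f i i * element ψ g j j - element ψ f i j * element ψ g j i) := by
      simp_rw [Finset.sum_comm (s := Finset.univ (α := Fin N))
        (t := Finset.univ (α := Equiv.Perm (Fin N)))]
      have : ∀ σ : Equiv.Perm (Fin N), ∑ a : Fin N, ∑ b : Fin N,
          (element ψ f (σ a) (σ a) * element ψ g (σ b) (σ b) -
          element ψ f (σ a) (σ b) * element ψ g (σ b) (σ a)) =
          ∑ i ∈ Finset.range N, ∑ j ∈ Finset.range N,
        (element ψ f i i * element ψ g j j - element ψ f i j * element ψ g j i) := fun σ => by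
        simp_rw [Finset.sum_range]
        rw [← Equiv.sum_comp σ (fun i : Fin N => ∑ j : Fin N,
          (element ψ f i i * element ψ g j j - element ψ f i j * element ψ g j i))]
        refine Finset.sum_congr rfl fun a _ => ?_
        exact Equiv.sum_comp σ (fun j : Fin N => element ψ f (σ a) (σ a) * element ψ g j j -
          element ψ f (σ a) j * element ψ g j (σ a))
      simp only [this, Finset.sum_const, Finset.card_univ, Fintype.card_perm, Fintype.card_fin,
        nsmul_eq_mul]
    rw [e1, e2, ← mul_add, mul_div_cancel_left₀ _ (by exact_mod_cast N.factorial_ne_zero)]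

theorem cov_eq_mean_mul_sub {N : ℕ} {A B : (Fin N → ℝ) → ℂ} (hA : Integrable A (law N))
    (hB : Integrable B (law N)) (hAB : Integrable (fun x => A x * B x) (law N)) :
    cov N A B = mean N (fun x => A x * B x) - mean N A * mean N B := by
  have e : (fun x => (A x - mean N A) * (B x - mean N B)) =
      fun x => A x * B x - (A x * mean N B + mean N A * B x) + mean N A * mean N B := by
    funext x; ring
  have i1 : Integrable (fun x => A x * mean N B) (law N) := hA.mul_const _
  have i2 : Integrable (fun x => mean N A * B x) (law N) := hB.const_mul _
  have i3 : Integrable (fun x => A x * mean N B + mean N A * B x) (law N) := i1.add i2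
  have i4 : Integrable (fun x => A x * B x - (A x * mean N B + mean N A * B x)) (law N) :=
    hAB.sub i3
  have a1 : ∫ x, A x ∂law N = mean N A := rfl
  have a2 : ∫ x, B x ∂law N = mean N B := rfl
  have a3 : ∫ x, A x * B x ∂law N = mean N (fun x => A x * B x) := rfl
  rw [cov, e, mean, integral_add i4 (integrable_const _), integral_sub hAB i3,
    integral_add i1 i2, integral_mul_const, integral_const_mul, a1, a2, a3]
  simp
  ring

/-- The direct terms `f_ii g_jj` cancel against the product of the means; only the one-body and
exchange terms survive. -/
theorem cov_linearStat (ψ : ℕ → ℝ → ℝ) (N : ℕ)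
    (hdens : ∀ x, weight N x / ∫ y, weight N y = slater ψ N x ^ 2 / N.factorial)
    (hψ : ∀ i k, element ψ (fun _ => 1) i k = if i = k then 1 else 0)
    (h1 : HasElements ψ fun _ => 1) (f g : ℝ → ℂ) (hf : HasElements ψ f)
    (hg : HasElements ψ g) (hfg : HasElements ψ fun x => f x * g x) :
    cov N (fun x => ∑ a, f (x a)) (fun x => ∑ b, g (x b)) =
      ∑ i ∈ Finset.range N, element ψ (fun x => f x * g x) i i -
      ∑ i ∈ Finset.range N, ∑ j ∈ Finset.range N, element ψ f i j * element ψ g j i := by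
  obtain ⟨iA, mA⟩ := mean_linearStat ψ N hdens hψ h1 f hf
  obtain ⟨iB, mB⟩ := mean_linearStat ψ N hdens hψ h1 g hg
  obtain ⟨iAB, mAB⟩ := mean_mul_linearStat ψ N hdens hψ h1 f g hf hg hfg
  rw [cov_eq_mean_mul_sub iA iB iAB, mAB, mA, mB, Finset.sum_mul_sum]
  simp only [Finset.sum_sub_distrib]
  ring

end Averages

/-! ### Hermite functions and the matrix elements of exponentials -/

theorem derivative_hermite_succ (n : ℕ) :
    Polynomial.derivative (Polynomial.hermite (n + 1)) =
      (n + 1 : Polynomial ℤ) * Polynomial.hermite n := by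
  induction n with
  | zero => simp [Polynomial.hermite_zero]
  | succ n ih =>
    rw [Polynomial.hermite_succ (n + 1), Polynomial.derivative_sub, Polynomial.derivative_mul,
      Polynomial.derivative_X, ih, Polynomial.derivative_mul, Polynomial.hermite_succ n]
    simp
    ring

/-- The Hermite polynomial `Heₙ(√2 x)`, orthogonal for the weight `exp(-x²)`. -/
noncomputable def hermiteVal (n : ℕ) (x : ℝ) : ℝ :=
  Polynomial.aeval (√2 * x) (Polynomial.hermite n)

theorem hermiteVal_zero (x : ℝ) : hermiteVal 0 x = 1 := by
  simp [hermiteVal, Polynomial.hermite_zero]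

theorem hasDerivAt_hermiteVal (n : ℕ) (x : ℝ) :
    HasDerivAt (hermiteVal n) (√2 * n * hermiteVal (n - 1) x) x := by
  have h := ((Polynomial.hermite n).hasDerivAt_aeval (√2 * x)).comp x
    ((hasDerivAt_id x).const_mul √2)
  refine h.congr_deriv ?_
  cases n with
  | zero => simp [Polynomial.hermite_zero]
  | succ n =>
    rw [derivative_hermite_succ]
    simp [hermiteVal]
    ring

theorem hermiteVal_succ (n : ℕ) (x : ℝ) :
    hermiteVal (n + 1) x = √2 * x * hermiteVal n x - n * hermiteVal (n - 1) x := by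
  cases n with
  | zero => simp [hermiteVal, Polynomial.hermite_zero]
  | succ n =>
    rw [hermiteVal, Polynomial.hermite_succ (n + 1), derivative_hermite_succ]
    simp [hermiteVal]

/-- Since `|x|^k ≤ k! exp |x| ≤ k! (exp x + exp (-x))`, the power is absorbed by replacing `z` with
`z ± 1`. -/
theorem integrable_pow_mul_cexp_sub_sq (k : ℕ) (z : ℂ) :
    Integrable fun x : ℝ => (x : ℂ) ^ k * Complex.exp (z * x - (x : ℂ) ^ 2) := by
  have h (w : ℂ) : Integrable fun x : ℝ => Complex.exp (w * x - (x : ℂ) ^ 2) := by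
    have := integrable_cexp_quadratic' (b := -1) (by simp) w 0
    refine this.congr (Eventually.of_forall fun x => ?_)
    simp only
    congr 1
    ring
  refine (((h (z + 1)).norm.add (h (z - 1)).norm).const_mul (k.factorial : ℝ)).mono' ?_
    (Eventually.of_forall fun x => ?_)
  · exact (by fun_prop : Continuous _).aestronglyMeasurable
  · simp only [Pi.add_apply]
    rw [norm_mul, norm_pow, Complex.norm_real, Real.norm_eq_abs]
    have e1 : ‖Complex.exp ((z + 1) * x - (x : ℂ) ^ 2)‖ =
        Real.exp x * ‖Complex.exp (z * x - (x : ℂ) ^ 2)‖ := by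
      rw [show (z + 1) * x - (x : ℂ) ^ 2 = (x : ℂ) + (z * x - (x : ℂ) ^ 2) by ring,
        Complex.exp_add, norm_mul, Complex.norm_exp_ofReal]
    have e2 : ‖Complex.exp ((z - 1) * x - (x : ℂ) ^ 2)‖ =
        Real.exp (-x) * ‖Complex.exp (z * x - (x : ℂ) ^ 2)‖ := by
      rw [show (z - 1) * x - (x : ℂ) ^ 2 = ((-x : ℝ) : ℂ) + (z * x - (x : ℂ) ^ 2) by
        push_cast; ring,
        Complex.exp_add, norm_mul, Complex.norm_exp_ofReal]
    rw [e1, e2, ← add_mul, ← mul_assoc]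
    refine mul_le_mul_of_nonneg_right ?_ (norm_nonneg _)
    have h3 := Real.pow_div_factorial_le_exp |x| (abs_nonneg x) k
    have h4 : Real.exp |x| ≤ Real.exp x + Real.exp (-x) := by
      rcases abs_cases x with ⟨h, _⟩ | ⟨h, _⟩ <;> rw [h] <;>
        linarith [Real.exp_pos x, Real.exp_pos (-x)]
    rw [div_le_iff₀ (by positivity)] at h3
    have h5 : (0 : ℝ) < k.factorial := by positivity
    nlinarith

theorem integrable_polynomial_mul_cexp_sub_sq (p : Polynomial ℝ) (z : ℂ) :
    Integrable fun x : ℝ => ((p.eval x : ℝ) : ℂ) * Complex.exp (z * x - (x : ℂ) ^ 2) := by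
  simp_rw [Polynomial.eval_eq_sum_range]
  push_cast
  simp_rw [Finset.sum_mul, mul_assoc]
  exact integrable_finsetSum _ fun k _ => (integrable_pow_mul_cexp_sub_sq k z).const_mul _

theorem exists_polynomial_eq_hermiteVal (n : ℕ) :
    ∃ p : Polynomial ℝ, ∀ x, hermiteVal n x = p.eval x := by
  refine ⟨((Polynomial.hermite n).map (Int.castRingHom ℝ)).comp
    (Polynomial.C √2 * Polynomial.X), fun x => ?_⟩
  simp [hermiteVal, Polynomial.eval_map, Polynomial.aeval_def]

theorem integrable_hermiteVal_mul (n m : ℕ) (z : ℂ) :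
    Integrable fun x : ℝ => ((hermiteVal n x * hermiteVal m x : ℝ) : ℂ) *
      Complex.exp (z * x - (x : ℂ) ^ 2) := by
  obtain ⟨p, hp⟩ := exists_polynomial_eq_hermiteVal n
  obtain ⟨q, hq⟩ := exists_polynomial_eq_hermiteVal m
  simpa [hp, hq] using integrable_polynomial_mul_cexp_sub_sq (p * q) z

/-- The unnormalised matrix element `∫ exp(z x - x²) Heₙ(√2 x) Heₘ(√2 x) dx`. -/
noncomputable def hermiteInt (z : ℂ) (n m : ℕ) : ℂ :=
  ∫ x : ℝ, ((hermiteVal n x * hermiteVal m x : ℝ) : ℂ) * Complex.exp (z * x - (x : ℂ) ^ 2)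

theorem hermiteInt_comm (z : ℂ) (n m : ℕ) : hermiteInt z n m = hermiteInt z m n := by
  simp only [hermiteInt, mul_comm (hermiteVal n _)]

/-- Integration by parts: the derivative of `Heₙ Heₘ exp(zx - x²)` has integral zero, and the
three-term recurrence merges `Heₙ' - 2x Heₙ` into `-√2 Heₙ₊₁`. -/
theorem sqrt_two_mul_hermiteInt_succ (z : ℂ) (n m : ℕ) :
    √2 * hermiteInt z (n + 1) m =
      z * hermiteInt z n m + √2 * m * hermiteInt z n (m - 1) := by
  have h := integral_eq_zero_of_hasDerivAt_of_integrable
    (f := fun x : ℝ => ((hermiteVal n x * hermiteVal m x : ℝ) : ℂ) *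
      Complex.exp (z * x - (x : ℂ) ^ 2))
    (f' := fun x : ℝ => z * (((hermiteVal n x * hermiteVal m x : ℝ) : ℂ) *
        Complex.exp (z * x - (x : ℂ) ^ 2)) +
      √2 * m * (((hermiteVal n x * hermiteVal (m - 1) x : ℝ) : ℂ) *
        Complex.exp (z * x - (x : ℂ) ^ 2)) -
      √2 * (((hermiteVal (n + 1) x * hermiteVal m x : ℝ) : ℂ) *
        Complex.exp (z * x - (x : ℂ) ^ 2))) (fun x => ?_) ?_
      (integrable_hermiteVal_mul n m z)
  · have hadd : Integrable fun x : ℝ => z * (((hermiteVal n x * hermiteVal m x : ℝ) : ℂ) *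
        Complex.exp (z * x - (x : ℂ) ^ 2)) +
        √2 * m * (((hermiteVal n x * hermiteVal (m - 1) x : ℝ) : ℂ) *
        Complex.exp (z * x - (x : ℂ) ^ 2)) :=
      ((integrable_hermiteVal_mul n m z).const_mul _).add
        ((integrable_hermiteVal_mul n (m - 1) z).const_mul _)
    rw [integral_sub hadd ((integrable_hermiteVal_mul (n + 1) m z).const_mul _),
      integral_add ((integrable_hermiteVal_mul n m z).const_mul _)
      ((integrable_hermiteVal_mul n (m - 1) z).const_mul _), integral_const_mul,
      integral_const_mul, integral_const_mul] at h
    exact (sub_eq_zero.1 h).symm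
  · have d1 := ((hasDerivAt_hermiteVal n x).mul (hasDerivAt_hermiteVal m x)).ofReal_comp
    have d2 : HasDerivAt (fun x : ℝ => Complex.exp (z * x - (x : ℂ) ^ 2))
        (Complex.exp (z * x - (x : ℂ) ^ 2) * (z - 2 * x)) x := by
      have d3 : HasDerivAt (fun x : ℂ => Complex.exp (z * x - x ^ 2))
          (Complex.exp (z * x - (x : ℂ) ^ 2) * (z - 2 * x)) (x : ℂ) := by
        refine (((hasDerivAt_id (x : ℂ)).const_mul z).sub (hasDerivAt_pow 2 _)).cexp.congr_deriv ?_
        simp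
      exact d3.comp_ofReal
    refine (d1.mul d2).congr_deriv ?_
    rw [hermiteVal_succ]
    have h2 : ((√2 : ℝ) : ℂ) * ((√2 : ℝ) : ℂ) = 2 := by
      rw [← Complex.ofReal_mul, Real.mul_self_sqrt (by norm_num)]; norm_num
    simp only [Pi.mul_apply]
    push_cast
    linear_combination (hermiteVal n x * hermiteVal m x *
      Complex.exp (z * x - (x : ℂ) ^ 2) * x) * h2
  · exact (((integrable_hermiteVal_mul n m z).const_mul _).add
      ((integrable_hermiteVal_mul n (m - 1) z).const_mul _)).sub
      ((integrable_hermiteVal_mul (n + 1) m z).const_mul _)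

theorem hermiteInt_zero_zero (z : ℂ) :
    hermiteInt z 0 0 = √Real.pi * Complex.exp (z ^ 2 / 4) := by
  have h := integral_cexp_quadratic (b := -1) (by simp) z 0
  simp only [hermiteInt, hermiteVal_zero]
  have e : (Real.pi : ℂ) ^ (1 / 2 : ℂ) = (√Real.pi : ℝ) := by
    rw [Real.sqrt_eq_rpow, Complex.ofReal_cpow Real.pi_pos.le]; norm_num
  calc _ = ∫ x : ℝ, Complex.exp (-1 * (x : ℂ) ^ 2 + z * x + 0) := by
        refine integral_congr_ae (Eventually.of_forall fun x => ?_)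
        simp only [mul_one, Complex.ofReal_one, one_mul]
        congr 1; ring
    _ = _ := by
        rw [h, ← e]
        simp
        congr 1; ring

/-- The polynomials `∑ⱼ C(n,j) c^(n-j) m(m-1)⋯(m-j+1) c^(m-j)`, the Taylor coefficients of
`exp(c(u+v) + uv)`, in recursive form. -/
noncomputable def charlier (c : ℂ) : ℕ → ℕ → ℂ
  | 0, m => c ^ m
  | n + 1, m => c * charlier c n m + m * charlier c n (m - 1)

/-- The generating function `exp(c(u+v) + uv)` is symmetric in `u` and `v`, so the defining
recursion also holds in the second index. At `n = 0` the truncated `n - 1` is harmless because of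
the factor `n`. -/
theorem charlier_succ_right (c : ℂ) (n m : ℕ) :
    charlier c n (m + 1) = c * charlier c n m + n * charlier c (n - 1) m := by
  induction n generalizing m with
  | zero => simp [charlier]; ring
  | succ n ih =>
    cases m with
    | zero =>
      simp only [charlier, ih]
      cases n with
      | zero => simp [charlier]
      | succ n => simp [charlier]; ring
    | succ m =>
      cases n with
      | zero => simp [charlier]; ring
      | succ n =>
        have h1 := ih (m + 1)
        have h2 := ih m
        have e1 : charlier c (n + 1 + 1) (m + 1 + 1) = c * charlier c (n + 1) (m + 1 + 1) +
          ((m + 1 + 1 : ℕ) : ℂ) * charlier c (n + 1) (m + 1) := rfl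
        have e2 : charlier c (n + 1 + 1) (m + 1) = c * charlier c (n + 1) (m + 1) +
          ((m + 1 : ℕ) : ℂ) * charlier c (n + 1) m := rfl
        have e3 : charlier c (n + 1) (m + 1) = c * charlier c n (m + 1) +
          ((m + 1 : ℕ) : ℂ) * charlier c n m := rfl
        simp only [Nat.add_sub_cancel] at h1 h2 ⊢
        push_cast at *
        linear_combination e1 - c * e2 + c * h1 + (m + 1) * h2 - (n + 1) * e3

/-- For `z = √2 c` the integration-by-parts recurrence, divided by `√2`, is the recursion of
`charlier`; the Gaussian integral supplies the prefactor. -/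
theorem hermiteInt_eq_charlier (c : ℂ) (n m : ℕ) :
    hermiteInt (√2 * c) n m = √Real.pi * Complex.exp (c ^ 2 / 2) * charlier c n m := by
  have hs : ((√2 : ℝ) : ℂ) ≠ 0 := by
    rw [Complex.ofReal_ne_zero]; positivity
  have h2 : ((√2 : ℝ) : ℂ) ^ 2 = 2 := by
    rw [← Complex.ofReal_pow, Real.sq_sqrt (by norm_num)]; norm_num
  have hrec : ∀ n m, hermiteInt (√2 * c) (n + 1) m =
      c * hermiteInt (√2 * c) n m + m * hermiteInt (√2 * c) n (m - 1) := fun n m => by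
    apply mul_left_cancel₀ hs
    rw [sqrt_two_mul_hermiteInt_succ]
    ring
  induction n generalizing m with
  | zero =>
    induction m with
    | zero =>
      rw [hermiteInt_zero_zero, charlier, mul_pow, h2]
      simp
      left; congr 1; ring
    | succ m ih =>
      rw [hermiteInt_comm, hrec, hermiteInt_comm, ih]
      simp [charlier]
      ring
  | succ n ih =>
    rw [hrec, ih, ih, charlier]
    ring

theorem charlier_zero (n m : ℕ) : charlier 0 n m = if n = m then (n.factorial : ℂ) else 0 := by
  induction n generalizing m with
  | zero =>
    cases m with
    | zero => simp [charlier]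
    | succ m => simp [charlier]
  | succ n ih =>
    cases m with
    | zero => simp [charlier]
    | succ m =>
      rw [charlier, ih, ih]
      by_cases h : n = m
      · subst h; simp [Nat.factorial_succ]
      · simp [h]

theorem charlier_conj (c : ℂ) (n m : ℕ) :
    charlier ((starRingEnd ℂ) c) n m = (starRingEnd ℂ) (charlier c n m) := by
  induction n generalizing m with
  | zero => simp [charlier]
  | succ n ih => simp [charlier, ih]

/-- The orthonormal Hermite functions. -/
noncomputable def hermiteFn (n : ℕ) (x : ℝ) : ℝ :=
  hermiteVal n x * Real.exp (-x ^ 2 / 2) / √(√Real.pi * n.factorial)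

theorem cexp_mul_hermiteFn (z : ℂ) (n m : ℕ) (x : ℝ) :
    Complex.exp (z * x) * ((hermiteFn n x * hermiteFn m x : ℝ) : ℂ) =
      ((√Real.pi * √(n.factorial * m.factorial) : ℝ) : ℂ)⁻¹ *
      (((hermiteVal n x * hermiteVal m x : ℝ) : ℂ) * Complex.exp (z * x - (x : ℂ) ^ 2)) := by
  have e1 : hermiteFn n x * hermiteFn m x =
      (√Real.pi * √(n.factorial * m.factorial))⁻¹ * (hermiteVal n x * hermiteVal m x) *
        Real.exp (-x ^ 2) := by
    have h1 : √(√Real.pi * n.factorial) * √(√Real.pi * m.factorial) =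
        √Real.pi * √(n.factorial * m.factorial) := by
      rw [← Real.sqrt_mul (by positivity), show √Real.pi * (n.factorial : ℝ) *
        (√Real.pi * m.factorial) = (√Real.pi * √Real.pi) * (n.factorial * m.factorial) by ring,
        Real.sqrt_mul (by positivity), Real.sqrt_mul_self (by positivity)]
    have h2 : Real.exp (-x ^ 2) = Real.exp (-x ^ 2 / 2) * Real.exp (-x ^ 2 / 2) := by
      rw [← Real.exp_add]; ring_nf
    rw [hermiteFn, hermiteFn, div_mul_div_comm, h1, h2]
    ring
  rw [e1, sub_eq_add_neg, Complex.exp_add]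
  push_cast
  ring

theorem hasElements_cexp (z : ℂ) : HasElements hermiteFn fun x => Complex.exp (z * x) := by
  intro n m
  simp only [cexp_mul_hermiteFn]
  exact (integrable_hermiteVal_mul n m z).const_mul _

theorem element_cexp (c : ℂ) (n m : ℕ) :
    element hermiteFn (fun x => Complex.exp (√2 * c * x)) n m =
      Complex.exp (c ^ 2 / 2) * charlier c n m / (√(n.factorial * m.factorial) : ℝ) := by
  simp only [element, cexp_mul_hermiteFn]
  rw [integral_const_mul]
  have := hermiteInt_eq_charlier c n m
  rw [hermiteInt] at this
  rw [this]
  have hp : ((√Real.pi : ℝ) : ℂ) ≠ 0 := by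
    rw [Complex.ofReal_ne_zero]; positivity
  push_cast
  field_simp

theorem hasElements_one : HasElements hermiteFn fun _ => 1 := by
  simpa using hasElements_cexp 0

theorem element_one (n m : ℕ) :
    element hermiteFn (fun _ => 1) n m = if n = m then 1 else 0 := by
  have h := element_cexp 0 n m
  simp only [mul_zero, zero_mul, Complex.exp_zero] at h
  rw [h, charlier_zero]
  split_ifs with hnm
  · subst hnm
    rw [Real.sqrt_mul_self (by positivity)]
    have : (n.factorial : ℂ) ≠ 0 := by exact_mod_cast n.factorial_ne_zero
    simp [this]
  · simp

/-- Norms factor out of the rows and Gaussians out of the columns; the remaining determinant of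
monic polynomials is Vandermonde's at the points `√2 xⱼ`. -/
theorem slater_hermiteFn_sq (N : ℕ) :
    ∃ C : ℝ, 0 < C ∧ ∀ x, slater hermiteFn N x ^ 2 = C * weight N x := by
  have hdet : ∀ y : Fin N → ℝ, (Matrix.of fun i j : Fin N =>
      Polynomial.aeval (y j) (Polynomial.hermite i)).det = ∏ i, ∏ j ∈ Finset.Ioi i, (y j - y i) := by
    intro y
    rw [← Matrix.det_vandermonde, Matrix.det_eval_matrixOfPolynomials_eq_det_vandermonde y
      (fun i => (Polynomial.hermite i).map (Int.castRingHom ℝ)) (fun i => ?_) (fun i => ?_),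
      ← Matrix.det_transpose]
    · congr 1
      ext i j
      simp [Polynomial.aeval_def, Polynomial.eval_map]
    · rw [(Polynomial.hermite_monic i).natDegree_map, Polynomial.natDegree_hermite]
    · exact (Polynomial.hermite_monic i).map _
  refine ⟨(∏ i : Fin N, (√(√Real.pi * (i : ℕ).factorial))⁻¹) ^ 2 *
    (∏ i : Fin N, ∏ j ∈ Finset.Ioi i, √2) ^ 2, by positivity, fun x => ?_⟩
  have h1 : slater hermiteFn N x = (∏ i : Fin N, (√(√Real.pi * (i : ℕ).factorial))⁻¹) *
      ((∏ j, Real.exp (-(x j) ^ 2 / 2)) *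
        ∏ i, ∏ j ∈ Finset.Ioi i, (√2 * x j - √2 * x i)) := by
    rw [← hdet fun j => √2 * x j, ← Matrix.det_mul_row, ← Matrix.det_mul_column, slater]
    congr 1
    ext i j
    simp only [Matrix.of_apply, hermiteFn, hermiteVal]
    ring
  have h2 : ∏ j, Real.exp (-(x j) ^ 2) = (∏ j, Real.exp (-(x j) ^ 2 / 2)) ^ 2 := by
    rw [← Finset.prod_pow]
    refine Finset.prod_congr rfl fun j _ => ?_
    rw [← Real.exp_nat_mul]
    congr 1
    push_cast; ring
  rw [h1, weight, h2]
  simp only [← mul_sub, Finset.prod_mul_distrib, Finset.prod_pow]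
  ring

/-- No evaluation of the partition function is needed: orthonormality gives `∫ slater² = N!`, and
the proportionality constant `C` cancels. -/
theorem density_eq_slater_sq (N : ℕ) (x : Fin N → ℝ) :
    weight N x / ∫ y, weight N y = slater hermiteFn N x ^ 2 / N.factorial := by
  obtain ⟨C, hC, h⟩ := slater_hermiteFn_sq N
  have hint := integral_prod_mul_slater_sq hermiteFn N (fun _ _ => 1)
    (fun j i k => hasElements_one i k)
  simp only [Finset.prod_const_one, one_mul, element_one] at hint
  rw [integral_complex_ofReal] at hint
  have hval : ∫ x, slater hermiteFn N x ^ 2 = N.factorial := by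
    have h3 : ∑ σ : Equiv.Perm (Fin N), ∑ τ : Equiv.Perm (Fin N),
        ((Equiv.Perm.sign σ : ℤ) : ℂ) * ((Equiv.Perm.sign τ : ℤ) : ℂ) *
        ∏ j, (if (σ j : ℕ) = τ j then (1 : ℂ) else 0) = N.factorial := by
      have h4 : ∀ σ τ : Equiv.Perm (Fin N),
          ∏ j, (if (σ j : ℕ) = τ j then (1 : ℂ) else 0) = if σ = τ then 1 else 0 := by
        intro σ τ
        rw [Finset.prod_ite_zero]
        simp [Fin.ext_iff, Equiv.ext_iff]
      simp only [h4, mul_ite, mul_one, mul_zero, Finset.sum_ite_eq, Finset.mem_univ, if_true]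
      have h5 : ∀ σ : Equiv.Perm (Fin N),
          ((Equiv.Perm.sign σ : ℤ) : ℂ) * ((Equiv.Perm.sign σ : ℤ) : ℂ) = 1 := fun σ => by
        rcases Int.units_eq_one_or (Equiv.Perm.sign σ) with h | h <;> simp [h]
      simp [h5, Fintype.card_perm]
    rw [h3] at hint
    exact_mod_cast hint
  have h6 : C * ∫ y, weight N y = N.factorial := by
    rw [← hval, ← integral_const_mul]
    simp only [h]
  have hZ := integral_weight_pos N
  rw [h, ← h6]
  field_simp

/-! ### Generating functions of squared matrix elements -/

/-- The Taylor coefficients of `exp(α u + β v + r u v)`, in recursive form. -/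
noncomputable def biCharlier (α β r : ℂ) : ℕ → ℕ → ℂ
  | 0, l => β ^ l
  | n + 1, l => α * biCharlier α β r n l + r * l * biCharlier α β r n (l - 1)

theorem biCharlier_one (α : ℂ) (n l : ℕ) : biCharlier α α 1 n l = charlier α n l := by
  induction n generalizing l with
  | zero => rfl
  | succ n ih => simp [biCharlier, charlier, ih]

/-- The factor `m` cancels against `m!`, and the index shift costs one power of `r`. -/
theorem hasSum_pow_div_factorial_shift {r S : ℂ} {h : ℕ → ℂ}
    (hh : HasSum (fun m => r ^ m / m.factorial * h m) S) :
    HasSum (fun m : ℕ => r ^ m / m.factorial * (m * h (m - 1))) (r * S) := by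
  rw [← hasSum_nat_add_iff' 1]
  simp only [Finset.range_one, Finset.sum_singleton, Nat.cast_zero, zero_mul, mul_zero, sub_zero]
  refine (hh.mul_left r).congr_fun fun m => ?_
  have h1 : (m.factorial : ℂ) ≠ 0 := by exact_mod_cast m.factorial_ne_zero
  have h2 : (m + 1 : ℂ) ≠ 0 := by exact_mod_cast m.succ_ne_zero
  rw [Nat.factorial_succ, Nat.add_sub_cancel]
  push_cast
  field_simp
  ring

/-- A Mehler-type formula. On generating functions in `u, v` it says `∑ rᵐ/m! (c+u)ᵐ (d+v)ᵐ
exp(cu+dv) = exp(rcd + (c+rd)u + (d+rc)v + ruv)`. The induction runs coefficientwise, the recursion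
in the first index lowering `m` and the one in the second index restoring it. -/
theorem hasSum_charlier_mul_charlier (c d r : ℂ) (n l : ℕ) :
    HasSum (fun m : ℕ => r ^ m / m.factorial * (charlier c n m * charlier d l m))
      (Complex.exp (r * c * d) * biCharlier (c + r * d) (d + r * c) r n l) := by
  induction n generalizing l with
  | zero =>
    induction l with
    | zero =>
      have h := NormedSpace.expSeries_div_hasSum_exp (r * c * d)
      rw [← Complex.exp_eq_exp_ℂ] at h
      simp only [biCharlier, pow_zero, mul_one]
      refine h.congr_fun fun m => ?_
      simp only [charlier]
      ring
    | succ l ih =>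
      have h1 := ih.mul_left d
      have hh : HasSum (fun m : ℕ => r ^ m / m.factorial *
          (c * (charlier c 0 m * charlier d l m)))
          (c * (Complex.exp (r * c * d) * biCharlier (c + r * d) (d + r * c) r 0 l)) :=
        (ih.mul_left c).congr_fun fun m => by ring
      have h2 := hasSum_pow_div_factorial_shift hh
      convert! h1.add h2 using 1
      · funext m
        cases m with
        | zero => simp [charlier]
        | succ m =>
          simp only [charlier, Nat.add_sub_cancel]
          ring
      · simp only [biCharlier]
        ring
  | succ n ih =>
    have hh : HasSum (fun m : ℕ => r ^ m / m.factorial * (charlier c n m * charlier d l (m + 1)))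
        (Complex.exp (r * c * d) * (d * biCharlier (c + r * d) (d + r * c) r n l +
          l * biCharlier (c + r * d) (d + r * c) r n (l - 1))) := by
      convert! ((ih l).mul_left d).add ((ih (l - 1)).mul_left (l : ℂ)) using 1
      · funext m
        rw [charlier_succ_right]
        ring
      · ring
    have h2 := hasSum_pow_div_factorial_shift hh
    convert! ((ih l).mul_left c).add h2 using 1
    · funext m
      cases m with
      | zero => simp [charlier]; ring
      | succ m =>
        rw [charlier]
        simp only [Nat.add_sub_cancel]
        ring
    · rw [biCharlier]
      ring

/-- The lowering operator `f ↦ (l ↦ l f(l-1))` on sequences. -/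
def lowering : Module.End ℂ (ℕ → ℂ) where
  toFun f l := l * f (l - 1)
  map_add' f g := by funext l; simp [mul_add]
  map_smul' a f := by funext l; simp; ring

theorem lowering_pow_apply (j : ℕ) (f : ℕ → ℂ) (l : ℕ) :
    (lowering ^ j) f l = l.descFactorial j * f (l - j) := by
  induction j generalizing l with
  | zero => simp
  | succ j ih =>
    rw [pow_succ', Module.End.mul_apply]
    simp only [lowering, LinearMap.coe_mk, AddHom.coe_mk] at ih ⊢
    rw [ih]
    cases l with
    | zero => simp
    | succ l =>
      rw [Nat.succ_descFactorial_succ, Nat.add_sub_cancel, Nat.add_sub_add_right]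
      push_cast
      ring

/-- The recursion in `n` applies the operator `r • lowering + α` repeatedly to `l ↦ β ^ l`; the two
summands commute, so the binomial theorem gives the closed form. -/
theorem biCharlier_eq_sum (α β r : ℂ) (n l : ℕ) :
    biCharlier α β r n l = ∑ j ∈ Finset.range (n + 1),
      r ^ j * α ^ (n - j) * n.choose j * (l.descFactorial j * β ^ (l - j)) := by
  have h : biCharlier α β r n = ((r • lowering + α • 1) ^ n) fun l => β ^ l := by
    induction n with
    | zero => funext l; simp [biCharlier]
    | succ n ih =>
      rw [pow_succ', Module.End.mul_apply, ← ih]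
      funext l
      simp only [biCharlier, lowering, LinearMap.add_apply, LinearMap.smul_apply,
        LinearMap.coe_mk, AddHom.coe_mk, Pi.add_apply, Pi.smul_apply, Module.End.one_apply,
        smul_eq_mul]
      ring
  have hc : Commute (r • lowering) (α • (1 : Module.End ℂ (ℕ → ℂ))) :=
    (Commute.one_right _).smul_right α
  rw [h, hc.add_pow, LinearMap.sum_apply, Finset.sum_apply]
  refine Finset.sum_congr rfl fun j _ => ?_
  rw [smul_pow, smul_pow, one_pow, ← nsmul_eq_mul', LinearMap.smul_apply, Module.End.mul_apply,
    LinearMap.smul_apply, LinearMap.smul_apply, Module.End.one_apply, map_smul]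
  simp only [Pi.smul_apply, lowering_pow_apply, smul_eq_mul, nsmul_eq_mul]
  ring

/-- On the diagonal the powers of `α` and `β` pair up, so only `α β` enters. The antidiagonal form
lets a later sum over `n` become a sum over two independent indices. -/
theorem biCharlier_diag_div_factorial (α β r : ℂ) (n : ℕ) :
    biCharlier α β r n n / n.factorial = ∑ p ∈ Finset.HasAntidiagonal.antidiagonal n,
      ((p.1 + p.2).choose p.1 : ℂ) * r ^ p.1 * (α * β) ^ p.2 / p.2.factorial := by
  rw [biCharlier_eq_sum, Finset.sum_div, Finset.Nat.sum_antidiagonal_eq_sum_range_succ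
    (fun i j => ((i + j).choose i : ℂ) * r ^ i * (α * β) ^ j / j.factorial)]
  refine Finset.sum_congr rfl fun j hj => ?_
  have hjn : j ≤ n := Nat.lt_succ_iff.1 (Finset.mem_range.1 hj)
  rw [Nat.add_sub_cancel' hjn]
  have h1 : ((n - j).factorial : ℂ) * n.descFactorial j = n.factorial := by
    exact_mod_cast Nat.factorial_mul_descFactorial hjn
  have h2 : ((n - j).factorial : ℂ) ≠ 0 := by exact_mod_cast (n - j).factorial_ne_zero
  have h3 : (n.factorial : ℂ) ≠ 0 := by exact_mod_cast n.factorial_ne_zero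
  rw [div_eq_div_iff h3 h2, ← h1, mul_pow]
  ring

/-- The negative binomial series sums the first index, the exponential series the second;
nonnegativity gives joint summability. -/
theorem hasSum_choose_mul_pow_div_factorial {q x : ℝ} (hq : 0 ≤ q) (hq1 : q < 1) (hx : 0 ≤ x) :
    HasSum (fun p : ℕ × ℕ => ((p.1 + p.2).choose p.1 : ℝ) * q ^ p.1 * (x ^ p.2 / p.2.factorial))
      (1 / (1 - q) * Real.exp (x / (1 - q))) := by
  have h1 : ∀ j : ℕ, HasSum (fun i : ℕ => ((i + j).choose i : ℝ) * q ^ i *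
      (x ^ j / j.factorial)) (1 / (1 - q) ^ (j + 1) * (x ^ j / j.factorial)) := fun j => by
    have := (hasSum_choose_mul_geometric_of_norm_lt_one j
      (by rwa [Real.norm_of_nonneg hq] : ‖q‖ < 1)).mul_right (x ^ j / j.factorial)
    refine this.congr_fun fun i => ?_
    rw [Nat.choose_symm_add]
  have h2 : HasSum (fun j : ℕ => 1 / (1 - q) ^ (j + 1) * (x ^ j / j.factorial))
      (1 / (1 - q) * Real.exp (x / (1 - q))) := by
    have h := NormedSpace.expSeries_div_hasSum_exp (x / (1 - q))
    rw [← Real.exp_eq_exp_ℝ] at h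
    refine (h.mul_left (1 / (1 - q))).congr_fun fun j => ?_
    rw [div_pow, pow_succ]
    field_simp
  have hs : Summable fun p : ℕ × ℕ => ((p.2 + p.1).choose p.2 : ℝ) * q ^ p.2 *
      (x ^ p.1 / p.1.factorial) := by
    rw [summable_prod_of_nonneg (fun p => by positivity)]
    refine ⟨fun j => (h1 j).summable, ?_⟩
    simp only [(h1 _).tsum_eq]
    exact h2.summable
  have h3 := (hs.hasSum.prod_fiberwise h1).unique h2
  rw [← h3]
  exact (Equiv.prodComm ℕ ℕ).hasSum_iff.1 hs.hasSum

/-- The squared modulus of the matrix element of `exp(√2 c x)`. -/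
noncomputable def elementSq (c : ℂ) (n m : ℕ) : ℝ :=
  Real.exp (c ^ 2).re * ‖charlier c n m‖ ^ 2 / (n.factorial * m.factorial)

theorem elementSq_nonneg (c : ℂ) (n m : ℕ) : 0 ≤ elementSq c n m := by
  unfold elementSq
  positivity

theorem ofReal_elementSq (c : ℂ) (n m : ℕ) :
    (elementSq c n m : ℂ) = Complex.exp ((c ^ 2).re) *
      (charlier c n m * charlier ((starRingEnd ℂ) c) n m) / (n.factorial * m.factorial) := by
  rw [elementSq, charlier_conj, Complex.mul_conj, Complex.normSq_eq_norm_sq]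
  push_cast
  ring

theorem hasSum_elementSq_row (c : ℂ) (r : ℝ) (n : ℕ) :
    HasSum (fun m : ℕ => ((r ^ m * elementSq c n m : ℝ) : ℂ))
      (Complex.exp ((c ^ 2).re + r * ‖c‖ ^ 2) *
        (biCharlier (c + r * (starRingEnd ℂ) c) ((starRingEnd ℂ) c + r * c) r n n /
          n.factorial)) := by
  have h := (hasSum_charlier_mul_charlier c ((starRingEnd ℂ) c) r n n).mul_left
    (Complex.exp ((c ^ 2).re) / n.factorial)
  have e : (r : ℂ) * c * (starRingEnd ℂ) c = r * ‖c‖ ^ 2 := by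
    rw [mul_assoc, Complex.mul_conj, Complex.normSq_eq_norm_sq]; push_cast; ring
  rw [e] at h
  convert! h using 1
  · funext m
    rw [Complex.ofReal_mul, ofReal_elementSq, Complex.ofReal_pow]
    field_simp
  · rw [Complex.exp_add]
    ring

/-- The bilinear formula with `d = c̄` sums each row, with `α β = |α|²` real. Distributing `sⁿ` over
the antidiagonal of `n` then gives the double series with `q = r s` and `x = s |α|²`. -/
theorem hasSum_elementSq (c : ℂ) {r s : ℝ} (hr : 0 ≤ r) (hs : 0 ≤ s) (hrs : r * s < 1) :
    HasSum (fun p : ℕ × ℕ => s ^ p.1 * r ^ p.2 * elementSq c p.1 p.2)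
      (1 / (1 - r * s) * Real.exp ((c ^ 2).re + r * ‖c‖ ^ 2 +
        s * ‖c + r * (starRingEnd ℂ) c‖ ^ 2 / (1 - r * s))) := by
  set α := c + r * (starRingEnd ℂ) c with hα
  have hαβ : α * ((starRingEnd ℂ) c + r * c) = ((‖α‖ ^ 2 : ℝ) : ℂ) := by
    rw [← Complex.normSq_eq_norm_sq, ← Complex.mul_conj, hα]
    simp
  set K := Real.exp ((c ^ 2).re + r * ‖c‖ ^ 2) with hK
  set D : ℕ → ℝ := fun n => ∑ p ∈ Finset.HasAntidiagonal.antidiagonal n,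
    ((p.1 + p.2).choose p.1 : ℝ) * r ^ p.1 * (‖α‖ ^ 2) ^ p.2 / p.2.factorial with hD
  have hrow : ∀ n, HasSum (fun m : ℕ => r ^ m * elementSq c n m) (K * D n) := fun n => by
    have h := hasSum_elementSq_row c r n
    rw [biCharlier_diag_div_factorial, ← hα, hαβ] at h
    rw [← Complex.hasSum_ofReal]
    convert! h using 1
    simp only [hK, hD]
    push_cast
    rfl
  have hq := hasSum_choose_mul_pow_div_factorial (q := r * s) (x := s * ‖α‖ ^ 2)
    (by positivity) hrs (by positivity)
  have hdiag : HasSum (fun n => s ^ n * D n)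
      (1 / (1 - r * s) * Real.exp (s * ‖α‖ ^ 2 / (1 - r * s))) := by
    have h := (Finset.HasAntidiagonal.sigmaAntidiagonalEquivProd.hasSum_iff.2 hq).sigma
      (fun n => hasSum_fintype _)
    refine h.congr_fun fun n => ?_
    simp only [Function.comp, Finset.HasAntidiagonal.sigmaAntidiagonalEquivProd_apply]
    rw [Finset.sum_coe_sort (Finset.HasAntidiagonal.antidiagonal n) (fun p : ℕ × ℕ =>
      ((p.1 + p.2).choose p.1 : ℝ) * (r * s) ^ p.1 * ((s * ‖α‖ ^ 2) ^ p.2 / p.2.factorial)),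
      hD, Finset.mul_sum]
    refine Finset.sum_congr rfl fun p hp => ?_
    rw [← Finset.HasAntidiagonal.mem_antidiagonal.1 hp, pow_add, mul_pow, mul_pow s]
    ring
  have htot : HasSum (fun n => s ^ n * (K * D n)) (1 / (1 - r * s) *
      Real.exp ((c ^ 2).re + r * ‖c‖ ^ 2 + s * ‖α‖ ^ 2 / (1 - r * s))) := by
    convert! hdiag.mul_left K using 1
    · funext n; ring
    · rw [hK, Real.exp_add ((c ^ 2).re + r * ‖c‖ ^ 2)]; ring
  have hrow' : ∀ n, HasSum (fun m : ℕ => s ^ n * r ^ m * elementSq c n m) (s ^ n * (K * D n)) :=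
    fun n => ((hrow n).mul_left (s ^ n)).congr_fun fun m => by ring
  have hsum : Summable fun p : ℕ × ℕ => s ^ p.1 * r ^ p.2 * elementSq c p.1 p.2 := by
    rw [summable_prod_of_nonneg
      (fun p => mul_nonneg (by positivity) (elementSq_nonneg c _ _))]
    refine ⟨fun n => (hrow' n).summable, ?_⟩
    simp only [(hrow' _).tsum_eq]
    exact htot.summable
  rw [← (hsum.hasSum.prod_fiberwise hrow').unique htot]
  exact hsum.hasSum

/-! ### The covariance as a sum over squared matrix elements -/

theorem expStat_eq (N : ℕ) (k c : ℂ) (h : Complex.I * k = √2 * c) :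
    expStat N k = fun x => ∑ a, Complex.exp (√2 * c * (x a : ℂ)) := by
  funext x
  simp only [expStat, h]

theorem exp_mul_charlier_conj (c : ℂ) (n m : ℕ) :
    element hermiteFn (fun x => Complex.exp (√2 * c * x)) n m *
      element hermiteFn (fun x => Complex.exp (√2 * (starRingEnd ℂ) c * x)) m n =
      elementSq c n m := by
  have hcomm : element hermiteFn (fun x => Complex.exp (√2 * (starRingEnd ℂ) c * x)) m n =
      element hermiteFn (fun x => Complex.exp (√2 * (starRingEnd ℂ) c * x)) n m := by
    simp only [element, mul_comm (hermiteFn m _)]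
  have hs : ((√(n.factorial * m.factorial) : ℝ) : ℂ) * ((√(n.factorial * m.factorial) : ℝ) : ℂ) =
      n.factorial * m.factorial := by
    rw [← Complex.ofReal_mul, Real.mul_self_sqrt (by positivity)]; push_cast; rfl
  have he : Complex.exp (c ^ 2 / 2) * Complex.exp ((starRingEnd ℂ) c ^ 2 / 2) =
      Complex.exp ((c ^ 2).re) := by
    rw [← Complex.exp_add]
    congr 1
    rw [← map_pow, ← add_div, Complex.add_conj]
    push_cast; ring
  rw [hcomm, element_cexp, element_cexp, div_mul_div_comm, hs, ofReal_elementSq, ← he]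
  ring

/-- Parseval's identity for one row. It is the bilinear formula at `r = 1`, where both parameters
become `c + c̄`, so completeness of the Hermite functions is not used. -/
theorem element_cexp_add_conj (c : ℂ) (n : ℕ) :
    HasSum (fun m => ((elementSq c n m : ℝ) : ℂ)) (element hermiteFn (fun x =>
      Complex.exp (√2 * c * x) * Complex.exp (√2 * (starRingEnd ℂ) c * x)) n n) := by
  have h := hasSum_elementSq_row c 1 n
  simp only [one_pow, one_mul, Complex.ofReal_one] at h
  convert! h using 1
  have e : (fun x : ℝ => Complex.exp (√2 * c * x) * Complex.exp (√2 * (starRingEnd ℂ) c * x)) =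
      fun x : ℝ => Complex.exp (√2 * (c + (starRingEnd ℂ) c) * x) := by
    funext x
    rw [← Complex.exp_add]
    ring_nf
  rw [e, element_cexp, add_comm ((starRingEnd ℂ) c) c, biCharlier_one,
    Real.sqrt_mul_self (by positivity), mul_div_assoc]
  congr 2
  have h2 : ((c ^ 2).re : ℂ) = (c ^ 2 + (starRingEnd ℂ) c ^ 2) / 2 := by
    rw [← map_pow, Complex.add_conj]; push_cast; ring
  have h3 : (‖c‖ : ℂ) ^ 2 = c * (starRingEnd ℂ) c := by
    rw [Complex.mul_conj, Complex.normSq_eq_norm_sq]; push_cast; rfl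
  rw [h2, h3]
  ring

/-- The one-body term is a full row sum by `element_cexp_add_conj`, so the covariance is the weight
of transitions leaving the first `N` levels. -/
theorem cov_expStat (N : ℕ) (k l c : ℂ) (hk : Complex.I * k = √2 * c)
    (hl : Complex.I * l = √2 * (starRingEnd ℂ) c) :
    cov N (expStat N k) (expStat N l) =
      ((∑ i ∈ Finset.range N, (∑' m, elementSq c i m - ∑ j ∈ Finset.range N, elementSq c i j) :
        ℝ) : ℂ) := by
  rw [expStat_eq N k c hk, expStat_eq N l _ hl,
    cov_linearStat hermiteFn N (density_eq_slater_sq N) element_one hasElements_one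
    (fun x => Complex.exp (√2 * c * x)) (fun x => Complex.exp (√2 * (starRingEnd ℂ) c * x))
    (hasElements_cexp _) (hasElements_cexp _)]
  · push_cast
    rw [Finset.sum_sub_distrib]
    congr 1
    · refine Finset.sum_congr rfl fun i _ => ?_
      exact (element_cexp_add_conj c i).tsum_eq.symm
    · refine Finset.sum_congr rfl fun i _ => Finset.sum_congr rfl fun j _ => ?_
      rw [exp_mul_charlier_conj]
  · have := hasElements_cexp (√2 * c + √2 * (starRingEnd ℂ) c)
    simpa only [add_mul, Complex.exp_add] using this

end GUE

namespace GUE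

/-! ### Convergence of measures from convergence of moments -/

open unitInterval

/-- The coordinate functions of the unit square. -/
def fstMap : C(I × I, ℝ) := ⟨fun p => (p.1 : ℝ), by fun_prop⟩

/-- The coordinate functions of the unit square. -/
def sndMap : C(I × I, ℝ) := ⟨fun p => (p.2 : ℝ), by fun_prop⟩

theorem integrable_continuousMap {K : Type*} [TopologicalSpace K] [CompactSpace K]
    [MeasurableSpace K] [BorelSpace K] (ρ : Measure K) [IsFiniteMeasure ρ]
    (f : C(K, ℝ)) : Integrable (fun p => f p) ρ :=
  Integrable.of_bound f.continuous.measurable.aestronglyMeasurable ‖f‖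
    (Eventually.of_forall fun p => f.norm_coe_le_norm p)

theorem abs_integral_sub_integral_le {K : Type*} [TopologicalSpace K] [CompactSpace K]
    [MeasurableSpace K] [BorelSpace K] (ρ : Measure K) [IsFiniteMeasure ρ] (f g : C(K, ℝ)) :
    |∫ p, f p ∂ρ - ∫ p, g p ∂ρ| ≤ ‖f - g‖ * ρ.real Set.univ := by
  rw [← integral_sub (integrable_continuousMap ρ f) (integrable_continuousMap ρ g),
    ← Real.norm_eq_abs]
  exact norm_integral_le_of_norm_le_const (Eventually.of_forall fun p => (f - g).norm_coe_le_norm p)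

/-- Polynomials are dense in `C(I × I, ℝ)` by Stone–Weierstrass, and the zeroth moment controls the
total masses, so uniform approximation passes to the limit. -/
theorem tendsto_integral_of_tendsto_moments (ρ : ℕ → Measure (I × I)) (ρ' : Measure (I × I))
    [∀ n, IsFiniteMeasure (ρ n)] [IsFiniteMeasure ρ']
    (h : ∀ i j : ℕ, Tendsto (fun n => ∫ p : I × I, (p.1 : ℝ) ^ i * (p.2 : ℝ) ^ j ∂ρ n) atTop
      (𝓝 (∫ p : I × I, (p.1 : ℝ) ^ i * (p.2 : ℝ) ^ j ∂ρ'))) (f : C(I × I, ℝ)) :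
    Tendsto (fun n => ∫ p, f p ∂ρ n) atTop (𝓝 (∫ p, f p ∂ρ')) := by
  have hspan : ∀ g ∈ Algebra.adjoin ℝ ({fstMap, sndMap} : Set C(I × I, ℝ)),
      Tendsto (fun n => ∫ p, g p ∂ρ n) atTop (𝓝 (∫ p, g p ∂ρ')) := by
    intro g hg
    rw [← Subalgebra.mem_toSubmodule, Algebra.adjoin_eq_span] at hg
    induction hg using Submodule.span_induction with
    | mem g hg =>
      obtain ⟨i, j, rfl⟩ := (Submonoid.mem_closure_pair _ _ _).1 hg
      exact h i j
    | zero => simp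
    | add g₁ g₂ _ _ h₁ h₂ =>
      simp only [ContinuousMap.add_apply]
      simp_rw [fun n => integral_add (integrable_continuousMap (ρ n) g₁)
        (integrable_continuousMap (ρ n) g₂), integral_add (integrable_continuousMap ρ' g₁)
        (integrable_continuousMap ρ' g₂)]
      exact h₁.add h₂
    | smul a g _ hg =>
      simp only [ContinuousMap.smul_apply, integral_smul]
      exact hg.const_smul a
  have hdense := ContinuousMap.subalgebra_topologicalClosure_eq_top_of_separatesPoints
    (Algebra.adjoin ℝ ({fstMap, sndMap} : Set C(I × I, ℝ))) (by
      intro p q hpq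
      by_cases h1 : p.1 = q.1
      · refine ⟨_, ⟨sndMap, Algebra.subset_adjoin (by simp), rfl⟩, fun hcon => hpq ?_⟩
        exact Prod.ext h1 (Subtype.ext hcon)
      · exact ⟨_, ⟨fstMap, Algebra.subset_adjoin (by simp), rfl⟩,
          fun hcon => h1 (Subtype.ext hcon)⟩)
  have hmass : Tendsto (fun n => (ρ n).real Set.univ) atTop (𝓝 (ρ'.real Set.univ)) := by
    simpa using h 0 0
  rw [Metric.tendsto_atTop]
  intro ε hε
  -- `C` eventually bounds all the masses, so an approximation within `ε / (3C)` costs at most `ε /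
  -- 3` in each integral.
  set C := ρ'.real Set.univ + 1 with hC
  have hCpos : 0 < C := by have : 0 ≤ ρ'.real Set.univ := measureReal_nonneg; linarith
  obtain ⟨g, hg, hfg⟩ : ∃ g ∈ Algebra.adjoin ℝ ({fstMap, sndMap} : Set C(I × I, ℝ)),
      ‖f - g‖ < ε / (3 * C) := by
    have hf : f ∈ (Algebra.adjoin ℝ ({fstMap, sndMap} : Set C(I × I, ℝ))).topologicalClosure := by
      rw [hdense]; trivial
    rw [← SetLike.mem_coe, Subalgebra.topologicalClosure_coe, Metric.mem_closure_iff] at hf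
    obtain ⟨g, hg, hd⟩ := hf (ε / (3 * C)) (by positivity)
    exact ⟨g, hg, by rwa [dist_eq_norm] at hd⟩
  have h1 := (Metric.tendsto_atTop.1 (hspan g hg)) (ε / 3) (by positivity)
  obtain ⟨n₁, h1⟩ := h1
  obtain ⟨n₂, h2⟩ := eventually_atTop.1
    (hmass.eventually_lt_const (show ρ'.real Set.univ < C by linarith))
  refine ⟨max n₁ n₂, fun n hn => ?_⟩
  have a1 := h1 n (le_of_max_le_left hn)
  have a2 := h2 n (le_of_max_le_right hn)
  have b1 := abs_integral_sub_integral_le (ρ n) f g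
  have b2 := abs_integral_sub_integral_le ρ' f g
  have c0 : ε / (3 * C) * C = ε / 3 := by field_simp
  have c1 : ‖f - g‖ * (ρ n).real Set.univ ≤ ε / 3 := by
    rw [← c0]; gcongr
  have c2 : ‖f - g‖ * ρ'.real Set.univ < ε / 3 := by
    rw [← c0]
    exact mul_lt_mul'' hfg (by linarith) (norm_nonneg _) measureReal_nonneg
  rw [Real.dist_eq] at a1 ⊢
  rw [abs_lt] at *
  rw [abs_le] at *
  constructor <;> linarith [a1.1, a1.2, b1.1, b1.2, b2.1, b2.2]

/-- The portmanteau theorem for probability measures, transferred by normalisation; a zero limit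
cannot be normalised, but then the masses tend to zero. -/
theorem tendsto_apply_of_null_frontier {K : Type*} [MeasurableSpace K] [TopologicalSpace K]
    [OpensMeasurableSpace K] [HasOuterApproxClosed K] [Nonempty K]
    {χ : ℕ → FiniteMeasure K} {χ' : FiniteMeasure K} (h : Tendsto χ atTop (𝓝 χ')) {E : Set K}
    (hE : χ' (frontier E) = 0) : Tendsto (fun n => χ n E) atTop (𝓝 (χ' E)) := by
  by_cases h0 : χ' = 0
  · subst h0
    have hm := h.mass
    simp only [FiniteMeasure.zero_mass] at hm
    refine tendsto_of_tendsto_of_tendsto_of_le_of_le tendsto_const_nhds hm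
      (fun n => by simp) (fun n => (χ n).apply_le_mass E)
  · have h1 := FiniteMeasure.tendsto_normalize_of_tendsto h h0
    have h2 : χ'.normalize (frontier E) = 0 := by
      have := χ'.self_eq_mass_mul_normalize (frontier E)
      rw [hE] at this
      exact (mul_eq_zero.1 this.symm).resolve_left ((FiniteMeasure.mass_nonzero_iff _).2 h0)
    have h3 := ProbabilityMeasure.tendsto_measure_of_null_frontier_of_tendsto h1 h2
    have h4 := h.mass.mul h3
    simpa only [← FiniteMeasure.self_eq_mass_mul_normalize] using h4

/-- The map into the unit square with given coordinates. -/
def squareMap {Ω : Type*} (U V : Ω → ℝ) (hU : ∀ ω, U ω ∈ I) (hV : ∀ ω, V ω ∈ I) (ω : Ω) : I × I :=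
  (⟨U ω, hU ω⟩, ⟨V ω, hV ω⟩)

theorem measurable_squareMap {Ω : Type*} [MeasurableSpace Ω] {U V : Ω → ℝ}
    (hU : ∀ ω, U ω ∈ I) (hV : ∀ ω, V ω ∈ I) (mU : Measurable U) (mV : Measurable V) :
    Measurable (squareMap U V hU hV) :=
  (mU.subtype_mk).prodMk (mV.subtype_mk)

/-- The image in the unit square of a measure with density `w`. -/
noncomputable def squareMeasure {Ω : Type*} [MeasurableSpace Ω] (μ : Measure Ω) (U V w : Ω → ℝ)
    (hU : ∀ ω, U ω ∈ I) (hV : ∀ ω, V ω ∈ I) : Measure (I × I) :=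
  (μ.withDensity fun ω => ENNReal.ofReal (w ω)).map (squareMap U V hU hV)

theorem integral_squareMeasure {Ω : Type*} [MeasurableSpace Ω] (μ : Measure Ω) {U V w : Ω → ℝ}
    (hU : ∀ ω, U ω ∈ I) (hV : ∀ ω, V ω ∈ I) (mU : Measurable U) (mV : Measurable V)
    (mw : Measurable w) (hw : ∀ ω, 0 ≤ w ω) (f : C(I × I, ℝ)) :
    ∫ p, f p ∂squareMeasure μ U V w hU hV = ∫ ω, w ω * f (squareMap U V hU hV ω) ∂μ := by
  rw [squareMeasure, integral_map (measurable_squareMap hU hV mU mV).aemeasurable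
    f.continuous.measurable.aestronglyMeasurable,
    integral_withDensity_eq_integral_toReal_smul mw.ennreal_ofReal
      (Eventually.of_forall fun ω => ENNReal.ofReal_lt_top)]
  simp only [ENNReal.toReal_ofReal (hw _), smul_eq_mul]

theorem isFiniteMeasure_squareMeasure {Ω : Type*} [MeasurableSpace Ω] (μ : Measure Ω)
    {U V w : Ω → ℝ} (hU : ∀ ω, U ω ∈ I) (hV : ∀ ω, V ω ∈ I) (iw : Integrable w μ) :
    IsFiniteMeasure (squareMeasure μ U V w hU hV) := by
  have := isFiniteMeasure_withDensity_ofReal iw.2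
  exact Measure.isFiniteMeasure_map _ _

/-- The continuous function `(u, v) ↦ 1 / max u θ` on the unit square. -/
noncomputable def invMaxMap (θ : ℝ) (hθ : 0 < θ) : C(I × I, ℝ) :=
  ⟨fun p => (max (p.1 : ℝ) θ)⁻¹,
    Continuous.inv₀ (by fun_prop) fun _ => (lt_max_of_lt_right hθ).ne'⟩

/-- `μ` need not be finite, but `U dμ` is. The bounded continuous factor `1 / max U θ` preserves
weak convergence and undoes the weight `U` wherever `U ≥ θ`. -/
theorem squareMeasure_reweight {Ω : Type*} [MeasurableSpace Ω] (μ : Measure Ω) {U V : Ω → ℝ}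
    (hU : ∀ ω, U ω ∈ I) (hV : ∀ ω, V ω ∈ I) (mU : Measurable U) (mV : Measurable V)
    (iU : Integrable U μ) (θ : ℝ) (hθ : 0 < θ) :
    IsFiniteMeasure (squareMeasure μ U V (fun ω => U ω * (max (U ω) θ)⁻¹) hU hV) ∧
    (∀ f : C(I × I, ℝ), ∫ p, f p ∂squareMeasure μ U V (fun ω => U ω * (max (U ω) θ)⁻¹) hU hV =
      ∫ p, (invMaxMap θ hθ * f) p ∂squareMeasure μ U V U hU hV) ∧
    ∀ T : Set (I × I), MeasurableSet T → (∀ p ∈ T, θ ≤ (p.1 : ℝ)) →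
      squareMeasure μ U V (fun ω => U ω * (max (U ω) θ)⁻¹) hU hV T =
        μ (squareMap U V hU hV ⁻¹' T) := by
  have hmax : ∀ u : ℝ, 0 < max u θ := fun u => lt_max_of_lt_right hθ
  have mw : Measurable fun ω => U ω * (max (U ω) θ)⁻¹ := mU.mul (mU.max measurable_const).inv
  refine ⟨isFiniteMeasure_squareMeasure _ _ _ ?_, fun f => ?_, fun T hT hTθ => ?_⟩
  · refine (iU.mul_const θ⁻¹).mono' mw.aestronglyMeasurable (Eventually.of_forall fun ω => ?_)
    rw [Real.norm_of_nonneg (mul_nonneg (hU ω).1 (inv_pos.2 (hmax _)).le)]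
    exact mul_le_mul_of_nonneg_left (inv_anti₀ hθ (le_max_right _ _)) (hU ω).1
  · rw [integral_squareMeasure μ hU hV mU mV mw
      (fun ω => mul_nonneg (hU ω).1 (inv_pos.2 (hmax _)).le),
      integral_squareMeasure μ hU hV mU mV mU (fun ω => (hU ω).1)]
    refine integral_congr_ae (Eventually.of_forall fun ω => ?_)
    simp only [invMaxMap, squareMap, ContinuousMap.mul_apply, ContinuousMap.coe_mk]
    ring
  · have hm := measurable_squareMap hU hV mU mV
    rw [squareMeasure, Measure.map_apply hm hT, withDensity_apply _ (hm hT),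
      ← setLIntegral_one]
    refine setLIntegral_congr_fun (hm hT) fun ω hω => ?_
    have h1 : θ ≤ U ω := hTθ _ hω
    rw [max_eq_left h1, mul_inv_cancel₀ (hθ.trans_le h1).ne', ENNReal.ofReal_one]

/-- Only moments with a positive power of `U` are required, which allows infinite mass near `U = 0`.
The event stays in `U > θ`, where the reweighted measures coincide with the images of the original
ones. -/
theorem tendsto_measureReal_of_tendsto_moments {Ω Ω' : Type*} [MeasurableSpace Ω]
    [MeasurableSpace Ω'] (μ : ℕ → Measure Ω) (ν : Measure Ω') (U V : ℕ → Ω → ℝ) (U' V' : Ω' → ℝ)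
    (hU : ∀ n ω, U n ω ∈ I) (hV : ∀ n ω, V n ω ∈ I) (hU' : ∀ ω, U' ω ∈ I) (hV' : ∀ ω, V' ω ∈ I)
    (mU : ∀ n, Measurable (U n)) (mV : ∀ n, Measurable (V n)) (mU' : Measurable U')
    (mV' : Measurable V') (iU : ∀ n, Integrable (U n) (μ n)) (iU' : Integrable U' ν)
    (h : ∀ i j : ℕ, Tendsto (fun n => ∫ ω, U n ω ^ (i + 1) * V n ω ^ j ∂μ n) atTop
      (𝓝 (∫ ω, U' ω ^ (i + 1) * V' ω ^ j ∂ν))) (θ : ℝ) (hθ : 0 < θ)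
    (nU : ν {ω | U' ω = θ} = 0) (nV : ν {ω | V' ω = θ} = 0) :
    Tendsto (fun n => (μ n).real {ω | θ < U n ω ∧ V n ω ≤ θ}) atTop
      (𝓝 (ν.real {ω | θ < U' ω ∧ V' ω ≤ θ})) := by
  have fρ : ∀ n, IsFiniteMeasure (squareMeasure (μ n) (U n) (V n) (U n) (hU n) (hV n)) :=
    fun n => isFiniteMeasure_squareMeasure _ _ _ (iU n)
  have fρ' : IsFiniteMeasure (squareMeasure ν U' V' U' hU' hV') :=
    isFiniteMeasure_squareMeasure _ _ _ iU'
  have hρ := tendsto_integral_of_tendsto_moments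
    (fun n => squareMeasure (μ n) (U n) (V n) (U n) (hU n) (hV n))
    (squareMeasure ν U' V' U' hU' hV') (fun i j => by
      have e1 := fun n => integral_squareMeasure (μ n) (hU n) (hV n) (mU n) (mV n) (mU n)
        (fun ω => (hU n ω).1) (fstMap ^ i * sndMap ^ j)
      have e2 := integral_squareMeasure ν hU' hV' mU' mV' mU'
        (fun ω => (hU' ω).1) (fstMap ^ i * sndMap ^ j)
      simp only [fstMap, sndMap, squareMap, ContinuousMap.mul_apply, ContinuousMap.pow_apply,
        ContinuousMap.coe_mk, ← mul_assoc, ← pow_succ'] at e1 e2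
      simp_rw [e1, e2]
      exact h i j)
  have kμ := fun n => squareMeasure_reweight (μ n) (hU n) (hV n) (mU n) (mV n) (iU n) θ hθ
  obtain ⟨k1, k2, k3⟩ := squareMeasure_reweight ν hU' hV' mU' mV' iU' θ hθ
  set χ : ℕ → FiniteMeasure (I × I) := fun n => ⟨_, (kμ n).1⟩ with hχ
  set χ' : FiniteMeasure (I × I) := ⟨_, k1⟩ with hχ'
  have hconv : Tendsto χ atTop (𝓝 χ') := by
    rw [FiniteMeasure.tendsto_iff_forall_integral_tendsto]
    intro f
    have e := hρ (invMaxMap θ hθ * f.toContinuousMap)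
    rw [← k2] at e
    simp_rw [← (kμ _).2.1] at e
    exact e
  set E : Set (I × I) := {p | θ < (p.1 : ℝ)} ∩ {p | (p.2 : ℝ) ≤ θ} with hEdef
  have mE : MeasurableSet E := by
    refine MeasurableSet.inter (measurableSet_lt measurable_const ?_)
      (measurableSet_le ?_ measurable_const)
    · exact measurable_fst.subtype_val
    · exact measurable_snd.subtype_val
  have hcont1 : Continuous fun p : I × I => (p.1 : ℝ) := by fun_prop
  have hcont2 : Continuous fun p : I × I => (p.2 : ℝ) := by fun_prop
  -- The bound `θ ≤ p.1` keeps the frontier where the reweighted measure is the image of `ν`, so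
  -- that `nU` and `nV` make it null.
  have hfr : frontier E ⊆ {p | θ ≤ (p.1 : ℝ) ∧ ((p.1 : ℝ) = θ ∨ (p.2 : ℝ) = θ)} := by
    intro p hp
    refine ⟨?_, ?_⟩
    · have h1 : E ⊆ {p | θ ≤ (p.1 : ℝ)} := fun q hq => le_of_lt (show θ < (q.1 : ℝ) from hq.1)
      exact closure_minimal h1 (isClosed_le continuous_const hcont1) hp.1
    · rcases frontier_inter_subset _ _ hp with h1 | h1
      · exact Or.inl (frontier_lt_subset_eq continuous_const hcont1 h1.1).symm
      · exact Or.inr (frontier_le_subset_eq hcont2 continuous_const h1.2)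
  have hnull : χ' (frontier E) = 0 := by
    have h1 : (χ' : Measure (I × I)) (frontier E) = 0 := by
      change squareMeasure ν U' V' (fun ω => U' ω * (max (U' ω) θ)⁻¹) hU' hV' (frontier E) = 0
      rw [k3 _ isClosed_frontier.measurableSet (fun p hp => (hfr hp).1)]
      refine measure_mono_null (fun ω hω => ?_) (measure_union_null nU nV)
      exact (hfr hω).2
    change ENNReal.toNNReal ((χ' : Measure (I × I)) (frontier E)) = 0
    rw [h1]
    rfl
  have hfin := tendsto_apply_of_null_frontier hconv hnull
  have e1 : ∀ n, ((χ n E : NNReal) : ℝ) = (μ n).real {ω | θ < U n ω ∧ V n ω ≤ θ} := fun n => by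
    change ENNReal.toReal (squareMeasure (μ n) (U n) (V n)
      (fun ω => U n ω * (max (U n ω) θ)⁻¹) (hU n) (hV n) E) = _
    rw [(kμ n).2.2 E mE (fun p hp => hp.1.le)]
    rfl
  have e2 : ((χ' E : NNReal) : ℝ) = ν.real {ω | θ < U' ω ∧ V' ω ≤ θ} := by
    change ENNReal.toReal (squareMeasure ν U' V'
      (fun ω => U' ω * (max (U' ω) θ)⁻¹) hU' hV' E) = _
    rw [k3 E mE (fun p hp => hp.1.le)]
    rfl
  have := (NNReal.tendsto_coe.2 hfin)
  simp only [e1] at this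
  rwa [e2] at this

end GUE

namespace GUE

/-! ### The limiting measure -/

theorem integral_exp_neg_mul_sq_add_mul {b : ℝ} (hb : 0 < b) (c : ℝ) :
    ∫ x : ℝ, Real.exp (-b * x ^ 2 + c * x) = √(Real.pi / b) * Real.exp (c ^ 2 / (4 * b)) := by
  have h : ∀ x : ℝ, Real.exp (-b * x ^ 2 + c * x) =
      Real.exp (-b * (x - c / (2 * b)) ^ 2) * Real.exp (c ^ 2 / (4 * b)) := fun x => by
    rw [← Real.exp_add]
    congr 1
    field_simp
    ring
  simp_rw [h]
  rw [integral_mul_const, integral_sub_right_eq_self (fun x : ℝ => Real.exp (-b * x ^ 2)),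
    integral_gaussian]

theorem integrable_exp_neg_mul_sq_add_mul {b : ℝ} (hb : 0 < b) (c : ℝ) :
    Integrable fun x : ℝ => Real.exp (-b * x ^ 2 + c * x) := by
  refine Integrable.of_integral_ne_zero ?_
  rw [integral_exp_neg_mul_sq_add_mul hb]
  positivity

/-- The measure on the line with density `exp(-γ x) / π`. -/
noncomputable def tiltMeasure (γ : ℝ) : Measure ℝ :=
  volume.withDensity fun x => ENNReal.ofReal (Real.exp (-γ * x) / Real.pi)

instance sFinite_tiltMeasure (γ : ℝ) : SFinite (tiltMeasure γ) := by
  unfold tiltMeasure; infer_instance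

theorem integral_tiltMeasure (γ : ℝ) (f : ℝ → ℝ) :
    ∫ x, f x ∂tiltMeasure γ = ∫ x, Real.exp (-γ * x) / Real.pi * f x := by
  rw [tiltMeasure, integral_withDensity_eq_integral_toReal_smul (by fun_prop)
    (Eventually.of_forall fun ω => ENNReal.ofReal_lt_top)]
  simp only [ENNReal.toReal_ofReal (div_nonneg (Real.exp_pos _).le Real.pi_pos.le), smul_eq_mul]

theorem integrable_tiltMeasure_iff (γ : ℝ) (f : ℝ → ℝ) :
    Integrable f (tiltMeasure γ) ↔ Integrable fun x => Real.exp (-γ * x) / Real.pi * f x := by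
  rw [tiltMeasure, integrable_withDensity_iff_integrable_smul' (by fun_prop)
    (Eventually.of_forall fun ω => ENNReal.ofReal_lt_top)]
  simp only [ENNReal.toReal_ofReal (div_nonneg (Real.exp_pos _).le Real.pi_pos.le), smul_eq_mul]

/-- The rescaled phase space measure: density `exp(-γ x) / π` on the plane. -/
noncomputable def phaseMeasure (γ : ℝ) : Measure (ℝ × ℝ) := (tiltMeasure γ).prod volume

/-- The Gaussian of the squared distance to `(0, a)`. -/
noncomputable def discFn (a : ℝ) (p : ℝ × ℝ) : ℝ := Real.exp (-(p.1 ^ 2 + (p.2 - a) ^ 2))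

theorem discFn_pow_mul_discFn_pow (a : ℝ) (i j : ℕ) (p : ℝ × ℝ) :
    discFn 0 p ^ i * discFn a p ^ j = Real.exp (-(i + j) * p.1 ^ 2) *
      (Real.exp (-(i + j) * p.2 ^ 2 + 2 * j * a * p.2) * Real.exp (-j * a ^ 2)) := by
  rw [discFn, discFn, ← Real.exp_nat_mul, ← Real.exp_nat_mul, ← Real.exp_add, ← Real.exp_add,
    ← Real.exp_add]
  congr 1
  ring

/-- Completing the square in each coordinate gives two factors `√(π/(i+j))`; the `1/π` of
`tiltMeasure` cancels the `π` of their product. -/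
theorem integral_phaseMeasure (γ a : ℝ) (i j : ℕ) (hij : 0 < i + j) :
    Integrable (fun p => discFn 0 p ^ i * discFn a p ^ j) (phaseMeasure γ) ∧
    ∫ p, discFn 0 p ^ i * discFn a p ^ j ∂phaseMeasure γ =
      1 / (i + j) * Real.exp (γ ^ 2 / (4 * (i + j)) - a ^ 2 * (i * j) / (i + j)) := by
  have hb : (0 : ℝ) < i + j := by exact_mod_cast hij
  simp only [discFn_pow_mul_discFn_pow a i j]
  have e : ∀ x : ℝ, Real.exp (-γ * x) / Real.pi * Real.exp (-(i + j) * x ^ 2) =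
      Real.exp (-(i + j) * x ^ 2 + -γ * x) / Real.pi := fun x => by
    rw [Real.exp_add]; ring
  constructor
  · refine Integrable.mul_prod (μ := tiltMeasure γ) (f := fun x => Real.exp (-(i + j) * x ^ 2))
      (g := fun y => Real.exp (-(i + j) * y ^ 2 + 2 * j * a * y) * Real.exp (-j * a ^ 2)) ?_ ?_
    · rw [integrable_tiltMeasure_iff]
      simp only [e]
      exact (integrable_exp_neg_mul_sq_add_mul hb _).div_const _
    · exact (integrable_exp_neg_mul_sq_add_mul hb _).mul_const _
  · rw [phaseMeasure, integral_prod_mul (μ := tiltMeasure γ) (ν := (volume : Measure ℝ))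
      (fun x : ℝ => Real.exp (-(i + j) * x ^ 2))
      (fun y => Real.exp (-(i + j) * y ^ 2 + 2 * j * a * y) * Real.exp (-j * a ^ 2)),
      integral_tiltMeasure, integral_mul_const, integral_exp_neg_mul_sq_add_mul hb]
    simp only [e]
    rw [integral_div, integral_exp_neg_mul_sq_add_mul hb]
    have h1 : √(Real.pi / (i + j)) * √(Real.pi / (i + j)) = Real.pi / (i + j) :=
      Real.mul_self_sqrt (by positivity)
    have h2 : Real.exp (γ ^ 2 / (4 * (i + j)) - a ^ 2 * (i * j) / (i + j)) =
        Real.exp ((-γ) ^ 2 / (4 * (i + j))) *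
        (Real.exp ((2 * j * a) ^ 2 / (4 * (i + j))) * Real.exp (-j * a ^ 2)) := by
      rw [← Real.exp_add, ← Real.exp_add]
      congr 1
      field_simp
      ring
    rw [h2]
    have hpi := Real.pi_pos.ne'
    calc _ = (√(Real.pi / (i + j)) * √(Real.pi / (i + j))) / Real.pi *
          (Real.exp ((-γ) ^ 2 / (4 * (i + j))) *
        (Real.exp ((2 * j * a) ^ 2 / (4 * (i + j))) * Real.exp (-j * a ^ 2))) := by ring
      _ = _ := by
        rw [h1]
        field_simp

theorem phaseMeasure_circle (γ a : ℝ) : phaseMeasure γ {p | discFn a p = Real.exp (-1)} = 0 := by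
  have hset : {p : ℝ × ℝ | discFn a p = Real.exp (-1)} = {p | p.1 ^ 2 + (p.2 - a) ^ 2 = 1} := by
    ext p
    simp only [discFn, Set.mem_ofPred_eq, Real.exp_eq_exp, neg_inj]
  rw [hset, phaseMeasure, Measure.measure_prod_null]
  · refine Eventually.of_forall fun x => ?_
    refine measure_mono_null (t := {a + √(1 - x ^ 2), a - √(1 - x ^ 2)}) (fun y hy => ?_)
      ((Set.toFinite _).measure_zero _)
    simp only [Set.mem_preimage, Set.mem_ofPred_eq] at hy
    have h1 : (y - a) ^ 2 = √(1 - x ^ 2) ^ 2 := by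
      rw [Real.sq_sqrt (by nlinarith [sq_nonneg (y - a)])]; linarith
    rcases sq_eq_sq_iff_eq_or_eq_neg.1 h1 with h | h
    · left; linarith
    · right
      rw [Set.mem_singleton_iff]
      linarith
  · exact measurableSet_eq_fun (by fun_prop) measurable_const

theorem tiltMeasure_setOf_sq_lt (γ s : ℝ) :
    tiltMeasure γ {x | x ^ 2 + s ^ 2 < 1} =
      ENNReal.ofReal ((∫ x in (-√(1 - s ^ 2))..√(1 - s ^ 2), Real.exp (-γ * x)) / Real.pi) := by
  have hset : {x : ℝ | x ^ 2 + s ^ 2 < 1} = Set.Ioo (-√(1 - s ^ 2)) √(1 - s ^ 2) := by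
    ext x
    rw [Set.mem_ofPred_eq, Set.mem_Ioo, ← Real.sq_lt]
    constructor <;> intro h <;> linarith
  have hle : -√(1 - s ^ 2) ≤ √(1 - s ^ 2) := by linarith [Real.sqrt_nonneg (1 - s ^ 2)]
  rw [hset, tiltMeasure, withDensity_apply _ measurableSet_Ioo,
    ← ofReal_integral_eq_lintegral_ofReal, integral_div, ← integral_Ioc_eq_integral_Ioo,
    intervalIntegral.integral_of_le hle]
  · exact ((by fun_prop : Continuous fun x => Real.exp (-γ * x) / Real.pi).continuousOn.integrableOn_Icc
      ).mono_set Set.Ioo_subset_Icc_self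
  · exact Eventually.of_forall fun x => div_nonneg (Real.exp_pos _).le Real.pi_pos.le

/-- With half-chord `w`, removing from `(-w, w)` its translate by `2τ` leaves length `2 min(τ, w)`,
twice the length of `(0, min(τ, w))`. -/
theorem volume_slice_disc_diff {τ : ℝ} (hτ : 0 < τ) (x : ℝ) :
    volume {y : ℝ | x ^ 2 + y ^ 2 < 1 ∧ 1 ≤ x ^ 2 + (y - 2 * τ) ^ 2} =
      2 * volume {s : ℝ | (0 < s ∧ s < τ) ∧ x ^ 2 + s ^ 2 < 1} := by
  set w := √(1 - x ^ 2) with hw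
  have hw0 : 0 ≤ w := Real.sqrt_nonneg _
  by_cases hx : x ^ 2 < 1
  · have hw2 : w ^ 2 = 1 - x ^ 2 := Real.sq_sqrt (by linarith)
    have hwpos : 0 < w := Real.sqrt_pos.2 (by linarith)
    have h2 : {s : ℝ | (0 < s ∧ s < τ) ∧ x ^ 2 + s ^ 2 < 1} = Set.Ioo 0 (min τ w) := by
      ext s
      simp only [Set.mem_ofPred_eq, Set.mem_Ioo, lt_min_iff]
      constructor
      · rintro ⟨⟨h1, h2⟩, h3⟩
        exact ⟨h1, h2, by nlinarith⟩
      · rintro ⟨h1, h2, h3⟩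
        exact ⟨⟨h1, h2⟩, by nlinarith⟩
    have h1 : volume {y : ℝ | x ^ 2 + y ^ 2 < 1 ∧ 1 ≤ x ^ 2 + (y - 2 * τ) ^ 2} =
        volume (Set.Ioo (-w) (min w (2 * τ - w))) := by
      have hset : ∀ y : ℝ, (x ^ 2 + y ^ 2 < 1 ∧ 1 ≤ x ^ 2 + (y - 2 * τ) ^ 2) ↔
          (-w < y ∧ y < w ∧ y ≤ 2 * τ - w) := fun y => by
        constructor
        · rintro ⟨h1, h2⟩
          have h3 : y ^ 2 < w ^ 2 := by linarith
          have h4 := abs_lt_of_sq_lt_sq' h3 hw0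
          refine ⟨h4.1, h4.2, ?_⟩
          by_contra hcon
          push Not at hcon
          have h5 : (y - 2 * τ) ^ 2 < w ^ 2 := sq_lt_sq' (by linarith) (by linarith [h4.2])
          linarith
        · rintro ⟨h1, h2, h3⟩
          exact ⟨by nlinarith, by nlinarith⟩
      refine measure_congr ?_
      have hne : ∀ᵐ y : ℝ, y ≠ 2 * τ - w := by
        rw [ae_iff]; simp
      filter_upwards [hne] with y hy
      refine propext ((hset y).trans ?_)
      change _ ↔ y ∈ Set.Ioo _ _
      rw [Set.mem_Ioo, lt_min_iff]
      constructor
      · rintro ⟨a, b, c⟩; exact ⟨a, b, lt_of_le_of_ne c hy⟩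
      · rintro ⟨a, b, c⟩; exact ⟨a, b, c.le⟩
    rw [h1, h2, Real.volume_Ioo, Real.volume_Ioo,
      show (2 : ENNReal) = ENNReal.ofReal 2 by simp, ← ENNReal.ofReal_mul (by norm_num)]
    congr 1
    rcases le_total τ w with h | h
    · rw [min_eq_left h, min_eq_right (by linarith)]; ring
    · rw [min_eq_right h, min_eq_left (by linarith)]; ring
  · have e1 : {y : ℝ | x ^ 2 + y ^ 2 < 1 ∧ 1 ≤ x ^ 2 + (y - 2 * τ) ^ 2} = ∅ := by
      ext y
      simp only [Set.mem_ofPred_eq, Set.mem_empty_iff_false, iff_false]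
      rintro ⟨h, _⟩
      nlinarith [sq_nonneg y]
    have e2 : {s : ℝ | (0 < s ∧ s < τ) ∧ x ^ 2 + s ^ 2 < 1} = ∅ := by
      ext y
      simp only [Set.mem_ofPred_eq, Set.mem_empty_iff_false, iff_false]
      rintro ⟨_, h⟩
      nlinarith [sq_nonneg y]
    rw [e1, e2]
    simp

theorem continuous_integral_exp_sqrt (γ : ℝ) :
    Continuous fun s : ℝ => ∫ x in (-√(1 - s ^ 2))..√(1 - s ^ 2), Real.exp (-γ * x) := by
  have hc : Continuous fun x : ℝ => Real.exp (-γ * x) := by fun_prop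
  have h1 : Continuous fun t : ℝ => ∫ x in (0 : ℝ)..t, Real.exp (-γ * x) :=
    intervalIntegral.continuous_primitive (fun a b => hc.intervalIntegrable a b) 0
  have e : ∀ s : ℝ, ∫ x in (-√(1 - s ^ 2))..√(1 - s ^ 2), Real.exp (-γ * x) =
      (∫ x in (0 : ℝ)..√(1 - s ^ 2), Real.exp (-γ * x)) -
      ∫ x in (0 : ℝ)..(-√(1 - s ^ 2)), Real.exp (-γ * x) := fun s =>
    (intervalIntegral.integral_interval_sub_left (hc.intervalIntegrable _ _)
      (hc.intervalIntegrable _ _)).symm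
  simp only [e]
  exact (h1.comp (by fun_prop)).sub (h1.comp (by fun_prop))

/-- Slice by slice, the crescent has twice the measure of the part of the disc in the strip `0 < y <
τ`. That part is then integrated in the other order, first over horizontal chords. -/
theorem phaseMeasure_disc_diff (γ : ℝ) {τ : ℝ} (hτ : 0 < τ) :
    (phaseMeasure γ).real {p | Real.exp (-1) < discFn 0 p ∧ discFn (2 * τ) p ≤ Real.exp (-1)} =
      2 / Real.pi * ∫ s in (0 : ℝ)..τ, ∫ x in (-√(1 - s ^ 2))..√(1 - s ^ 2), Real.exp (-γ * x) := by
  have hset : {p : ℝ × ℝ | Real.exp (-1) < discFn 0 p ∧ discFn (2 * τ) p ≤ Real.exp (-1)} =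
      {p | p.1 ^ 2 + p.2 ^ 2 < 1 ∧ 1 ≤ p.1 ^ 2 + (p.2 - 2 * τ) ^ 2} := by
    ext p
    simp only [discFn, Set.mem_ofPred_eq, Real.exp_lt_exp, Real.exp_le_exp, sub_zero,
      neg_lt_neg_iff, neg_le_neg_iff]
  have m1 : MeasurableSet {p : ℝ × ℝ | p.1 ^ 2 + p.2 ^ 2 < 1 ∧ 1 ≤ p.1 ^ 2 + (p.2 - 2 * τ) ^ 2} :=
    MeasurableSet.inter (s₁ := {p : ℝ × ℝ | p.1 ^ 2 + p.2 ^ 2 < 1})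
      (s₂ := {p : ℝ × ℝ | 1 ≤ p.1 ^ 2 + (p.2 - 2 * τ) ^ 2})
      (measurableSet_lt (by fun_prop) measurable_const)
      (measurableSet_le measurable_const (by fun_prop))
  have m2 : MeasurableSet {p : ℝ × ℝ | (0 < p.2 ∧ p.2 < τ) ∧ p.1 ^ 2 + p.2 ^ 2 < 1} :=
    MeasurableSet.inter (s₁ := {p : ℝ × ℝ | 0 < p.2 ∧ p.2 < τ})
      (s₂ := {p : ℝ × ℝ | p.1 ^ 2 + p.2 ^ 2 < 1})
      (MeasurableSet.inter (s₁ := {p : ℝ × ℝ | 0 < p.2}) (s₂ := {p : ℝ × ℝ | p.2 < τ})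
        (measurableSet_lt measurable_const measurable_snd)
        (measurableSet_lt measurable_snd measurable_const))
      (measurableSet_lt (by fun_prop) measurable_const)
  set F : ℝ → ℝ := fun s => ∫ x in (-√(1 - s ^ 2))..√(1 - s ^ 2), Real.exp (-γ * x) with hF
  have hF0 : ∀ s, 0 ≤ F s := fun s => intervalIntegral.integral_nonneg
    (by linarith [Real.sqrt_nonneg (1 - s ^ 2)]) fun x _ => (Real.exp_pos _).le
  have hW : phaseMeasure γ {p : ℝ × ℝ | (0 < p.2 ∧ p.2 < τ) ∧ p.1 ^ 2 + p.2 ^ 2 < 1} =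
      ENNReal.ofReal ((∫ s in (0 : ℝ)..τ, F s) / Real.pi) := by
    rw [phaseMeasure, Measure.prod_apply_symm m2]
    have e : ∀ s : ℝ, tiltMeasure γ ((fun x => (x, s)) ⁻¹'
        {p : ℝ × ℝ | (0 < p.2 ∧ p.2 < τ) ∧ p.1 ^ 2 + p.2 ^ 2 < 1}) =
        (Set.Ioo 0 τ).indicator (fun s => ENNReal.ofReal (F s / Real.pi)) s := fun s => by
      by_cases hs : 0 < s ∧ s < τ
      · rw [Set.indicator_of_mem (show s ∈ Set.Ioo 0 τ from hs), hF,
          ← tiltMeasure_setOf_sq_lt]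
        congr 1
        ext x
        simp [hs]
      · rw [Set.indicator_of_notMem (show s ∉ Set.Ioo 0 τ from hs)]
        convert! measure_empty (μ := tiltMeasure γ)
        ext x
        simp [hs]
    simp only [e]
    rw [lintegral_indicator measurableSet_Ioo, ← ofReal_integral_eq_lintegral_ofReal,
      integral_div, ← integral_Ioc_eq_integral_Ioo, intervalIntegral.integral_of_le hτ.le]
    · exact (((continuous_integral_exp_sqrt γ).div_const _).continuousOn.integrableOn_Icc
        ).mono_set Set.Ioo_subset_Icc_self
    · exact Eventually.of_forall fun s => div_nonneg (hF0 s) Real.pi_pos.le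
  have h2 : phaseMeasure γ {p | p.1 ^ 2 + p.2 ^ 2 < 1 ∧ 1 ≤ p.1 ^ 2 + (p.2 - 2 * τ) ^ 2} =
      2 * phaseMeasure γ {p : ℝ × ℝ | (0 < p.2 ∧ p.2 < τ) ∧ p.1 ^ 2 + p.2 ^ 2 < 1} := by
    rw [phaseMeasure, Measure.prod_apply m1, Measure.prod_apply m2, ← lintegral_const_mul]
    · refine lintegral_congr fun x => ?_
      exact volume_slice_disc_diff hτ x
    · exact measurable_measure_prodMk_left m2
  rw [hset, measureReal_def, h2, hW, ENNReal.toReal_mul, ENNReal.toReal_ofReal]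
  · simp only [ENNReal.toReal_ofNat]
    ring
  · exact div_nonneg (intervalIntegral.integral_nonneg hτ.le fun s _ => hF0 s) Real.pi_pos.le

/-! ### The bulk scaling limit of the covariance -/

/-- The rescaled complex wave number `i k₁ / √2` of the bulk scaling. -/
noncomputable def bulkParam (γ τ : ℝ) (N : ℕ) : ℂ :=
  ⟨-(γ / (4 * √N)), 2 * √N * τ⟩

theorem sqrt_two_mul_div (γ : ℝ) (N : ℕ) : √2 * (γ / (4 * √N)) = γ / (2 * √(2 * N)) := by
  rcases N.eq_zero_or_pos with rfl | hN
  · simp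
  have hN' : (0 : ℝ) < N := by exact_mod_cast hN
  have h1 : 0 < √(N : ℝ) := Real.sqrt_pos.2 hN'
  have h2 : 0 < √(2 : ℝ) := by positivity
  have h3 : √(2 : ℝ) ^ 2 = 2 := Real.sq_sqrt (by norm_num)
  rw [Real.sqrt_mul (by norm_num), ← mul_div_assoc, div_eq_div_iff (by positivity) (by positivity)]
  linear_combination (2 * √(N : ℝ) * γ) * h3

theorem I_mul_bulk_eq (N : ℕ) (γ τ : ℝ) :
    Complex.I * (bulkShift N γ + bulkWave N τ) = √2 * bulkParam γ τ N := by
  rw [bulkShift, bulkWave, bulkParam, ← sqrt_two_mul_div, Real.sqrt_mul (by norm_num)]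
  generalize γ / (4 * √(N : ℝ)) = a
  apply Complex.ext
  · simp
  · simp
    ring

theorem I_mul_neg_bulk_eq (N : ℕ) (γ τ : ℝ) :
    Complex.I * (-(-bulkShift N γ + bulkWave N τ)) =
      √2 * (starRingEnd ℂ) (bulkParam γ τ N) := by
  rw [bulkShift, bulkWave, bulkParam, ← sqrt_two_mul_div, Real.sqrt_mul (by norm_num)]
  generalize γ / (4 * √(N : ℝ)) = a
  apply Complex.ext
  · simp
  · simp
    ring

/-- Arranged so that `1 - r`, `1 - s` and `1 - r s` all occur multiplied by `N`, the combinations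
that converge when `r` and `s` are exponentials of `-const/N`. -/
theorem bulkParam_exponent (γ τ : ℝ) {N : ℕ} (hN : 0 < N) {r s : ℝ} (hrs : r * s < 1) :
    ((bulkParam γ τ N) ^ 2).re + r * ‖bulkParam γ τ N‖ ^ 2 +
        s * ‖bulkParam γ τ N + r * (starRingEnd ℂ) (bulkParam γ τ N)‖ ^ 2 / (1 - r * s) =
      γ ^ 2 / 16 * ((1 + r) * (1 + s)) / (N * (1 - r * s)) -
        4 * τ ^ 2 * ((N * (1 - r)) * (N * (1 - s))) / (N * (1 - r * s)) := by
  have hN' : (0 : ℝ) < N := by exact_mod_cast hN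
  have h1 : √(N : ℝ) ^ 2 = N := Real.sq_sqrt hN'.le
  have h2 : 1 - r * s ≠ 0 := by linarith
  have h3 : 0 < √(N : ℝ) := Real.sqrt_pos.2 hN'
  have e1 : (γ / (4 * √(N : ℝ))) ^ 2 = γ ^ 2 / (16 * N) := by
    rw [div_pow, mul_pow, h1]; norm_num
  have e2 : (2 * √(N : ℝ) * τ) ^ 2 = 4 * N * τ ^ 2 := by
    rw [mul_pow, mul_pow, h1]; norm_num
  have n1 : ‖bulkParam γ τ N‖ ^ 2 = γ ^ 2 / (16 * N) + 4 * N * τ ^ 2 := by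
    rw [← Complex.normSq_eq_norm_sq, Complex.normSq_apply, ← e1, ← e2, bulkParam]
    ring
  have n2 : ((bulkParam γ τ N) ^ 2).re = γ ^ 2 / (16 * N) - 4 * N * τ ^ 2 := by
    rw [← e1, ← e2, bulkParam, sq, Complex.mul_re]
    ring
  have n3 : ‖bulkParam γ τ N + r * (starRingEnd ℂ) (bulkParam γ τ N)‖ ^ 2 =
      (1 + r) ^ 2 * (γ ^ 2 / (16 * N)) + (1 - r) ^ 2 * (4 * N * τ ^ 2) := by
    rw [← Complex.normSq_eq_norm_sq, Complex.normSq_apply, ← e1, ← e2, bulkParam]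
    simp
    ring
  rw [n1, n2, n3]
  field_simp
  ring

/-- The counting measure on pairs of levels, weighted by squared matrix elements. -/
noncomputable def levelMeasure (γ τ : ℝ) (N : ℕ) : Measure (ℕ × ℕ) :=
  Measure.count.withDensity fun p =>
    ENNReal.ofReal (elementSq (bulkParam γ τ N) p.1 p.2 / N)

theorem integral_levelMeasure (γ τ : ℝ) (N : ℕ) {f : ℕ × ℕ → ℝ} {S : ℝ}
    (h : HasSum (fun p : ℕ × ℕ => f p * elementSq (bulkParam γ τ N) p.1 p.2) S) :
    Integrable f (levelMeasure γ τ N) ∧ ∫ p, f p ∂levelMeasure γ τ N = 1 / N * S := by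
  have hw : ∀ p : ℕ × ℕ, 0 ≤ elementSq (bulkParam γ τ N) p.1 p.2 / N := fun p =>
    div_nonneg (elementSq_nonneg _ _ _) (Nat.cast_nonneg _)
  have hm : Measurable fun p : ℕ × ℕ =>
    ENNReal.ofReal (elementSq (bulkParam γ τ N) p.1 p.2 / N) := by fun_prop
  have hs : HasSum (fun p : ℕ × ℕ => elementSq (bulkParam γ τ N) p.1 p.2 / N * f p)
      (1 / N * S) := (h.mul_left (1 / (N : ℝ))).congr_fun fun p => by ring
  have hi : Integrable (fun p : ℕ × ℕ => elementSq (bulkParam γ τ N) p.1 p.2 / N * f p)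
      Measure.count := by
    rw [integrable_count_iff]
    exact hs.summable.norm
  constructor
  · rw [levelMeasure, integrable_withDensity_iff_integrable_smul' hm
      (Eventually.of_forall fun ω => ENNReal.ofReal_lt_top)]
    simpa only [ENNReal.toReal_ofReal (hw _), smul_eq_mul] using hi
  · rw [levelMeasure, integral_withDensity_eq_integral_toReal_smul hm
      (Eventually.of_forall fun ω => ENNReal.ofReal_lt_top)]
    simp only [ENNReal.toReal_ofReal (hw _), smul_eq_mul]
    rw [integral_countable hi, ← hs.tsum_eq]
    simp [measureReal_def]

/-- The exponential of a rescaled level. -/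
noncomputable def levelFn (N n : ℕ) : ℝ := Real.exp (-(n / N : ℝ))

theorem levelFn_pow (N n i : ℕ) : levelFn N n ^ i = Real.exp (-(i / N : ℝ)) ^ n := by
  rw [levelFn, ← Real.exp_nat_mul, ← Real.exp_nat_mul]
  congr 1
  ring

theorem integral_levelFn (γ τ : ℝ) {N : ℕ} (hN : 0 < N) (i j : ℕ) :
    Integrable (fun p : ℕ × ℕ => levelFn N p.1 ^ (i + 1) * levelFn N p.2 ^ j)
      (levelMeasure γ τ N) ∧
    ∫ p : ℕ × ℕ, levelFn N p.1 ^ (i + 1) * levelFn N p.2 ^ j ∂levelMeasure γ τ N =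
      1 / (N * (1 - Real.exp (-((j + (i + 1 : ℕ) : ℝ) / N)))) * Real.exp
        (γ ^ 2 / 16 * ((1 + Real.exp (-((j : ℝ) / N))) * (1 + Real.exp (-(((i + 1 : ℕ) : ℝ) / N)))) /
          (N * (1 - Real.exp (-((j + (i + 1 : ℕ) : ℝ) / N)))) -
        4 * τ ^ 2 * ((N * (1 - Real.exp (-((j : ℝ) / N)))) *
          (N * (1 - Real.exp (-(((i + 1 : ℕ) : ℝ) / N))))) /
          (N * (1 - Real.exp (-((j + (i + 1 : ℕ) : ℝ) / N))))) := by
  have hN' : (0 : ℝ) < N := by exact_mod_cast hN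
  set r := Real.exp (-((j : ℝ) / N)) with hr
  set s := Real.exp (-(((i + 1 : ℕ) : ℝ) / N)) with hs
  have e : Real.exp (-((j + (i + 1 : ℕ) : ℝ) / N)) = r * s := by
    rw [hr, hs, ← Real.exp_add]
    congr 1
    ring
  -- The exponent `i + 1` instead of `i` keeps this strict even when `j = 0`, where `r = 1`.
  have hrs : r * s < 1 := by
    rw [← e, Real.exp_lt_one_iff, neg_lt_zero]
    positivity
  have h := hasSum_elementSq (bulkParam γ τ N) (Real.exp_pos _).le (Real.exp_pos _).le hrs
  rw [bulkParam_exponent γ τ hN hrs] at h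
  have h2 := integral_levelMeasure γ τ N
    (f := fun p : ℕ × ℕ => levelFn N p.1 ^ (i + 1) * levelFn N p.2 ^ j)
    (h.congr_fun fun p => by rw [levelFn_pow, levelFn_pow])
  refine ⟨h2.1, ?_⟩
  rw [h2.2, e, ← mul_assoc, one_div_mul_one_div]

theorem tendsto_nat_mul_one_sub_exp (p : ℝ) (hp : 0 ≤ p) :
    Tendsto (fun N : ℕ => (N : ℝ) * (1 - Real.exp (-(p / N)))) atTop (𝓝 p) := by
  have h1 : Tendsto (fun N : ℕ => p / (1 + p / (N : ℝ))) atTop (𝓝 p) := by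
    have h2 : Tendsto (fun N : ℕ => p / (N : ℝ)) atTop (𝓝 0) :=
      tendsto_const_nhds.div_atTop tendsto_natCast_atTop_atTop
    have h3 := (tendsto_const_nhds (x := p)).div (tendsto_const_nhds (x := (1 : ℝ)).add h2)
      (by norm_num)
    simp only [add_zero, div_one] at h3
    exact h3
  refine tendsto_of_tendsto_of_tendsto_of_le_of_le' h1 tendsto_const_nhds ?_ ?_
  · filter_upwards [eventually_gt_atTop 0] with N hN
    have hN' : (0 : ℝ) < N := by exact_mod_cast hN
    have h4 : Real.exp (-(p / N)) ≤ 1 / (1 + p / N) := by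
      rw [Real.exp_neg, ← one_div]
      exact one_div_le_one_div_of_le (by positivity) (by linarith [Real.add_one_le_exp (p / N)])
    calc p / (1 + p / N) = N * (1 - 1 / (1 + p / N)) := by field_simp; ring
      _ ≤ _ := by gcongr
  · filter_upwards [eventually_gt_atTop 0] with N hN
    have hN' : (0 : ℝ) < N := by exact_mod_cast hN
    have h4 := Real.add_one_le_exp (-(p / N))
    calc N * (1 - Real.exp (-(p / N))) ≤ N * (p / N) := by gcongr; linarith
      _ = p := by field_simp

theorem tendsto_one_add_exp (p : ℝ) :
    Tendsto (fun N : ℕ => 1 + Real.exp (-(p / (N : ℝ)))) atTop (𝓝 2) := by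
  have h2 : Tendsto (fun N : ℕ => p / (N : ℝ)) atTop (𝓝 0) :=
    tendsto_const_nhds.div_atTop tendsto_natCast_atTop_atTop
  have h3 := (tendsto_const_nhds (x := (1 : ℝ))).add
    ((Real.continuous_exp.tendsto _).comp h2.neg)
  simp only [neg_zero, Real.exp_zero] at h3
  norm_num at h3
  exact h3

/-- The semiclassical limit: the rescaled levels `(n/N, m/N)` acquire the joint distribution of the
squared distances to `(0, 0)` and `(0, 2τ)` in phase space. -/
theorem tendsto_integral_levelFn (γ τ : ℝ) (i j : ℕ) :
    Tendsto (fun N : ℕ => ∫ p : ℕ × ℕ, levelFn N p.1 ^ (i + 1) * levelFn N p.2 ^ j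
      ∂levelMeasure γ τ N) atTop
      (𝓝 (∫ p, discFn 0 p ^ (i + 1) * discFn (2 * τ) p ^ j ∂phaseMeasure γ)) := by
  rw [(integral_phaseMeasure γ (2 * τ) (i + 1) j (by omega)).2]
  have hpos : (0 : ℝ) < j + (i + 1 : ℕ) := by positivity
  have t1 := tendsto_nat_mul_one_sub_exp (j + (i + 1 : ℕ)) hpos.le
  have t2 := tendsto_nat_mul_one_sub_exp j (by positivity)
  have t3 := tendsto_nat_mul_one_sub_exp ((i + 1 : ℕ) : ℝ) (by positivity)
  have t4 := tendsto_one_add_exp j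
  have t5 := tendsto_one_add_exp ((i + 1 : ℕ) : ℝ)
  have h := ((tendsto_const_nhds (x := (1 : ℝ))).div t1 hpos.ne').mul
    ((Real.continuous_exp.tendsto _).comp
      ((((t4.mul t5).const_mul (γ ^ 2 / 16)).div t1 hpos.ne').sub
        (((t2.mul t3).const_mul (4 * τ ^ 2)).div t1 hpos.ne')))
  have hlim : (1 : ℝ) / (j + (i + 1 : ℕ)) * Real.exp (γ ^ 2 / 16 * (2 * 2) / (j + (i + 1 : ℕ)) -
      4 * τ ^ 2 * (j * (i + 1 : ℕ)) / (j + (i + 1 : ℕ))) =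
      1 / ((i + 1 : ℕ) + j) * Real.exp (γ ^ 2 / (4 * ((i + 1 : ℕ) + j)) -
        (2 * τ) ^ 2 * ((i + 1 : ℕ) * j) / ((i + 1 : ℕ) + j)) := by
    rw [add_comm (j : ℝ)]
    congr 2
    have : ((i + 1 : ℕ) : ℝ) + j ≠ 0 := by positivity
    field_simp
    ring
  rw [hlim] at h
  refine h.congr' ?_
  filter_upwards [eventually_gt_atTop 0] with N hN
  exact (integral_levelFn γ τ hN i j).2.symm

theorem tsum_elementSq_summable (c : ℂ) (n : ℕ) : Summable fun m => elementSq c n m :=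
  Complex.summable_ofReal.1 (element_cexp_add_conj c n).summable

theorem levelMeasure_real (γ τ : ℝ) {N : ℕ} (hN : 0 < N) :
    (levelMeasure γ τ N).real
      {p | Real.exp (-1) < levelFn N p.1 ∧ levelFn N p.2 ≤ Real.exp (-1)} =
    1 / N * ∑ i ∈ Finset.range N, (∑' m, elementSq (bulkParam γ τ N) i m -
      ∑ j ∈ Finset.range N, elementSq (bulkParam γ τ N) i j) := by
  have hN' : (0 : ℝ) < N := by exact_mod_cast hN
  set c := bulkParam γ τ N
  -- The threshold `exp (-1)` is level `N`; the strict and weak inequalities place level `N` itself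
  -- among the unoccupied ones.
  have hset : {p : ℕ × ℕ | Real.exp (-1) < levelFn N p.1 ∧ levelFn N p.2 ≤ Real.exp (-1)} =
      {p | p.1 < N ∧ N ≤ p.2} := by
    ext p
    simp only [levelFn, Set.mem_ofPred_eq, Real.exp_lt_exp, Real.exp_le_exp, neg_lt_neg_iff,
      neg_le_neg_iff, div_lt_one hN', one_le_div hN', Nat.cast_lt, Nat.cast_le]
  have hrow : ∀ n, HasSum (fun m => if n < N ∧ N ≤ m then elementSq c n m else 0)
      (if n < N then ∑' m, elementSq c n m - ∑ j ∈ Finset.range N, elementSq c n j else 0) := by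
    intro n
    by_cases hn : n < N
    · simp only [hn, true_and, if_true]
      have h1 := (tsum_elementSq_summable c n).hasSum
      have h2 : HasSum (fun m => if m ∈ Finset.range N then elementSq c n m else 0)
          (∑ j ∈ Finset.range N, elementSq c n j) := by
        have := hasSum_sum_of_ne_finset_zero (L := .unconditional ℕ) (s := Finset.range N)
          (f := fun m => if m ∈ Finset.range N then elementSq c n m else 0)
          (fun m hm => by simp only [hm, if_false])
        convert! this using 1
        exact Finset.sum_congr rfl fun m hm => by simp only [hm, if_true]
      refine (h1.sub h2).congr_fun fun m => ?_
      by_cases hm : m < N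
      · simp [hm]
      · simp [hm, not_lt.1 hm]
    · simp only [hn, false_and, if_false]
      exact (hasSum_zero : HasSum (fun _ : ℕ => (0 : ℝ)) 0)
  have htot : HasSum (fun n => if n < N then ∑' m, elementSq c n m -
      ∑ j ∈ Finset.range N, elementSq c n j else 0)
      (∑ i ∈ Finset.range N, (∑' m, elementSq c i m - ∑ j ∈ Finset.range N, elementSq c i j)) := by
    have := hasSum_sum_of_ne_finset_zero (L := .unconditional ℕ) (s := Finset.range N)
      (f := fun n => if n < N then ∑' m, elementSq c n m -
      ∑ j ∈ Finset.range N, elementSq c n j else 0)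
      (fun m hm => by simp only [Finset.mem_range] at hm; simp only [hm, if_false])
    convert! this using 1
    exact Finset.sum_congr rfl fun m hm => by
      simp only [Finset.mem_range] at hm; simp only [hm, if_true]
  have hsum : Summable fun p : ℕ × ℕ => if p.1 < N ∧ N ≤ p.2 then elementSq c p.1 p.2 else 0 := by
    rw [summable_prod_of_nonneg]
    · refine ⟨fun n => (hrow n).summable, ?_⟩
      simp only [(hrow _).tsum_eq]
      exact htot.summable
    · intro p
      simp only [Pi.zero_apply]
      split_ifs
      · exact elementSq_nonneg _ _ _
      · exact le_rfl
  have hfin := hsum.hasSum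
  rw [(hsum.hasSum.prod_fiberwise hrow).unique htot] at hfin
  have h := integral_levelMeasure γ τ N
    (f := {p : ℕ × ℕ | p.1 < N ∧ N ≤ p.2}.indicator 1)
    (hfin.congr_fun fun p => by
      by_cases hp : p.1 < N ∧ N ≤ p.2 <;> simp [hp, c])
  rw [hset, ← h.2, integral_indicator_one (Set.to_countable _).measurableSet]

/-- The two thresholds `exp (-1)` are null circles in the limit, so the moment convergence yields
the measure of the crescent. No case distinction at `τ = 1` arises here. -/
theorem tendsto_bulkCov (γ : ℝ) {τ : ℝ} (hτ : 0 < τ) :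
    Tendsto (fun N : ℕ => 1 / (N : ℂ) * bulkCov N γ τ) atTop
      (𝓝 ((2 / Real.pi * ∫ s in (0 : ℝ)..τ, ∫ x in (-√(1 - s ^ 2))..√(1 - s ^ 2),
        Real.exp (-γ * x) : ℝ) : ℂ)) := by
  have hI : ∀ N n, levelFn N n ∈ unitInterval := fun N n =>
    ⟨(Real.exp_pos _).le, Real.exp_le_one_iff.2 (neg_nonpos.2 (by positivity))⟩
  have hI' : ∀ a p, discFn a p ∈ unitInterval := fun a p =>
    ⟨(Real.exp_pos _).le, Real.exp_le_one_iff.2 (neg_nonpos.2 (by positivity))⟩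
  have hm : ∀ a, Measurable (discFn a) := fun a => by unfold discFn; fun_prop
  -- The index is shifted to `N + 1` because integrability of the weight is available only for
  -- positive `N`.
  have h := tendsto_measureReal_of_tendsto_moments
    (fun N : ℕ => levelMeasure γ τ (N + 1)) (phaseMeasure γ)
    (fun N p => levelFn (N + 1) p.1) (fun N p => levelFn (N + 1) p.2) (discFn 0) (discFn (2 * τ))
    (fun N p => hI _ _) (fun N p => hI _ _) (hI' _) (hI' _) (fun N => measurable_of_countable _)
    (fun N => measurable_of_countable _) (hm _) (hm _)
    (fun N => by simpa using (integral_levelFn γ τ N.succ_pos 0 0).1)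
    (by simpa using (integral_phaseMeasure γ 0 1 0 (by norm_num)).1)
    (fun i j => (tendsto_add_atTop_iff_nat 1).2 (tendsto_integral_levelFn γ τ i j))
    (Real.exp (-1)) (Real.exp_pos _) (phaseMeasure_circle γ 0) (phaseMeasure_circle γ (2 * τ))
  rw [phaseMeasure_disc_diff γ hτ] at h
  have h2 := (tendsto_add_atTop_iff_nat (f := fun N : ℕ => (levelMeasure γ τ N).real
      {p | Real.exp (-1) < levelFn N p.1 ∧ levelFn N p.2 ≤ Real.exp (-1)}) 1).1 h
  refine ((Complex.continuous_ofReal.tendsto _).comp h2).congr' ?_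
  filter_upwards [eventually_gt_atTop 0] with N hN
  rw [Function.comp, levelMeasure_real γ τ hN, bulkCov,
    cov_expStat N _ _ (bulkParam γ τ N) (I_mul_bulk_eq N γ τ) (I_mul_neg_bulk_eq N γ τ)]
  push_cast
  rfl

/-! ### Evaluation of the limits -/

theorem integral_exp_neg_mul_symm {γ : ℝ} (hγ : γ ≠ 0) (w : ℝ) :
    ∫ x in (-w)..w, Real.exp (-γ * x) = 2 / γ * Real.sinh (γ * w) := by
  rw [intervalIntegral.integral_comp_mul_left (fun x => Real.exp x) (neg_ne_zero.2 hγ),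
    integral_exp, Real.sinh_eq, smul_eq_mul, neg_mul_neg, neg_mul]
  field_simp
  ring

theorem tendsto_bulkCov_of_ne_zero {γ : ℝ} (hγ : γ ≠ 0) {τ : ℝ} (hτ : 0 < τ) :
    Tendsto (fun N : ℕ => 1 / (N : ℂ) * bulkCov N γ τ) atTop
      (𝓝 ((4 / (γ * Real.pi) * ∫ s in (0 : ℝ)..τ, Real.sinh (γ * √(1 - s ^ 2)) : ℝ) : ℂ)) := by
  have h := tendsto_bulkCov γ hτ
  simp only [integral_exp_neg_mul_symm hγ] at h
  rw [intervalIntegral.integral_const_mul] at h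
  convert! h using 3
  have := Real.pi_pos.ne'
  field_simp
  ring

theorem tendsto_bulkCov_zero {τ : ℝ} (hτ : 0 < τ) :
    Tendsto (fun N : ℕ => 1 / (N : ℂ) * bulkCov N 0 τ) atTop
      (𝓝 ((4 / Real.pi * ∫ s in (0 : ℝ)..τ, √(1 - s ^ 2) : ℝ) : ℂ)) := by
  have h := tendsto_bulkCov 0 hτ
  have e : ∀ w : ℝ, ∫ x in (-w)..w, Real.exp (-0 * x) = 2 * w := fun w => by
    simp; ring
  simp only [e] at h
  rw [intervalIntegral.integral_const_mul] at h
  convert! h using 3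
  ring

/-- The real square root of a negative number is `0`, so the integrand vanishes beyond `s = 1`; this
is the saturation for `τ > 1`. -/
theorem integral_comp_sqrt_one_sub_sq {g : ℝ → ℝ} (hg : Continuous g) (h0 : g 0 = 0) {τ : ℝ}
    (hτ : 1 ≤ τ) :
    ∫ s in (0 : ℝ)..τ, g √(1 - s ^ 2) = ∫ s in (0 : ℝ)..1, g √(1 - s ^ 2) := by
  have hc : Continuous fun s : ℝ => g √(1 - s ^ 2) := by fun_prop
  rw [← intervalIntegral.integral_add_adjacent_intervals (hc.intervalIntegrable 0 1)
    (hc.intervalIntegrable 1 τ), intervalIntegral.integral_congr (g := fun _ => (0 : ℝ)) (a := 1)]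
  · simp
  · intro s hs
    rw [Set.uIcc_of_le hτ] at hs
    simp only
    rw [Real.sqrt_eq_zero_of_nonpos (by nlinarith [hs.1]), h0]

theorem integral_sqrt_one_sub_sq_zero_one :
    ∫ s in (0 : ℝ)..1, √(1 - s ^ 2) = Real.pi / 4 := by
  have hc : Continuous fun s : ℝ => √(1 - s ^ 2) := by fun_prop
  have h := integral_sqrt_one_sub_sq
  have h2 : ∫ s in (-1 : ℝ)..0, √(1 - s ^ 2) = ∫ s in (0 : ℝ)..1, √(1 - s ^ 2) := by
    have := intervalIntegral.integral_comp_neg (a := 0) (b := 1) fun s : ℝ => √(1 - s ^ 2)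
    simpa using this.symm
  rw [← intervalIntegral.integral_add_adjacent_intervals (hc.intervalIntegrable (-1) 0)
    (hc.intervalIntegrable 0 1), h2] at h
  linarith

theorem integral_sqrt_one_sub_sq_zero_left {τ : ℝ} (h0 : 0 < τ) (h1 : τ < 1) :
    ∫ s in (0 : ℝ)..τ, √(1 - s ^ 2) = (τ * √(1 - τ ^ 2) + Real.arcsin τ) / 2 := by
  have hc : Continuous fun s : ℝ => √(1 - s ^ 2) := by fun_prop
  rw [intervalIntegral.integral_eq_sub_of_hasDerivAt
    (f := fun s => (s * √(1 - s ^ 2) + Real.arcsin s) / 2) (fun s hs => ?_)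
    (hc.intervalIntegrable _ _)]
  · simp
  · rw [Set.uIcc_of_le h0.le] at hs
    have hpos : 0 < 1 - s ^ 2 := by nlinarith [hs.1, hs.2]
    have d1 : HasDerivAt (fun s : ℝ => 1 - s ^ 2) (-(2 * s)) s := by
      simpa using (hasDerivAt_pow 2 s).const_sub 1
    have d2 := d1.sqrt hpos.ne'
    have d3 := Real.hasDerivAt_arcsin (x := s) (by linarith [hs.1]) (by linarith [hs.2])
    refine ((((hasDerivAt_id s).mul d2).add d3).div_const 2).congr_deriv ?_
    have h2 : 0 < √(1 - s ^ 2) := Real.sqrt_pos.2 hpos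
    have h3 : √(1 - s ^ 2) ^ 2 = 1 - s ^ 2 := Real.sq_sqrt hpos.le
    simp only [id]
    field_simp
    rw [h3]
    ring

/-! ### The structure function as a covariance -/

theorem norm_expStat_le (N : ℕ) (k : ℝ) (x : Fin N → ℝ) : ‖expStat N k x‖ ≤ N := by
  refine (norm_sum_le _ _).trans ?_
  have h : ∀ j, ‖Complex.exp (Complex.I * k * (x j : ℂ))‖ = 1 := fun j => by
    rw [show Complex.I * k * (x j : ℂ) = ((k * x j : ℝ) : ℂ) * Complex.I by push_cast; ring,
      Complex.norm_exp_ofReal_mul_I]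
  simp [h]

theorem continuous_expStat (N : ℕ) (k : ℂ) : Continuous (expStat N k) := by
  unfold expStat
  fun_prop

theorem expStat_neg (N : ℕ) (k : ℝ) (x : Fin N → ℝ) :
    expStat N (-(k : ℂ)) x = (starRingEnd ℂ) (expStat N k x) := by
  simp only [expStat, map_sum, ← Complex.exp_conj]
  simp

theorem ofReal_structureFn (N : ℕ) (k : ℝ) :
    (structureFn N k : ℂ) = cov N (expStat N k) (expStat N (-(k : ℂ))) := by
  have i1 : Integrable (expStat N k) (law N) :=
    Integrable.of_bound (continuous_expStat N k).aestronglyMeasurable N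
      (Eventually.of_forall fun x => norm_expStat_le N k x)
  have i2 : Integrable (expStat N (-(k : ℂ))) (law N) :=
    Integrable.of_bound (continuous_expStat N _).aestronglyMeasurable N
      (Eventually.of_forall fun x => by
        rw [expStat_neg, RCLike.norm_conj]; exact norm_expStat_le N k x)
  have e : ∀ x, expStat N k x * expStat N (-(k : ℂ)) x = ((‖expStat N k x‖ ^ 2 : ℝ) : ℂ) :=
    fun x => by rw [expStat_neg, Complex.mul_conj, Complex.normSq_eq_norm_sq]
  have i3 : Integrable (fun x => expStat N k x * expStat N (-(k : ℂ)) x) (law N) := by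
    refine Integrable.of_bound ((continuous_expStat N _).mul
      (continuous_expStat N _)).aestronglyMeasurable (N * N) (Eventually.of_forall fun x => ?_)
    rw [norm_mul, expStat_neg, RCLike.norm_conj]
    have := norm_expStat_le N k x
    gcongr
  have hmean : mean N (expStat N (-(k : ℂ))) = (starRingEnd ℂ) (mean N (expStat N k)) := by
    simp only [mean, expStat_neg]
    exact integral_conj
  rw [cov_eq_mean_mul_sub i1 i2 i3, hmean, Complex.mul_conj, Complex.normSq_eq_norm_sq]
  simp only [mean, e]
  rw [integral_complex_ofReal, structureFn]
  push_cast
  rfl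

theorem tendsto_structureFn {τ : ℝ} (hτ : 0 < τ) :
    Tendsto (fun N : ℕ => 1 / (N : ℝ) * structureFn N (bulkWave N τ)) atTop
      (𝓝 (4 / Real.pi * ∫ s in (0 : ℝ)..τ, √(1 - s ^ 2))) := by
  have h := tendsto_bulkCov_zero hτ
  have e : ∀ N : ℕ, 1 / (N : ℂ) * bulkCov N 0 τ =
      ((1 / (N : ℝ) * structureFn N (bulkWave N τ) : ℝ) : ℂ) := fun N => by
    rw [Complex.ofReal_mul, ofReal_structureFn, bulkCov]
    simp [bulkShift]
  simp only [e] at h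
  exact ((Complex.continuous_re.tendsto _).comp h).congr fun N => by
    simp only [Function.comp, Complex.ofReal_re]

/-! ### Laplace's method with a complex quadratic phase -/

theorem integrable_pow_mul_exp_neg_mul_sq {b : ℝ} (hb : 0 < b) (k : ℕ) :
    Integrable fun u : ℝ => u ^ k * Real.exp (-b * u ^ 2) := by
  have := integrable_rpow_mul_exp_neg_mul_sq hb (s := k)
    (by have := Nat.cast_nonneg (α := ℝ) k; linarith)
  simpa [Real.rpow_natCast] using this

theorem norm_cexp_neg_mul_sq (b : ℂ) (u : ℝ) :
    ‖Complex.exp (-b * (u : ℂ) ^ 2)‖ = Real.exp (-b.re * u ^ 2) := by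
  rw [Complex.norm_exp, ← Complex.ofReal_pow, Complex.re_mul_ofReal, Complex.neg_re]

theorem integrable_pow_mul_cexp_neg_mul_sq {b : ℂ} (hb : 0 < b.re) (k : ℕ) :
    Integrable fun u : ℝ => (u : ℂ) ^ k * Complex.exp (-b * (u : ℂ) ^ 2) := by
  refine (integrable_pow_mul_exp_neg_mul_sq hb k).norm.mono'
    (by fun_prop : Continuous _).aestronglyMeasurable (Eventually.of_forall fun u => ?_)
  rw [norm_mul, norm_mul, norm_cexp_neg_mul_sq, norm_pow, norm_pow, Complex.norm_real,
    Real.norm_of_nonneg (Real.exp_pos _).le]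

/-- Under `v = √N u` the three terms scale alike, which is the source of the rate `N^{-3/2}`. -/
theorem integral_scaled_moments {c : ℝ} {N : ℕ} (hN : 0 < N) :
    ∫ u : ℝ, (u ^ 2 + N * u ^ 4 + N ^ 2 * u ^ 6) * Real.exp (-c * (N * u ^ 2)) =
      1 / (N * √N) * ∫ v : ℝ, (v ^ 2 + v ^ 4 + v ^ 6) * Real.exp (-c * v ^ 2) := by
  have hN' : (0 : ℝ) < N := by exact_mod_cast hN
  have hs : 0 < √(N : ℝ) := Real.sqrt_pos.2 hN'
  have h2 : √(N : ℝ) ^ 2 = N := Real.sq_sqrt hN'.le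
  have h4 : √(N : ℝ) ^ 4 = N ^ 2 := by rw [show 4 = 2 * 2 by rfl, pow_mul, h2]
  have h6 : √(N : ℝ) ^ 6 = N ^ 3 := by rw [show 6 = 2 * 3 by rfl, pow_mul, h2]
  have e : ∀ u : ℝ, (u ^ 2 + N * u ^ 4 + N ^ 2 * u ^ 6) * Real.exp (-c * (N * u ^ 2)) =
      1 / N * ((fun v : ℝ => (v ^ 2 + v ^ 4 + v ^ 6) * Real.exp (-c * v ^ 2)) (√N * u)) :=
    fun u => by
    simp only [mul_pow, h2, h4, h6]
    field_simp
  rw [integral_congr_ae (Eventually.of_forall e), integral_const_mul,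
    Measure.integral_comp_mul_left
      (fun v : ℝ => (v ^ 2 + v ^ 4 + v ^ 6) * Real.exp (-c * v ^ 2)) √N, abs_of_pos (inv_pos.2 hs), smul_eq_mul,
    ← mul_assoc]
  congr 1
  field_simp

theorem integrable_scaled_moments {c : ℝ} (hc : 0 < c) {N : ℕ} (hN : 0 < N) :
    Integrable fun u : ℝ => (u ^ 2 + N * u ^ 4 + N ^ 2 * u ^ 6) *
      Real.exp (-c * (N * u ^ 2)) := by
  have hN' : (0 : ℝ) < N := by exact_mod_cast hN
  have h := fun k => integrable_pow_mul_exp_neg_mul_sq (mul_pos hc hN') k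
  refine (((h 2).add ((h 4).const_mul (N : ℝ))).add ((h 6).const_mul ((N : ℝ) ^ 2))).congr
    (Eventually.of_forall fun u => ?_)
  simp only [Pi.add_apply]
  rw [show -c * (N * u ^ 2) = -(c * N) * u ^ 2 by ring]
  ring

theorem combination_le_mul_sum {a b c x y z : ℝ} (ha : 0 ≤ a) (hb : 0 ≤ b) (hc : 0 ≤ c)
    (hx : 0 ≤ x) (hy : 0 ≤ y) (hz : 0 ≤ z) :
    a * z + (b * x + c * y) ≤ (a + b + c) * (x + y + z) := by
  have e1 := mul_nonneg ha (add_nonneg hx hy)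
  have e2 := mul_nonneg hb (add_nonneg hy hz)
  have e3 := mul_nonneg hc (add_nonneg hx hz)
  linarith

-- With the Gaussian pulled out, `ε = N (L + p u²)` is close to `-N q u³`. The remainder of `exp ε`
-- costs `N² u⁶`, replacing `ε` by its cubic part costs `N u⁴`, the amplitude costs `u²`, and the
-- cross term costs `N u⁴`. By `hQ`, `‖ε‖` is at most half the Gaussian exponent, so half of the
-- decay survives.
set_option maxHeartbeats 800000 in
theorem laplace_local_bound {p q A₀ A₁ : ℂ} {C δ : ℝ} (hC : 0 ≤ C) (hδ : 0 ≤ δ) (hδ1 : δ ≤ 1)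
    (hQ : (‖q‖ + C) * δ ≤ p.re / 2) {N : ℕ} {u : ℝ} (hu : |u| ≤ δ) {L A : ℂ}
    (hL : ‖L + p * (u : ℂ) ^ 2 + q * (u : ℂ) ^ 3‖ ≤ C * u ^ 4)
    (hA : ‖A - A₀ - A₁ * u‖ ≤ C * u ^ 2) :
    ‖A * Complex.exp (N * L) - Complex.exp (-(N * p) * (u : ℂ) ^ 2) *
      (A₀ + A₁ * u - N * q * A₀ * (u : ℂ) ^ 3)‖ ≤
      ((‖A₀‖ + ‖A₁‖ + C) * (‖q‖ + C) ^ 2 + C + (‖A₀‖ + ‖A₁‖ + C) * C + ‖q‖ * (‖A₁‖ + C)) *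
      ((u ^ 2 + N * u ^ 4 + N ^ 2 * u ^ 6) * Real.exp (-(p.re / 2) * (N * u ^ 2))) := by
  have hu0 := abs_nonneg u
  have hu1 : |u| ≤ 1 := hu.trans hδ1
  have hus : u ^ 2 = |u| ^ 2 := (sq_abs u).symm
  have hu4 : u ^ 4 = |u| ^ 4 := by rw [show 4 = 2 * 2 by rfl, pow_mul, pow_mul, hus]
  have hu6 : u ^ 6 = |u| ^ 6 := by rw [show 6 = 2 * 3 by rfl, pow_mul, pow_mul, hus]
  have hN : (0 : ℝ) ≤ N := Nat.cast_nonneg N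
  have nu : ∀ k : ℕ, ‖(u : ℂ) ^ k‖ = |u| ^ k := fun k => by
    rw [norm_pow, Complex.norm_real, Real.norm_eq_abs]
  have hpow : |u| ^ 4 ≤ |u| ^ 3 := pow_le_pow_of_le_one hu0 hu1 (by norm_num)
  have hpow1 : |u| ^ 2 ≤ |u| := by nlinarith
  set ε : ℂ := N * (L + p * (u : ℂ) ^ 2) with hε
  have hεN : ‖ε‖ ≤ N * ((‖q‖ + C) * |u| ^ 3) := by
    rw [hε, norm_mul, Complex.norm_natCast]
    refine mul_le_mul_of_nonneg_left ?_ hN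
    calc ‖L + p * (u : ℂ) ^ 2‖ = ‖(L + p * (u : ℂ) ^ 2 + q * (u : ℂ) ^ 3) - q * (u : ℂ) ^ 3‖ := by
          congr 1; ring
      _ ≤ C * u ^ 4 + ‖q‖ * |u| ^ 3 := by
          refine (norm_sub_le _ _).trans (add_le_add hL ?_)
          rw [norm_mul, nu]
      _ ≤ C * |u| ^ 3 + ‖q‖ * |u| ^ 3 := by rw [hu4]; gcongr
      _ = (‖q‖ + C) * |u| ^ 3 := by ring
  have hεexp : ‖ε‖ ≤ p.re / 2 * (N * u ^ 2) := by
    refine hεN.trans ?_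
    calc N * ((‖q‖ + C) * |u| ^ 3) = ((‖q‖ + C) * |u|) * (N * u ^ 2) := by rw [hus]; ring
      _ ≤ ((‖q‖ + C) * δ) * (N * u ^ 2) := by gcongr
      _ ≤ _ := by gcongr
  have hε3 : ‖ε + N * (q * (u : ℂ) ^ 3)‖ ≤ N * (C * |u| ^ 4) := by
    rw [hε, ← mul_add, norm_mul, Complex.norm_natCast, ← hu4]
    exact mul_le_mul_of_nonneg_left hL hN
  have hA1 : ‖A - A₀‖ ≤ (‖A₁‖ + C) * |u| := by
    calc ‖A - A₀‖ = ‖(A - A₀ - A₁ * u) + A₁ * u‖ := by congr 1; ring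
      _ ≤ C * u ^ 2 + ‖A₁‖ * |u| := by
          refine (norm_add_le _ _).trans (add_le_add hA ?_)
          rw [norm_mul, Complex.norm_real, Real.norm_eq_abs]
      _ ≤ C * |u| + ‖A₁‖ * |u| := by rw [hus]; gcongr
      _ = _ := by ring
  have hAn : ‖A‖ ≤ ‖A₀‖ + ‖A₁‖ + C := by
    calc ‖A‖ = ‖A₀ + (A - A₀)‖ := by congr 1; ring
      _ ≤ ‖A₀‖ + (‖A₁‖ + C) * |u| := (norm_add_le _ _).trans (by gcongr)
      _ ≤ ‖A₀‖ + (‖A₁‖ + C) * 1 := by gcongr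
      _ = _ := by ring
  have hexp : ‖Complex.exp ε - 1 - ε‖ ≤ ‖ε‖ ^ 2 * Real.exp ‖ε‖ := by
    have := Complex.norm_exp_sub_sum_le_norm_mul_exp ε 2
    simpa [Finset.sum_range_succ, sub_sub] using this
  have hfac : A * Complex.exp (N * L) - Complex.exp (-(N * p) * (u : ℂ) ^ 2) *
      (A₀ + A₁ * u - N * q * A₀ * (u : ℂ) ^ 3) = Complex.exp (-(N * p) * (u : ℂ) ^ 2) *
      (A * (Complex.exp ε - 1 - ε) + ((A - A₀ - A₁ * u) + A * (ε + N * (q * (u : ℂ) ^ 3)) -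
        N * (q * (u : ℂ) ^ 3) * (A - A₀))) := by
    have : Complex.exp (N * L) = Complex.exp (-(N * p) * (u : ℂ) ^ 2) * Complex.exp ε := by
      rw [← Complex.exp_add, hε]; congr 1; ring
    rw [this]
    ring
  have hg : ‖Complex.exp (-(N * p) * (u : ℂ) ^ 2)‖ = Real.exp (-(p.re / 2) * (N * u ^ 2)) *
      Real.exp (-(p.re / 2) * (N * u ^ 2)) := by
    rw [norm_cexp_neg_mul_sq, ← Real.exp_add]
    congr 1
    simp
    ring
  set G := Real.exp (-(p.re / 2) * (N * u ^ 2)) with hGdef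
  have hG0 : 0 < G := Real.exp_pos _
  have hre : 0 ≤ p.re / 2 := le_trans (by positivity) hQ
  have hG1 : G ≤ 1 := by
    rw [hGdef, Real.exp_le_one_iff]
    have : 0 ≤ p.re / 2 * (N * u ^ 2) := by positivity
    linarith
  have hGε : G * Real.exp ‖ε‖ ≤ 1 := by
    rw [hGdef, ← Real.exp_add, Real.exp_le_one_iff]
    linarith
  set M := ‖A₀‖ + ‖A₁‖ + C
  have hM : 0 ≤ M := by positivity
  rw [hfac, norm_mul, hg]
  have t1 : ‖A * (Complex.exp ε - 1 - ε)‖ ≤ M * (N * ((‖q‖ + C) * |u| ^ 3)) ^ 2 *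
      Real.exp ‖ε‖ := by
    rw [norm_mul, mul_assoc]
    refine mul_le_mul hAn (hexp.trans ?_) (norm_nonneg _) hM
    gcongr
  have t2 : ‖(A - A₀ - A₁ * u) + A * (ε + N * (q * (u : ℂ) ^ 3)) -
        N * (q * (u : ℂ) ^ 3) * (A - A₀)‖ ≤ C * u ^ 2 + M * (N * (C * |u| ^ 4)) +
        N * (‖q‖ * |u| ^ 3) * ((‖A₁‖ + C) * |u|) := by
    refine (norm_sub_le _ _).trans (add_le_add ((norm_add_le _ _).trans (add_le_add hA ?_)) ?_)
    · rw [norm_mul]; gcongr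
    · rw [norm_mul, norm_mul, norm_mul, nu, Complex.norm_natCast]; gcongr
  calc G * G * ‖A * (Complex.exp ε - 1 - ε) + ((A - A₀ - A₁ * u) +
        A * (ε + N * (q * (u : ℂ) ^ 3)) - N * (q * (u : ℂ) ^ 3) * (A - A₀))‖
      ≤ G * G * (M * (N * ((‖q‖ + C) * |u| ^ 3)) ^ 2 * Real.exp ‖ε‖ +
        (C * u ^ 2 + M * (N * (C * |u| ^ 4)) + N * (‖q‖ * |u| ^ 3) * ((‖A₁‖ + C) * |u|))) := by
        gcongr
        exact (norm_add_le _ _).trans (add_le_add t1 t2)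
    _ = G * (M * (‖q‖ + C) ^ 2 * (N ^ 2 * u ^ 6) * (G * Real.exp ‖ε‖) +
        (C * u ^ 2 + (M * C + ‖q‖ * (‖A₁‖ + C)) * (N * u ^ 4)) * G) := by
        rw [hu6, hu4]; ring
    _ ≤ G * (M * (‖q‖ + C) ^ 2 * (N ^ 2 * u ^ 6) * 1 +
        (C * u ^ 2 + (M * C + ‖q‖ * (‖A₁‖ + C)) * (N * u ^ 4)) * 1) := by
        gcongr
    _ ≤ (M * (‖q‖ + C) ^ 2 + C + M * C + ‖q‖ * (‖A₁‖ + C)) *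
        ((u ^ 2 + N * u ^ 4 + N ^ 2 * u ^ 6) * G) := by
        rw [mul_one, mul_one, mul_comm G, ← mul_assoc _ _ G]
        refine mul_le_mul_of_nonneg_right ?_ hG0.le
        refine (combination_le_mul_sum (by positivity) hC (by positivity) (by positivity)
          (by positivity) (by positivity)).trans (le_of_eq (by ring))

/-- Away from the saddle `1 ≤ |u| / δ`, so missing powers of `u` can be inserted at the cost of
powers of `1 / δ`. The tail thus gets a majorant of the same shape as the local error. -/
theorem laplace_far_bound {p q A₀ A₁ B : ℂ} {c C δ : ℝ} (hδ : 0 < δ) (hC : 0 ≤ C)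
    (hcp : c ≤ p.re) {N : ℕ} {u : ℝ} (hu : δ ≤ |u|)
    (hB : ‖B‖ ≤ C * Real.exp (-c * (N * u ^ 2))) :
    ‖B - Complex.exp (-(N * p) * (u : ℂ) ^ 2) *
      (A₀ + A₁ * u - N * q * A₀ * (u : ℂ) ^ 3)‖ ≤
      ((C + ‖A₀‖) / δ ^ 2 + ‖A₁‖ / δ + ‖q‖ * ‖A₀‖ / δ) *
      ((u ^ 2 + N * u ^ 4 + N ^ 2 * u ^ 6) * Real.exp (-c * (N * u ^ 2))) := by
  have hN : (0 : ℝ) ≤ N := Nat.cast_nonneg N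
  have hus : u ^ 2 = |u| ^ 2 := (sq_abs u).symm
  have hu4 : u ^ 4 = |u| ^ 4 := by rw [show 4 = 2 * 2 by rfl, pow_mul, pow_mul, hus]
  have hu0 := abs_nonneg u
  have h1 : 1 ≤ |u| / δ := (one_le_div hδ).2 hu
  have h1' : 1 ≤ u ^ 2 / δ ^ 2 := by rw [hus, ← div_pow]; exact one_le_pow₀ h1
  set G := Real.exp (-c * (N * u ^ 2)) with hG
  have hG0 : 0 < G := Real.exp_pos _
  have hg : ‖Complex.exp (-(N * p) * (u : ℂ) ^ 2)‖ ≤ G := by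
    rw [norm_cexp_neg_mul_sq, hG, Real.exp_le_exp]
    have h3 : 0 ≤ (p.re - c) * (N * u ^ 2) := mul_nonneg (by linarith) (by positivity)
    simp
    linarith
  have h2 : ‖A₀ + A₁ * u - N * q * A₀ * (u : ℂ) ^ 3‖ ≤
      ‖A₀‖ * (u ^ 2 / δ ^ 2) + ‖A₁‖ * (u ^ 2 / δ) + ‖q‖ * ‖A₀‖ * (N * u ^ 4 / δ) := by
    refine (norm_sub_le _ _).trans (add_le_add ((norm_add_le _ _).trans (add_le_add ?_ ?_)) ?_)
    · exact le_mul_of_one_le_right (norm_nonneg _) h1'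
    · rw [norm_mul, Complex.norm_real, Real.norm_eq_abs]
      refine mul_le_mul_of_nonneg_left ?_ (norm_nonneg _)
      rw [hus, sq, mul_div_assoc]
      exact le_mul_of_one_le_right hu0 h1
    · rw [norm_mul, norm_mul, norm_mul, norm_pow, Complex.norm_real, Real.norm_eq_abs,
        Complex.norm_natCast]
      calc N * ‖q‖ * ‖A₀‖ * |u| ^ 3 = ‖q‖ * ‖A₀‖ * (N * |u| ^ 3 * 1) := by ring
        _ ≤ ‖q‖ * ‖A₀‖ * (N * |u| ^ 3 * (|u| / δ)) := by gcongr
        _ = _ := by rw [hu4]; ring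
  calc _ ≤ C * G + G * (‖A₀‖ * (u ^ 2 / δ ^ 2) + ‖A₁‖ * (u ^ 2 / δ) +
        ‖q‖ * ‖A₀‖ * (N * u ^ 4 / δ)) := by
        refine (norm_sub_le _ _).trans (add_le_add hB ?_)
        rw [norm_mul]
        gcongr
    _ ≤ C * (u ^ 2 / δ ^ 2) * G + G * (‖A₀‖ * (u ^ 2 / δ ^ 2) + ‖A₁‖ * (u ^ 2 / δ) +
        ‖q‖ * ‖A₀‖ * (N * u ^ 4 / δ)) := by
        gcongr
        exact le_mul_of_one_le_right hC h1'
    _ = ((C + ‖A₀‖) / δ ^ 2 + ‖A₁‖ / δ) * (u ^ 2 * G) +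
        ‖q‖ * ‖A₀‖ / δ * (N * u ^ 4 * G) := by ring
    _ ≤ ((C + ‖A₀‖) / δ ^ 2 + ‖A₁‖ / δ) * ((u ^ 2 + N * u ^ 4 + N ^ 2 * u ^ 6) * G) +
        ‖q‖ * ‖A₀‖ / δ * ((u ^ 2 + N * u ^ 4 + N ^ 2 * u ^ 6) * G) := by
        have a2 : 0 ≤ u ^ 2 := by positivity
        have a4 : 0 ≤ N * u ^ 4 := by positivity
        have a6 : 0 ≤ N ^ 2 * u ^ 6 := by positivity
        gcongr <;> linarith
    _ = _ := by ring

theorem integral_eq_zero_of_odd {f : ℝ → ℂ} (hf : ∀ u, f (-u) = -f u) : ∫ u, f u = 0 := by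
  have h1 := integral_neg_eq_self f volume
  simp only [hf, integral_neg] at h1
  linear_combination (-1 / 2 : ℂ) * h1

/-- Laplace's method, with an error of relative order `1/N`, at an interior nondegenerate saddle. -/
theorem laplace_method {a b α₀ : ℝ} {A P : ℝ → ℂ} {P₀ p q A₀ A₁ : ℂ} {c C δ : ℝ}
    (hA : Continuous A) (hP : Continuous P) (hδ : 0 < δ) (hδ1 : δ ≤ 1)
    (ha : a ≤ α₀ - δ) (hb : α₀ + δ ≤ b) (hc : 0 < c) (hC : 0 ≤ C) (hp : 0 < p.re)
    (hP₀ : ‖P₀‖ = 1) (hAC : ∀ α ∈ Set.Icc a b, ‖A α‖ ≤ C)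
    (hPc : ∀ α ∈ Set.Icc a b, ‖P α‖ ≤ Real.exp (-c * (α - α₀) ^ 2))
    (L : ℝ → ℂ) (hL : ∀ u, |u| ≤ δ → P (α₀ + u) = P₀ * Complex.exp (L u))
    (hLb : ∀ u : ℝ, |u| ≤ δ → ‖L u + p * (u : ℂ) ^ 2 + q * (u : ℂ) ^ 3‖ ≤ C * u ^ 4)
    (hAb : ∀ u : ℝ, |u| ≤ δ → ‖A (α₀ + u) - A₀ - A₁ * u‖ ≤ C * u ^ 2) :
    ∃ K : ℝ, ∀ N : ℕ, 0 < N →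
      ‖(∫ α in a..b, A α * P α ^ N) - P₀ ^ N * A₀ * ((Real.pi : ℂ) / (N * p)) ^ (1 / 2 : ℂ)‖ ≤
        K / (N * √N) := by
  -- One Gaussian rate for both regions; `δ'` is shrunk so that the cubic and quartic terms stay
  -- below half of the quadratic one.
  set c' := min c (p.re / 2) with hc'
  have hc'0 : 0 < c' := lt_min hc (by linarith)
  set δ' := min δ (p.re / 2 / (‖q‖ + C + 1)) with hδ'
  have hqC : 0 < ‖q‖ + C + 1 := by positivity
  have hδ'0 : 0 < δ' := lt_min hδ (by positivity)
  have hQ : (‖q‖ + C) * δ' ≤ p.re / 2 := by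
    have h1 : δ' ≤ p.re / 2 / (‖q‖ + C + 1) := min_le_right _ _
    rw [le_div_iff₀ hqC] at h1
    nlinarith
  set K₁ := (‖A₀‖ + ‖A₁‖ + C) * (‖q‖ + C) ^ 2 + C + (‖A₀‖ + ‖A₁‖ + C) * C + ‖q‖ * (‖A₁‖ + C)
  set K₂ := (C + ‖A₀‖) / δ' ^ 2 + ‖A₁‖ / δ' + ‖q‖ * ‖A₀‖ / δ'
  have hK₁ : 0 ≤ K₁ := by positivity
  have hK₂ : 0 ≤ K₂ := by positivity
  refine ⟨(K₁ + K₂) * ∫ v : ℝ, (v ^ 2 + v ^ 4 + v ^ 6) * Real.exp (-c' * v ^ 2), fun N hN => ?_⟩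
  have hN' : (0 : ℝ) < N := by exact_mod_cast hN
  have hNp : 0 < ((N : ℂ) * p).re := by
    rw [← Complex.ofReal_natCast, Complex.re_ofReal_mul]; positivity
  set f : ℝ → ℂ := (Set.Icc (a - α₀) (b - α₀)).indicator
    (fun u => A (α₀ + u) * P (α₀ + u) ^ N) with hf
  set g : ℝ → ℂ := fun u => Complex.exp (-(N * p) * (u : ℂ) ^ 2) *
    (A₀ + A₁ * u - N * q * A₀ * (u : ℂ) ^ 3) with hg
  have hbound : ∀ u, ‖f u - P₀ ^ N * g u‖ ≤ (K₁ + K₂) *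
      ((u ^ 2 + N * u ^ 4 + N ^ 2 * u ^ 6) * Real.exp (-c' * (N * u ^ 2))) := by
    intro u
    have hpoly : 0 ≤ (u ^ 2 + N * u ^ 4 + N ^ 2 * u ^ 6) := by positivity
    have hmono : ∀ d, c' ≤ d → Real.exp (-d * (N * u ^ 2)) ≤ Real.exp (-c' * (N * u ^ 2)) := by
      intro d hd
      rw [Real.exp_le_exp]
      have : 0 ≤ (d - c') * (N * u ^ 2) := mul_nonneg (by linarith) (by positivity)
      linarith
    by_cases hu : |u| ≤ δ'
    · have huδ : |u| ≤ δ := hu.trans (min_le_left _ _)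
      have hmem : u ∈ Set.Icc (a - α₀) (b - α₀) := by
        have := abs_le.1 huδ
        exact ⟨by linarith [this.1], by linarith [this.2]⟩
      have e : f u - P₀ ^ N * g u = P₀ ^ N * (A (α₀ + u) * Complex.exp (N * L u) -
          Complex.exp (-(N * p) * (u : ℂ) ^ 2) * (A₀ + A₁ * u - N * q * A₀ * (u : ℂ) ^ 3)) := by
        rw [hf, Set.indicator_of_mem hmem, hL u huδ, mul_pow, ← Complex.exp_nat_mul, hg]
        ring
      rw [e, norm_mul, norm_pow, hP₀, one_pow, one_mul]
      refine (laplace_local_bound hC hδ'0.le ((min_le_left _ _).trans hδ1) hQ hu (hLb u huδ)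
        (hAb u huδ)).trans ?_
      refine mul_le_mul (by linarith) (mul_le_mul_of_nonneg_left (hmono _ (min_le_right _ _)) hpoly)
        (by positivity) (by positivity)
    · have hu' : δ' ≤ |u| := (not_le.1 hu).le
      have hunit : ‖(P₀ ^ N)⁻¹‖ = 1 := by rw [norm_inv, norm_pow, hP₀, one_pow, inv_one]
      have hne : P₀ ^ N ≠ 0 := by
        rw [← norm_ne_zero_iff, norm_pow, hP₀]; simp
      have e : f u - P₀ ^ N * g u = P₀ ^ N * ((P₀ ^ N)⁻¹ * f u - g u) := by
        rw [mul_sub, mul_inv_cancel_left₀ hne]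
      rw [e, norm_mul, norm_pow, hP₀, one_pow, one_mul]
      have hfB : ‖(P₀ ^ N)⁻¹ * f u‖ ≤ C * Real.exp (-c' * (N * u ^ 2)) := by
        rw [norm_mul, hunit, one_mul, hf]
        by_cases hmem : u ∈ Set.Icc (a - α₀) (b - α₀)
        · have hm2 : α₀ + u ∈ Set.Icc a b := ⟨by linarith [hmem.1], by linarith [hmem.2]⟩
          rw [Set.indicator_of_mem hmem, norm_mul, norm_pow]
          refine mul_le_mul (hAC _ hm2) ?_ (by positivity) hC
          refine (pow_le_pow_left₀ (norm_nonneg _) (hPc _ hm2) N).trans ?_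
          rw [← Real.exp_nat_mul, show (N : ℝ) * (-c * (α₀ + u - α₀) ^ 2) = -c * (N * u ^ 2) by ring]
          exact hmono _ (min_le_left _ _)
        · rw [Set.indicator_of_notMem hmem, norm_zero]
          positivity
      refine (laplace_far_bound hδ'0 hC ((min_le_right _ _).trans (by linarith)) hu' hfB).trans ?_
      exact mul_le_mul_of_nonneg_right (by linarith) (by positivity)
  have if1 : Integrable f := by
    rw [hf, integrable_indicator_iff measurableSet_Icc]
    exact (by fun_prop : Continuous fun u => A (α₀ + u) * P (α₀ + u) ^ N).continuousOn.integrableOn_Icc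
  have ig1 : Integrable fun u : ℝ => A₀ * Complex.exp (-(N * p) * (u : ℂ) ^ 2) := by
    simpa using (integrable_pow_mul_cexp_neg_mul_sq hNp 0).const_mul A₀
  have ig2 : Integrable fun u : ℝ => Complex.exp (-(N * p) * (u : ℂ) ^ 2) *
      (A₁ * u - N * q * A₀ * (u : ℂ) ^ 3) := by
    refine (((integrable_pow_mul_cexp_neg_mul_sq hNp 1).const_mul A₁).sub
      ((integrable_pow_mul_cexp_neg_mul_sq hNp 3).const_mul (N * q * A₀))).congr
      (Eventually.of_forall fun u => ?_)
    simp only [Pi.sub_apply]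
    ring
  have hgs : g = fun u : ℝ => A₀ * Complex.exp (-(N * p) * (u : ℂ) ^ 2) +
      Complex.exp (-(N * p) * (u : ℂ) ^ 2) * (A₁ * u - N * q * A₀ * (u : ℂ) ^ 3) := by
    funext u; rw [hg]; ring
  have ig : Integrable g := by rw [hgs]; exact ig1.add ig2
  -- The terms in `u` and `u³` are odd and integrate to zero; they are kept in `g` so that the
  -- remaining error is `N^{-3/2}` and not `N^{-1}`.
  have hgint : ∫ u, g u = A₀ * ((Real.pi : ℂ) / (N * p)) ^ (1 / 2 : ℂ) := by
    rw [hgs, integral_add ig1 ig2, integral_const_mul, integral_gaussian_complex hNp,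
      integral_eq_zero_of_odd, add_zero]
    intro u
    push_cast
    ring_nf
  have hfint : ∫ u, f u = ∫ α in a..b, A α * P α ^ N := by
    rw [hf, integral_indicator measurableSet_Icc, integral_Icc_eq_integral_Ioc,
      ← intervalIntegral.integral_of_le (by linarith),
      intervalIntegral.integral_comp_add_left (fun α => A α * P α ^ N)]
    congr 1 <;> ring
  have hmain : (∫ α in a..b, A α * P α ^ N) -
      P₀ ^ N * A₀ * ((Real.pi : ℂ) / (N * p)) ^ (1 / 2 : ℂ) = ∫ u, (f u - P₀ ^ N * g u) := by
    rw [integral_sub if1 (ig.const_mul _), integral_const_mul, hgint, hfint, mul_assoc]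
  rw [hmain]
  refine (norm_integral_le_of_norm_le ((integrable_scaled_moments hc'0 hN).const_mul (K₁ + K₂))
    (Eventually.of_forall hbound)).trans (le_of_eq ?_)
  rw [integral_const_mul, integral_scaled_moments hN]
  ring

/-! ### A contour integral for the mean -/

/-- The diagonal terms are the Laguerre values `Lₙ(-c²)`, and Pascal's rule sums them to the
associated Laguerre polynomial of parameter `1` and degree `N - 1`. -/
theorem sum_charlier_diag_div_factorial (c : ℂ) (N : ℕ) :
    ∑ n ∈ Finset.range N, charlier c n n / n.factorial =
      ∑ j ∈ Finset.range N, (N.choose (j + 1) : ℂ) * ((c ^ 2) ^ j / j.factorial) := by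
  induction N with
  | zero => simp
  | succ N ih =>
    have h : charlier c N N / N.factorial =
        ∑ j ∈ Finset.range (N + 1), (N.choose j : ℂ) * ((c ^ 2) ^ j / j.factorial) := by
      rw [← biCharlier_one, biCharlier_diag_div_factorial, ← Finset.Nat.sum_antidiagonal_swap,
        ← Finset.Nat.sum_antidiagonal_eq_sum_range_succ
          (fun j _ => (N.choose j : ℂ) * ((c ^ 2) ^ j / j.factorial))]
      refine Finset.sum_congr rfl fun p hp => ?_
      rw [Finset.HasAntidiagonal.mem_antidiagonal] at hp
      simp only [Prod.fst_swap, Prod.snd_swap, one_pow, mul_one]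
      rw [show p.2 + p.1 = N by omega, ← hp, Nat.choose_symm_add, sq, mul_div_assoc]
    have h2 : ∀ j, (((N + 1).choose (j + 1) : ℕ) : ℂ) * ((c ^ 2) ^ j / j.factorial) =
        (N.choose j : ℂ) * ((c ^ 2) ^ j / j.factorial) +
          (N.choose (j + 1) : ℂ) * ((c ^ 2) ^ j / j.factorial) := fun j => by
      rw [Nat.choose_succ_succ]; push_cast; ring
    rw [Finset.sum_range_succ, ih, h, Finset.sum_congr rfl fun j _ => h2 j,
      Finset.sum_add_distrib, Finset.sum_range_succ _ N, add_comm]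
    congr 1
    rw [Finset.sum_range_succ]
    simp

theorem mean_expStat (N : ℕ) (k c : ℂ) (hk : Complex.I * k = √2 * c) :
    mean N (expStat N k) = Complex.exp (c ^ 2 / 2) *
      ∑ j ∈ Finset.range N, (N.choose (j + 1) : ℂ) * ((c ^ 2) ^ j / j.factorial) := by
  rw [expStat_eq N k c hk, (mean_linearStat hermiteFn N (density_eq_slater_sq N) element_one
    hasElements_one (fun x => Complex.exp (√2 * c * x)) (hasElements_cexp _)).2,
    ← sum_charlier_diag_div_factorial, Finset.mul_sum]
  refine Finset.sum_congr rfl fun n _ => ?_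
  rw [element_cexp, ← Nat.cast_mul, ← sq, Nat.cast_pow, Real.sqrt_sq (Nat.cast_nonneg _),
    mul_div_assoc, Complex.ofReal_natCast]

theorem circleIntegral_exp_mul_inv_pow (z : ℂ) {R : ℝ} (hR : 0 < R) (m : ℕ) :
    (∮ w in C(0, R), Complex.exp (z * w) * (w⁻¹) ^ (m + 1)) =
      2 * Real.pi * Complex.I * (z ^ m / m.factorial) := by
  have hd : Differentiable ℂ fun w : ℂ => Complex.exp (z * w) := by fun_prop
  have h := hd.differentiableOn.circleIntegral_one_div_sub_center_pow_smul (c := 0) hR m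
  simp only [iteratedDeriv_cexp_const_mul, sub_zero, smul_eq_mul, mul_zero, Complex.exp_zero,
    mul_one] at h
  rw [show (2 * Real.pi * Complex.I * (z ^ m / m.factorial) : ℂ) =
    2 * Real.pi * Complex.I / m.factorial * z ^ m by ring, ← h]
  refine circleIntegral.integral_congr hR.le fun w _ => ?_
  simp only [one_div, inv_pow]
  ring

/-- In the binomial expansion `w^{-(j+1)}` extracts the Taylor coefficient `z^j / j!`, and the term
without a pole integrates to zero. -/
theorem circleIntegral_exp_mul_one_add_inv_pow (z : ℂ) {R : ℝ} (hR : 0 < R) (N : ℕ) :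
    (∮ w in C(0, R), Complex.exp (z * w) * (1 + w⁻¹) ^ N) = 2 * Real.pi * Complex.I *
      ∑ j ∈ Finset.range N, (N.choose (j + 1) : ℂ) * (z ^ j / j.factorial) := by
  have hci : ∀ m : ℕ, CircleIntegrable
      (fun w => (N.choose m : ℂ) * (Complex.exp (z * w) * (w⁻¹) ^ m)) 0 R := fun m => by
    refine ContinuousOn.circleIntegrable hR.le fun w hw => ContinuousAt.continuousWithinAt ?_
    have hw0 : w ≠ 0 := by
      rintro rfl
      simp at hw
      exact hR.ne hw
    fun_prop (disch := assumption)
  have h0 : (∮ w in C(0, R), Complex.exp (z * w) * (w⁻¹) ^ 0) = 0 := by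
    simp only [pow_zero, mul_one]
    exact Complex.circleIntegral_eq_zero_of_differentiable_on_off_countable hR.le
      Set.countable_empty (by fun_prop) fun w _ => by fun_prop
  have e : ∀ w : ℂ, Complex.exp (z * w) * (1 + w⁻¹) ^ N =
      ∑ m ∈ Finset.range (N + 1), (N.choose m : ℂ) * (Complex.exp (z * w) * (w⁻¹) ^ m) :=
    fun w => by
    rw [add_comm, add_pow, Finset.mul_sum]
    refine Finset.sum_congr rfl fun m _ => ?_
    rw [one_pow]
    ring
  simp only [e]
  rw [circleIntegral.integral_fun_sum fun m _ => hci m, Finset.sum_range_succ', Finset.mul_sum]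
  simp only [circleIntegral.integral_const_mul, h0, mul_zero, add_zero,
    circleIntegral_exp_mul_inv_pow z hR]
  exact Finset.sum_congr rfl fun j _ => by ring

/-- The integrand of the contour integral for the mean is the `N`-th power of this, up to the
factor `circleMap 0 (1 / (2 τ))`. -/
noncomputable def saddleFn (τ θ : ℝ) : ℂ :=
  Complex.exp (-2 * τ ^ 2 - 4 * τ ^ 2 * circleMap 0 (1 / (2 * τ)) θ) *
    (1 + (circleMap 0 (1 / (2 * τ)) θ)⁻¹)

theorem circleMap_two_pi_sub (R θ : ℝ) :
    circleMap 0 R (2 * Real.pi - θ) = (starRingEnd ℂ) (circleMap 0 R θ) := by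
  simp only [circleMap, zero_add, map_mul, Complex.conj_ofReal, ← Complex.exp_conj, Complex.conj_I]
  rw [show ((2 * Real.pi - θ : ℝ) : ℂ) * Complex.I = θ * -Complex.I + 2 * Real.pi * Complex.I by
    push_cast; ring, Complex.exp_periodic]

theorem saddleFn_two_pi_sub (τ θ : ℝ) :
    saddleFn τ (2 * Real.pi - θ) = (starRingEnd ℂ) (saddleFn τ θ) := by
  simp only [saddleFn, circleMap_two_pi_sub, map_mul, ← Complex.exp_conj, map_add, map_sub,
    map_one, map_inv₀, map_neg, map_pow, Complex.conj_ofReal, map_ofNat]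

theorem continuous_saddleFn {τ : ℝ} (hτ : 0 < τ) : Continuous (saddleFn τ) := by
  have h : ∀ θ, circleMap 0 (1 / (2 * τ)) θ ≠ 0 := fun θ => by
    rw [Ne, circleMap_eq_center_iff]; positivity
  unfold saddleFn
  have := continuous_circleMap 0 (1 / (2 * τ))
  fun_prop (disch := exact h _)

/-- Here `c² = -4Nτ²`. For `τ < 1` the saddles of `-4τ² w + log(1 + 1/w)` are the conjugate roots of
`w² + w + 1/(4τ²)`, both of modulus `1/(2τ)`, hence the radius. Conjugation symmetry reduces the
circle to its upper half. -/
theorem mean_expStat_bulkWave {τ : ℝ} (hτ : 0 < τ) (N : ℕ) :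
    mean N (expStat N (bulkWave N τ)) = ((1 / Real.pi * (∫ θ in (0 : ℝ)..Real.pi,
      circleMap 0 (1 / (2 * τ)) θ * saddleFn τ θ ^ N).re : ℝ) : ℂ) := by
  set R := 1 / (2 * τ) with hRdef
  have hR : 0 < R := by positivity
  set F : ℝ → ℂ := fun θ => circleMap 0 R θ * saddleFn τ θ ^ N with hF
  have hFc : Continuous F := (continuous_circleMap 0 R).mul ((continuous_saddleFn hτ).pow N)
  have hFsymm : ∀ θ, F (2 * Real.pi - θ) = (starRingEnd ℂ) (F θ) := fun θ => by
    simp only [hF, circleMap_two_pi_sub, saddleFn_two_pi_sub, map_mul, map_pow]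
  have hk : Complex.I * bulkWave N τ = √2 * bulkParam 0 τ N := by
    rw [← I_mul_bulk_eq]; simp [bulkShift]
  have hc : bulkParam 0 τ N ^ 2 = -(4 * N * τ ^ 2) := by
    have h1 : bulkParam 0 τ N = (2 * √N * τ : ℝ) * Complex.I := by
      apply Complex.ext <;> simp [bulkParam]
    rw [h1, mul_pow, Complex.I_sq, ← Complex.ofReal_pow, mul_pow, mul_pow,
      Real.sq_sqrt (Nat.cast_nonneg _)]
    push_cast
    ring
  have h2 : (∫ θ in (0 : ℝ)..2 * Real.pi, F θ) =
      ((2 * (∫ θ in (0 : ℝ)..Real.pi, F θ).re : ℝ) : ℂ) := by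
    have h3 : (∫ θ in Real.pi..2 * Real.pi, F θ) =
        (starRingEnd ℂ) (∫ θ in (0 : ℝ)..Real.pi, F θ) := by
      rw [← intervalIntegral.intervalIntegral_conj]
      simp only [← hFsymm]
      rw [intervalIntegral.integral_comp_sub_left F]
      congr 1 <;> ring
    rw [← intervalIntegral.integral_add_adjacent_intervals (hFc.intervalIntegrable 0 Real.pi)
      (hFc.intervalIntegrable _ _), h3, Complex.add_conj]
  have h4 : (∮ w in C(0, R), Complex.exp (bulkParam 0 τ N ^ 2 * w) * (1 + w⁻¹) ^ N) *
      Complex.exp (bulkParam 0 τ N ^ 2 / 2) = Complex.I * ∫ θ in (0 : ℝ)..2 * Real.pi, F θ := by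
    rw [circleIntegral, ← intervalIntegral.integral_mul_const,
      ← intervalIntegral.integral_const_mul]
    congr 1
    funext θ
    simp only [hF, saddleFn, deriv_circleMap, smul_eq_mul, mul_pow, ← Complex.exp_nat_mul, hc]
    rw [show (N : ℂ) * (-2 * τ ^ 2 - 4 * τ ^ 2 * circleMap 0 (1 / (2 * τ)) θ) =
      -(4 * N * τ ^ 2) * circleMap 0 R θ + -(4 * N * τ ^ 2) / 2 by rw [hRdef]; ring,
      Complex.exp_add]
    ring
  rw [circleIntegral_exp_mul_one_add_inv_pow _ hR, h2] at h4
  rw [mean_expStat N _ _ hk]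
  have hpi : (Real.pi : ℂ) ≠ 0 := by exact_mod_cast Real.pi_ne_zero
  push_cast at h4 ⊢
  have h5 : (2 * Real.pi * Complex.I : ℂ) ≠ 0 :=
    mul_ne_zero (mul_ne_zero two_ne_zero hpi) Complex.I_ne_zero
  refine mul_left_cancel₀ h5 ?_
  calc _ = _ := by ring
    _ = _ := h4
    _ = _ := by field_simp

/-! ### The saddle point -/

/-- Squaring `1 + t/2 ≤ exp(t/2)` gains `t²/4 ≥ 9y²/64`, more than the `y²/32` given away. The
interval `[-1, 8]` contains all values of `4τ(τ + cos θ)` for `0 < τ < 1`. -/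
theorem one_add_le_exp_sub_sq {y : ℝ} (h1 : -1 ≤ y) (h8 : y ≤ 8) :
    1 + y ≤ Real.exp (y - y ^ 2 / 32) := by
  set t := y - y ^ 2 / 32 with ht
  have ht2 : -2 ≤ t := by nlinarith
  have h2 : 9 / 16 * y ^ 2 ≤ t ^ 2 := by
    have e : t ^ 2 = y ^ 2 * (1 - y / 32) ^ 2 := by rw [ht]; ring
    have : 9 / 16 ≤ (1 - y / 32) ^ 2 := by nlinarith
    rw [e]
    nlinarith [sq_nonneg y]
  have h3 := Real.add_one_le_exp (t / 2)
  have h4 : Real.exp t = Real.exp (t / 2) ^ 2 := by rw [← Real.exp_nat_mul]; congr 1; push_cast; ring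
  have h5 : (t / 2 + 1) ^ 2 ≤ Real.exp (t / 2) ^ 2 := pow_le_pow_left₀ (by linarith) h3 2
  have h6 : 0 ≤ y ^ 2 := sq_nonneg y
  rw [h4]
  nlinarith

/-- The modulus depends only on `y = 4τ(τ + cos θ)`, and `(1 + y) exp(-y)` attains its maximum `1`
only at `y = 0`, that is at `cos θ = -τ`. -/
theorem norm_saddleFn_sq {τ : ℝ} (hτ : 0 < τ) (θ : ℝ) :
    ‖saddleFn τ θ‖ ^ 2 = (1 + 4 * τ * (τ + Real.cos θ)) *
      Real.exp (-(4 * τ * (τ + Real.cos θ))) := by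
  have hτ' : (τ : ℂ) ≠ 0 := by exact_mod_cast hτ.ne'
  have hw : circleMap 0 (1 / (2 * τ)) θ =
      ((1 / (2 * τ) * Real.cos θ : ℝ) : ℂ) + ((1 / (2 * τ) * Real.sin θ : ℝ) : ℂ) * Complex.I := by
    rw [circleMap, Complex.exp_mul_I]
    push_cast
    ring
  have hinv : (circleMap 0 (1 / (2 * τ)) θ)⁻¹ =
      ((2 * τ * Real.cos θ : ℝ) : ℂ) + ((-(2 * τ * Real.sin θ) : ℝ) : ℂ) * Complex.I := by
    refine inv_eq_of_mul_eq_one_right ?_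
    rw [hw]
    have := Complex.cos_sq_add_sin_sq (θ : ℂ)
    push_cast
    field_simp
    linear_combination this - Complex.sin θ ^ 2 * Complex.I_sq
  rw [saddleFn, norm_mul, mul_pow, Complex.norm_exp, ← Real.exp_nat_mul, mul_comm,
    ← Complex.normSq_eq_norm_sq, hinv, hw]
  congr 1
  · rw [← Complex.ofReal_one, Complex.normSq_apply]
    simp [-Complex.ofReal_cos, -Complex.ofReal_sin]
    have := Real.cos_sq_add_sin_sq θ
    linear_combination 4 * τ ^ 2 * this
  · congr 1
    rw [← Complex.ofReal_ofNat 4, ← Complex.ofReal_ofNat 2, ← Complex.ofReal_neg,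
      ← Complex.ofReal_pow, ← Complex.ofReal_mul, ← Complex.ofReal_mul, Complex.sub_re,
      Complex.re_ofReal_mul]
    simp [-Complex.ofReal_cos, -Complex.ofReal_sin, -Complex.ofReal_pow]
    field_simp
    ring

/-- In the product formula for `cos θ - cos α`, the factor `sin((θ+α)/2)` is bounded below by
compactness and the other by Jordan's inequality. -/
theorem exists_mul_abs_sub_le_abs_cos_sub {α : ℝ} (h0 : 0 < α) (h1 : α < Real.pi) :
    ∃ m : ℝ, 0 < m ∧ ∀ θ ∈ Set.Icc 0 Real.pi, m * |θ - α| ≤ |Real.cos θ - Real.cos α| := by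
  obtain ⟨m, hm, h⟩ := (isCompact_Icc (a := (0 : ℝ)) (b := Real.pi)).exists_forall_le'
    (f := fun θ => Real.sin ((θ + α) / 2)) (by fun_prop) (a := 0) fun θ hθ =>
      Real.sin_pos_of_pos_of_lt_pi (by linarith [hθ.1]) (by linarith [hθ.2])
  refine ⟨m * (2 / Real.pi), mul_pos hm (by positivity), fun θ hθ => ?_⟩
  have h2 : |(θ - α) / 2| ≤ Real.pi / 2 := by
    rw [abs_le]; constructor <;> linarith [hθ.1, hθ.2]
  have h3 := Real.mul_abs_le_abs_sin h2
  have h4 := h θ hθ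
  rw [Real.cos_sub_cos, abs_mul, abs_mul, abs_of_pos (hm.trans_le h4), abs_neg, abs_two]
  rw [abs_div, abs_two] at h3
  calc m * (2 / Real.pi) * |θ - α| = 2 * m * (2 / Real.pi * (|θ - α| / 2)) := by ring
    _ ≤ _ := mul_le_mul (by gcongr) h3 (by positivity) (by linarith)

theorem exists_norm_saddleFn_le {τ α : ℝ} (hτ : 0 < τ) (hτ1 : τ < 1) (h0 : 0 < α)
    (h1 : α < Real.pi) (hcos : Real.cos α = -τ) :
    ∃ c : ℝ, 0 < c ∧ ∀ θ ∈ Set.Icc 0 Real.pi,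
      ‖saddleFn τ θ‖ ≤ Real.exp (-c * (θ - α) ^ 2) := by
  obtain ⟨m, hm, h⟩ := exists_mul_abs_sub_le_abs_cos_sub h0 h1
  -- From `y² / 32 ≥ τ² m² (θ - α)² / 2`, halved because the bound is proved for the squared norm.
  refine ⟨τ ^ 2 * m ^ 2 / 4, by positivity, fun θ hθ => ?_⟩
  have hc1 := Real.neg_one_le_cos θ
  have hc2 := Real.cos_le_one θ
  set y := 4 * τ * (τ + Real.cos θ) with hy
  have hy1 : -1 ≤ y := by nlinarith [sq_nonneg (2 * τ - 1)]
  have hy8 : y ≤ 8 := by nlinarith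
  have hy2 : 16 * τ ^ 2 * (m ^ 2 * (θ - α) ^ 2) ≤ y ^ 2 := by
    have h2 := pow_le_pow_left₀ (by positivity) (h θ hθ) 2
    rw [mul_pow, sq_abs, sq_abs, hcos] at h2
    rw [hy, mul_pow]
    nlinarith [sq_nonneg τ]
  refine le_of_sq_le_sq ?_ (Real.exp_pos _).le
  rw [norm_saddleFn_sq hτ, ← Real.exp_nat_mul]
  calc (1 + y) * Real.exp (-y) ≤ Real.exp (y - y ^ 2 / 32) * Real.exp (-y) := by
        gcongr; exact one_add_le_exp_sub_sq hy1 hy8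
    _ = Real.exp (-(y ^ 2 / 32)) := by rw [← Real.exp_add]; congr 1; ring
    _ ≤ _ := by
        rw [Real.exp_le_exp]
        push_cast
        linarith

/-! ### Local expansion at the saddle -/

theorem AnalyticAt.exists_norm_taylor_four_le {f : ℂ → ℂ} (hf : AnalyticAt ℂ f 0) {p : ℂ}
    (h0 : f 0 = 0) (h1 : deriv f 0 = 0) (h2 : deriv (deriv f) 0 = -2 * p) :
    ∃ q : ℂ, ∃ C : ℝ, ∀ᶠ z in 𝓝 (0 : ℂ), ‖f z + p * z ^ 2 + q * z ^ 3‖ ≤ C * ‖z‖ ^ 4 := by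
  obtain ⟨C, hC⟩ := (hf.hasFPowerSeriesAt.isBigO_sub_partialSum_pow 4).bound
  refine ⟨-(iteratedDeriv 3 f 0 / 6), C, hC.mono fun z hz => ?_⟩
  simp only [FormalMultilinearSeries.partialSum, FormalMultilinearSeries.ofScalars_apply_eq,
    Finset.sum_range_succ, Finset.sum_range_zero, smul_eq_mul, iteratedDeriv_zero,
    iteratedDeriv_one, zero_add, norm_pow, norm_norm, h0, h1] at hz
  rw [show iteratedDeriv 2 f 0 = -2 * p by rw [iteratedDeriv_succ, iteratedDeriv_one, h2]] at hz
  refine le_of_eq_of_le (congrArg norm ?_) hz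
  simp [Nat.factorial]
  ring

/-- The logarithm of the ratio of `saddleFn τ` at `α₀ + z` and at its saddle `α₀`, with
`κ = exp (2 i arcsin τ)`. -/
noncomputable def saddleLog (κ z : ℂ) : ℂ :=
  (1 - κ) * (Complex.exp (z * Complex.I) - 1) - z * Complex.I +
    Complex.log (1 + κ * (Complex.exp (z * Complex.I) - 1))

theorem eventually_saddleLog_mem_slitPlane (κ : ℂ) :
    ∀ᶠ z in 𝓝 (0 : ℂ), 1 + κ * (Complex.exp (z * Complex.I) - 1) ∈ Complex.slitPlane := by
  have hc : ContinuousAt (fun z => 1 + κ * (Complex.exp (z * Complex.I) - 1)) 0 := by fun_prop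
  exact hc.eventually_mem (Complex.isOpen_slitPlane.mem_nhds (by simp))

theorem hasDerivAt_saddleLog (κ : ℂ) {z : ℂ}
    (hz : 1 + κ * (Complex.exp (z * Complex.I) - 1) ∈ Complex.slitPlane) :
    HasDerivAt (saddleLog κ) ((1 - κ) * (Complex.exp (z * Complex.I) * Complex.I) - Complex.I +
      κ * (Complex.exp (z * Complex.I) * Complex.I) /
        (1 + κ * (Complex.exp (z * Complex.I) - 1))) z := by
  have h1 : HasDerivAt (fun z : ℂ => z * Complex.I) Complex.I z := hasDerivAt_mul_const _
  have h2 : HasDerivAt (fun z : ℂ => Complex.exp (z * Complex.I) - 1)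
    (Complex.exp (z * Complex.I) * Complex.I) z := h1.cexp.sub_const 1
  exact ((h2.const_mul (1 - κ)).sub h1).add (((h2.const_mul κ).const_add 1).clog hz)

theorem analyticAt_saddleLog (κ : ℂ) : AnalyticAt ℂ (saddleLog κ) 0 := by
  refine DifferentiableOn.analyticAt (s := {z | 1 + κ * (Complex.exp (z * Complex.I) - 1) ∈
    Complex.slitPlane}) (fun z hz => ?_) (eventually_saddleLog_mem_slitPlane κ)
  exact (hasDerivAt_saddleLog κ hz).differentiableAt.differentiableWithinAt

/-- At `0` the first derivative `(1 - κ)i - i + κi` vanishes, which is the saddle condition; the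
second is `κ² - 1`. -/
theorem exists_norm_saddleLog_le (κ : ℂ) : ∃ q : ℂ, ∃ C : ℝ, ∀ᶠ z in 𝓝 (0 : ℂ),
    ‖saddleLog κ z + (1 - κ ^ 2) / 2 * z ^ 2 + q * z ^ 3‖ ≤ C * ‖z‖ ^ 4 := by
  have hmem := eventually_saddleLog_mem_slitPlane κ
  refine AnalyticAt.exists_norm_taylor_four_le (analyticAt_saddleLog κ) (by simp [saddleLog]) ?_ ?_
  · rw [(hasDerivAt_saddleLog κ hmem.self_of_nhds).deriv]
    simp
    ring
  · rw [EventuallyEq.deriv_eq (hmem.mono fun z hz => (hasDerivAt_saddleLog κ hz).deriv)]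
    have h1 : HasDerivAt (fun z : ℂ => z * Complex.I) Complex.I 0 := hasDerivAt_mul_const _
    have h2 := h1.cexp
    have h3 := h2.mul_const Complex.I
    have h4 := ((h2.sub_const 1).const_mul κ).const_add 1
    refine (((h3.const_mul (1 - κ)).sub_const Complex.I).add
      ((h3.const_mul κ).div h4 (by simp))).deriv.trans ?_
    simp
    linear_combination -κ ^ 2 * Complex.I_sq

theorem cexp_arcsin_mul_I {τ : ℝ} (h0 : -1 ≤ τ) (h1 : τ ≤ 1) :
    Complex.exp (Real.arcsin τ * Complex.I) = √(1 - τ ^ 2) + τ * Complex.I := by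
  rw [Complex.exp_mul_I, ← Complex.ofReal_cos, ← Complex.ofReal_sin, Real.cos_arcsin,
    Real.sin_arcsin h0 h1]

theorem circleMap_saddle_add (τ β u : ℝ) :
    circleMap 0 (1 / (2 * τ)) (Real.pi / 2 + β + u) =
      1 / (2 * τ) * Complex.exp ((Real.pi / 2 + β : ℝ) * Complex.I) *
        Complex.exp (u * Complex.I) := by
  rw [circleMap, zero_add, mul_assoc, ← Complex.exp_add]
  push_cast
  ring_nf

/-- With `b = exp(i arcsin τ)` the saddle is `i b / (2τ)`, and everything follows from `1 - b² =
-2iτ b`. The value at the saddle is unimodular; its phase is the one appearing in `oscillation`. -/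
theorem saddleFn_eq_mul_exp_saddleLog {τ : ℝ} (h0 : 0 < τ) (h1 : τ ≤ 1) {u : ℝ}
    (hu : 1 + Complex.exp (2 * Real.arcsin τ * Complex.I) * (Complex.exp (u * Complex.I) - 1) ∈
      Complex.slitPlane) :
    saddleFn τ (Real.pi / 2 + Real.arcsin τ + u) =
      Complex.exp ((-(2 * (τ * √(1 - τ ^ 2) + Real.arcsin τ)) : ℝ) * Complex.I) *
        Complex.exp (saddleLog (Complex.exp (2 * Real.arcsin τ * Complex.I)) u) := by
  have hτ : (τ : ℂ) ≠ 0 := by exact_mod_cast h0.ne'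
  set s := √(1 - τ ^ 2) with hs
  have hs2 : (s : ℂ) ^ 2 = 1 - τ ^ 2 := by
    rw [← Complex.ofReal_pow, hs, Real.sq_sqrt (by nlinarith)]; push_cast; ring
  set b := Complex.exp (Real.arcsin τ * Complex.I) with hb
  have hbs : b = s + τ * Complex.I := cexp_arcsin_mul_I (by linarith) h1
  have hb0 : b ≠ 0 := Complex.exp_ne_zero _
  have hκ : Complex.exp (2 * Real.arcsin τ * Complex.I) = b ^ 2 := by
    rw [hb, ← Complex.exp_nat_mul]; congr 1; push_cast; ring
  rw [hκ] at hu ⊢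
  have hb2 : 1 - b ^ 2 = -2 * τ * Complex.I * b := by
    rw [hbs]; linear_combination -hs2 + (τ : ℂ) ^ 2 * Complex.I_sq
  set E := Complex.exp (u * Complex.I) with hE
  have hE0 : E ≠ 0 := Complex.exp_ne_zero _
  have hw : circleMap 0 (1 / (2 * τ)) (Real.pi / 2 + Real.arcsin τ + u) =
      1 / (2 * τ) * (Complex.I * b) * E := by
    rw [circleMap_saddle_add]
    push_cast
    rw [add_mul, Complex.exp_add, Complex.exp_pi_div_two_mul_I]
  have hP : Complex.exp ((-(2 * (τ * s + Real.arcsin τ)) : ℝ) * Complex.I) =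
      Complex.exp (-(2 * τ * s) * Complex.I) * (b ^ 2)⁻¹ := by
    rw [← hκ, ← Complex.exp_neg, ← Complex.exp_add]
    congr 1
    push_cast
    ring
  have hlog : Complex.exp (saddleLog (b ^ 2) u) =
      Complex.exp ((1 - b ^ 2) * (E - 1)) * E⁻¹ * (1 + b ^ 2 * (E - 1)) := by
    rw [saddleLog, Complex.exp_add, Complex.exp_sub, Complex.exp_log (Complex.slitPlane_ne_zero hu),
      div_eq_mul_inv]
  have hexp : Complex.exp (-2 * τ ^ 2 - 4 * τ ^ 2 * (1 / (2 * τ) * (Complex.I * b) * E)) =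
      Complex.exp (-(2 * τ * s) * Complex.I) * Complex.exp ((1 - b ^ 2) * (E - 1)) := by
    rw [← Complex.exp_add]
    congr 1
    have e : 4 * (τ : ℂ) ^ 2 * (1 / (2 * τ) * (Complex.I * b) * E) =
        2 * τ * Complex.I * b * E := by field_simp; ring
    rw [e, hb2, hbs]
    linear_combination -2 * (τ : ℂ) ^ 2 * Complex.I_sq
  rw [saddleFn, hw, hexp, hP, hlog]
  have hI := Complex.I_ne_zero
  have hfac : 1 + (1 / (2 * τ) * (Complex.I * b) * E)⁻¹ =
      (b ^ 2)⁻¹ * E⁻¹ * (1 + b ^ 2 * (E - 1)) := by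
    field_simp
    linear_combination -Complex.I * hb2 + 2 * τ * b * Complex.I_sq
  rw [hfac]
  ring

/-! ### Phase and amplitude of the saddle contribution -/

theorem cpow_half_gaussian {r φ : ℝ} (hr : 0 < r) (h1 : -Real.pi < φ) (h2 : φ ≤ Real.pi) :
    ((r : ℂ) * Complex.exp (φ * Complex.I)) ^ (1 / 2 : ℂ) =
      √r * Complex.exp ((φ / 2 : ℝ) * Complex.I) := by
  have h3 : (r : ℂ) * Complex.exp (φ * Complex.I) =
      Complex.exp (Real.log r + φ * Complex.I) := by
    rw [Complex.exp_add, ← Complex.ofReal_exp, Real.exp_log hr]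
  rw [Complex.cpow_def_of_ne_zero (by rw [h3]; exact Complex.exp_ne_zero _), h3,
    Complex.log_exp (by simpa using h1) (by simpa using h2), Real.sqrt_eq_rpow,
    Real.rpow_def_of_pos hr, Complex.ofReal_exp, ← Complex.exp_add]
  congr 1
  push_cast
  ring

/-- The amplitude of the oscillation of the mean. -/
theorem amplitude_eq {τ : ℝ} (h0 : 0 < τ) (h1 : τ < 1) {N : ℕ} (hN : 0 < N) :
    (4 * N * τ ^ 2) ^ (-(1 / 2) : ℝ) * (2 * Real.pi * τ * √(1 - τ ^ 2)) ^ (-(1 / 2) : ℝ) =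
      1 / Real.pi * (√(Real.pi / (N * (2 * τ * √(1 - τ ^ 2)))) / (2 * τ)) := by
  have hN' : (0 : ℝ) < N := by exact_mod_cast hN
  have hs : 0 < √(1 - τ ^ 2) := Real.sqrt_pos.2 (by nlinarith)
  have hπ := Real.pi_pos
  rw [Real.rpow_neg (by positivity), Real.rpow_neg (by positivity), ← Real.sqrt_eq_rpow,
    ← Real.sqrt_eq_rpow, ← mul_inv, ← Real.sqrt_mul (by positivity)]
  refine inv_eq_of_mul_eq_one_right ?_
  have h2 : √(4 * N * τ ^ 2 * (2 * Real.pi * τ * √(1 - τ ^ 2))) *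
      √(Real.pi / (N * (2 * τ * √(1 - τ ^ 2)))) = 2 * τ * Real.pi := by
    rw [← Real.sqrt_mul (by positivity), ← Real.sqrt_sq (by positivity : 0 ≤ 2 * τ * Real.pi)]
    congr 1
    field_simp
    ring
  calc _ = √(4 * N * τ ^ 2 * (2 * Real.pi * τ * √(1 - τ ^ 2))) *
      √(Real.pi / (N * (2 * τ * √(1 - τ ^ 2)))) / (2 * τ * Real.pi) := by field_simp
    _ = 1 := by rw [h2]; exact div_self (by positivity)

/-- Factor `1 - b⁴ = (1 - b²)(1 + b²)` with `1 - b² = -2iτ b` and `1 + b² = 2√(1-τ²) b`. The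
argument lies in `(-π/2, π/2)`, so the real part is positive. -/
theorem saddle_quadratic_coeff {τ : ℝ} (h0 : 0 < τ) (h1 : τ < 1) :
    (1 - Complex.exp (2 * Real.arcsin τ * Complex.I) ^ 2) / 2 =
      (2 * τ * √(1 - τ ^ 2) : ℝ) *
        Complex.exp (((2 * Real.arcsin τ - Real.pi / 2 : ℝ) : ℂ) * Complex.I) := by
  have hs2 : ((√(1 - τ ^ 2) : ℝ) : ℂ) ^ 2 = 1 - τ ^ 2 := by
    rw [← Complex.ofReal_pow, Real.sq_sqrt (by nlinarith)]; push_cast; ring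
  set b := Complex.exp (Real.arcsin τ * Complex.I) with hb
  have hbs : b = √(1 - τ ^ 2) + τ * Complex.I := cexp_arcsin_mul_I (by linarith) h1.le
  have hκ : Complex.exp (2 * Real.arcsin τ * Complex.I) = b ^ 2 := by
    rw [hb, ← Complex.exp_nat_mul]; congr 1; push_cast; ring
  have hI : Complex.exp (((2 * Real.arcsin τ - Real.pi / 2 : ℝ) : ℂ) * Complex.I) =
      b ^ 2 * -Complex.I := by
    rw [← hκ, ← Complex.exp_neg_pi_div_two_mul_I, ← Complex.exp_add]
    congr 1
    push_cast
    ring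
  have hb2 : 1 - b ^ 2 = -2 * τ * Complex.I * b := by
    rw [hbs]; linear_combination -hs2 + (τ : ℂ) ^ 2 * Complex.I_sq
  have hb2' : 1 + b ^ 2 = 2 * √(1 - τ ^ 2) * b := by
    rw [hbs]; linear_combination -hs2 + (τ : ℂ) ^ 2 * Complex.I_sq
  rw [hκ, hI]
  push_cast
  linear_combination (1 + b ^ 2) / 2 * hb2 - τ * Complex.I * b * hb2'

/-- The position of the saddle contributes the phase `π/2 + β` and the Gaussian square root `π/4 -
β`. So `β` cancels outside the `N`-th power, and the leftover `π/2` turns the cosine into the sine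
with shift `-π/4`. -/
theorem re_saddle_contribution {τ : ℝ} (h0 : 0 < τ) (h1 : τ < 1) {N : ℕ} (hN : 0 < N) :
    (Complex.exp ((-(2 * (τ * √(1 - τ ^ 2) + Real.arcsin τ)) : ℝ) * Complex.I) ^ N *
      circleMap 0 (1 / (2 * τ)) (Real.pi / 2 + Real.arcsin τ) *
      ((Real.pi : ℂ) / (N * ((1 - Complex.exp (2 * Real.arcsin τ * Complex.I) ^ 2) / 2))) ^
        (1 / 2 : ℂ)).re =
    √(Real.pi / (N * (2 * τ * √(1 - τ ^ 2)))) / (2 * τ) * oscillation N (τ ^ 2) := by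
  have hN' : (0 : ℝ) < N := by exact_mod_cast hN
  have hs : 0 < √(1 - τ ^ 2) := Real.sqrt_pos.2 (by nlinarith)
  have hβ0 : 0 < Real.arcsin τ := Real.arcsin_pos.2 h0
  have hβ1 : Real.arcsin τ < Real.pi / 2 := Real.arcsin_lt_pi_div_two.2 h1
  set β := Real.arcsin τ with hβ
  set r := Real.pi / (N * (2 * τ * √(1 - τ ^ 2))) with hr
  have hr0 : 0 < r := by have := Real.pi_pos; positivity
  have hdiv : (Real.pi : ℂ) / (N * ((1 - Complex.exp (2 * β * Complex.I) ^ 2) / 2)) =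
      r * Complex.exp ((Real.pi / 2 - 2 * β : ℝ) * Complex.I) := by
    rw [saddle_quadratic_coeff h0 h1, hr, ← hβ,
      show Real.pi / 2 - 2 * β = -(2 * β - Real.pi / 2) by ring, Complex.ofReal_neg (2 * β - _),
      neg_mul, Complex.exp_neg]
    push_cast
    field_simp
  have harg : √(τ ^ 2 * (1 - τ ^ 2)) = τ * √(1 - τ ^ 2) := by
    rw [Real.sqrt_mul (by positivity), Real.sqrt_sq h0.le]
  have hprod : Complex.exp ((-(2 * (τ * √(1 - τ ^ 2) + β)) : ℝ) * Complex.I) ^ N *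
      circleMap 0 (1 / (2 * τ)) (Real.pi / 2 + β) *
      (r * Complex.exp ((Real.pi / 2 - 2 * β : ℝ) * Complex.I)) ^ (1 / 2 : ℂ) =
      (√r / (2 * τ) : ℝ) * Complex.exp ((Real.pi / 2 -
        (2 * N * (τ * √(1 - τ ^ 2) + β) - Real.pi / 4) : ℝ) * Complex.I) := by
    rw [cpow_half_gaussian hr0 (by linarith) (by linarith), ← Complex.exp_nat_mul, circleMap,
      zero_add]
    calc _ = ((√r : ℂ) / (2 * τ)) *
        (Complex.exp (N * ((-(2 * (τ * √(1 - τ ^ 2) + β)) : ℝ) * Complex.I)) *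
        Complex.exp ((Real.pi / 2 + β : ℝ) * Complex.I) *
        Complex.exp (((Real.pi / 2 - 2 * β) / 2 : ℝ) * Complex.I)) := by push_cast; ring
      _ = _ := by
        rw [← Complex.exp_add, ← Complex.exp_add]
        push_cast
        congr 2
        ring
  rw [hdiv, hprod, Complex.re_ofReal_mul, Complex.exp_ofReal_mul_I_re, Real.cos_pi_div_two_sub,
    oscillation, Real.sqrt_sq h0.le, harg]

theorem exists_saddle_error_bound {τ : ℝ} (h0 : 0 < τ) (h1 : τ < 1) : ∃ K : ℝ, ∀ N : ℕ, 0 < N →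
    ‖(∫ θ in (0 : ℝ)..Real.pi, circleMap 0 (1 / (2 * τ)) θ * saddleFn τ θ ^ N) -
      Complex.exp ((-(2 * (τ * √(1 - τ ^ 2) + Real.arcsin τ)) : ℝ) * Complex.I) ^ N *
      circleMap 0 (1 / (2 * τ)) (Real.pi / 2 + Real.arcsin τ) *
      ((Real.pi : ℂ) / (N * ((1 - Complex.exp (2 * Real.arcsin τ * Complex.I) ^ 2) / 2))) ^
        (1 / 2 : ℂ)‖ ≤ K / (N * √N) := by
  have hs : 0 < √(1 - τ ^ 2) := Real.sqrt_pos.2 (by nlinarith)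
  have hβ0 : 0 < Real.arcsin τ := Real.arcsin_pos.2 h0
  have hβ1 : Real.arcsin τ < Real.pi / 2 := Real.arcsin_lt_pi_div_two.2 h1
  have hcos : Real.cos (Real.pi / 2 + Real.arcsin τ) = -τ := by
    rw [add_comm, Real.cos_add_pi_div_two, Real.sin_arcsin (by linarith) h1.le]
  obtain ⟨c, hc, hPc⟩ := exists_norm_saddleFn_le h0 h1
    (by linarith [Real.pi_pos] : 0 < Real.pi / 2 + Real.arcsin τ) (by linarith) hcos
  have hp : 0 < ((1 - Complex.exp (2 * Real.arcsin τ * Complex.I) ^ 2) / 2).re := by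
    rw [saddle_quadratic_coeff h0 h1, Complex.re_ofReal_mul, Complex.exp_ofReal_mul_I_re,
      Real.cos_sub_pi_div_two]
    have := Real.sin_pos_of_pos_of_lt_pi (x := 2 * Real.arcsin τ) (by linarith) (by linarith)
    positivity
  have hslit := eventually_saddleLog_mem_slitPlane (Complex.exp (2 * Real.arcsin τ * Complex.I))
  obtain ⟨q, C, hC⟩ := exists_norm_saddleLog_le (Complex.exp (2 * Real.arcsin τ * Complex.I))
  obtain ⟨ε, hε, hball⟩ := Metric.eventually_nhds_iff.1 (hslit.and hC)
  set β := Real.arcsin τ with hβ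
  -- The bound `1` serves the Taylor remainder of the exponential, `ε / 2` the expansion of
  -- `saddleLog`, and `π/2 - β` keeps the window inside `[0, π]`.
  set δ := min (min 1 (ε / 2)) (Real.pi / 2 - β) with hδ
  have hδ0 : 0 < δ := lt_min (lt_min one_pos (by linarith)) (by linarith)
  have hδ1 : δ ≤ 1 := (min_le_left _ _).trans (min_le_left _ _)
  have hδε : δ ≤ ε / 2 := (min_le_left _ _).trans (min_le_right _ _)
  have hδβ : δ ≤ Real.pi / 2 - β := min_le_right _ _
  have hloc : ∀ u : ℝ, |u| ≤ δ → dist (u : ℂ) 0 < ε := fun u hu => by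
    rw [dist_zero_right, Complex.norm_real, Real.norm_eq_abs]
    linarith
  have hR : ∀ θ, ‖circleMap 0 (1 / (2 * τ)) θ‖ = 1 / (2 * τ) := fun θ => by
    rw [norm_circleMap_zero, abs_of_pos (by positivity)]
  have hCR : 1 / (2 * τ) ≤ |C| + 1 / (2 * τ) := by linarith [abs_nonneg C]
  refine laplace_method (α₀ := Real.pi / 2 + β) (c := c) (C := |C| + 1 / (2 * τ)) (δ := δ) (q := q)
    (A₁ := circleMap 0 (1 / (2 * τ)) (Real.pi / 2 + β) * Complex.I)
    (continuous_circleMap _ _) (continuous_saddleFn h0) hδ0 hδ1 (by linarith) (by linarith) hc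
    (by positivity) hp (Complex.norm_exp_ofReal_mul_I _) (fun θ _ => (hR θ).trans_le hCR) hPc
    (fun u => saddleLog (Complex.exp (2 * β * Complex.I)) u)
    (fun u hu => saddleFn_eq_mul_exp_saddleLog h0 h1.le (hball (hloc u hu)).1)
    (fun u hu => ?_) (fun u hu => ?_)
  · refine (hball (hloc u hu)).2.trans ?_
    rw [Complex.norm_real, Real.norm_eq_abs, show 4 = 2 * 2 by rfl, pow_mul, sq_abs, pow_mul]
    gcongr
    linarith [le_abs_self C, show 0 < 1 / (2 * τ) by positivity]
  · have e : circleMap 0 (1 / (2 * τ)) (Real.pi / 2 + β + u) -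
        circleMap 0 (1 / (2 * τ)) (Real.pi / 2 + β) -
        circleMap 0 (1 / (2 * τ)) (Real.pi / 2 + β) * Complex.I * u =
        circleMap 0 (1 / (2 * τ)) (Real.pi / 2 + β) *
          (Complex.exp (u * Complex.I) - 1 - u * Complex.I) := by
      have h2 := circleMap_saddle_add τ β u
      have h3 := circleMap_saddle_add τ β 0
      rw [add_zero, Complex.ofReal_zero, zero_mul, Complex.exp_zero, mul_one] at h3
      rw [h2, h3]
      ring
    have hu2 : ‖(u : ℂ) * Complex.I‖ = |u| := by
      rw [norm_mul, Complex.norm_I, mul_one, Complex.norm_real, Real.norm_eq_abs]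
    have h4 := Complex.norm_exp_sub_one_sub_id_le (hu2.trans_le (hu.trans hδ1))
    rw [hu2, sq_abs] at h4
    rw [e, norm_mul, hR]
    gcongr

theorem mean_expStat_bulk_asymptotic {τ : ℝ} (h0 : 0 < τ) (h1 : τ < 1) :
    ∃ E : ℕ → ℂ, E =O[atTop] (fun N : ℕ => 1 / (N : ℝ)) ∧
        ∀ N : ℕ, 1 ≤ N →
          mean N (expStat N (bulkWave N τ)) =
            (((4 * N * τ ^ 2) ^ (-(1 / 2) : ℝ) *
              (2 * Real.pi * τ * √(1 - τ ^ 2)) ^ (-(1 / 2) : ℝ) : ℝ) : ℂ) *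
              ((oscillation N (τ ^ 2) : ℂ) + E N) := by
  obtain ⟨K, hK⟩ := exists_saddle_error_bound h0 h1
  have hπ := Real.pi_pos
  have hs : 0 < √(1 - τ ^ 2) := Real.sqrt_pos.2 (by nlinarith)
  set amp : ℕ → ℝ := fun N =>
    1 / Real.pi * (√(Real.pi / (N * (2 * τ * √(1 - τ ^ 2)))) / (2 * τ)) with hamp
  have hpos : ∀ N : ℕ, 0 < N → 0 < amp N := fun N hN => by
    have hN' : (0 : ℝ) < N := by exact_mod_cast hN
    simp only [hamp]
    positivity
  set a := amp 1 with ha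
  have hscale : ∀ N : ℕ, amp N = a / √N := fun N => by
    simp only [ha, hamp, Nat.cast_one, one_mul]
    rw [mul_comm (N : ℝ), ← div_div Real.pi _ (N : ℝ),
      Real.sqrt_div (by positivity : 0 ≤ Real.pi / (2 * τ * √(1 - τ ^ 2)))]
    ring
  -- This choice makes the identity exact for `N ≥ 1`. Dividing the error `K / (N √N)` by `π a / √N`
  -- leaves `K / (π a)` times `1 / N`.
  refine ⟨fun N => mean N (expStat N (bulkWave N τ)) / amp N - oscillation N (τ ^ 2), ?_,
    fun N hN => ?_⟩
  · refine IsBigO.of_bound (K / (Real.pi * a)) ?_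
    filter_upwards [eventually_gt_atTop 0] with N hN
    have hN' : (0 : ℝ) < N := by exact_mod_cast hN
    have hsN : 0 < √(N : ℝ) := Real.sqrt_pos.2 hN'
    have hre := (Complex.abs_re_le_norm _).trans (hK N hN)
    rw [Complex.sub_re, re_saddle_contribution h0 h1 hN] at hre
    set I := (∫ θ in (0 : ℝ)..Real.pi, circleMap 0 (1 / (2 * τ)) θ * saddleFn τ θ ^ N).re with hI
    have hm : √(Real.pi / (N * (2 * τ * √(1 - τ ^ 2)))) / (2 * τ) = Real.pi * amp N := by
      simp only [hamp]; field_simp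
    have e : mean N (expStat N (bulkWave N τ)) / amp N - oscillation N (τ ^ 2) =
        (((I - Real.pi * amp N * oscillation N (τ ^ 2)) / (Real.pi * amp N) : ℝ) : ℂ) := by
      rw [mean_expStat_bulkWave h0, ← hI]
      have := (hpos N hN).ne'
      norm_cast
      field_simp
    rw [hm] at hre
    rw [e, Complex.norm_real, norm_div, Real.norm_eq_abs, Real.norm_of_nonneg
      (mul_pos hπ (hpos N hN)).le, Real.norm_of_nonneg (by positivity : (0 : ℝ) ≤ 1 / N)]
    refine (div_le_div_of_nonneg_right hre (mul_pos hπ (hpos N hN)).le).trans (le_of_eq ?_)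
    have ha0 : a ≠ 0 := (hpos 1 one_pos).ne'
    rw [hscale]
    field_simp
  · have hne : (amp N : ℂ) ≠ 0 := by exact_mod_cast (hpos N hN).ne'
    rw [amplitude_eq h0 h1 hN]
    change _ = (amp N : ℂ) * _
    rw [add_sub_cancel, mul_div_cancel₀ _ hne]

end GUE

theorem mainTheorem7 :
    -- the mean, for `0 < τ < 1`
    (∀ τ : ℝ, 0 < τ → τ < 1 →
      ∃ E : ℕ → ℂ, E =O[atTop] (fun N : ℕ => 1 / (N : ℝ)) ∧
        ∀ N : ℕ, 1 ≤ N →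
          GUE.mean N (GUE.expStat N (GUE.bulkWave N τ)) =
            (((4 * N * τ ^ 2) ^ (-(1 / 2) : ℝ) *
              (2 * Real.pi * τ * √(1 - τ ^ 2)) ^ (-(1 / 2) : ℝ) : ℝ) : ℂ) *
              ((GUE.oscillation N (τ ^ 2) : ℂ) + E N)) ∧
    -- the averaged structure function
    (∀ τ : ℝ, 0 < τ → τ < 1 →
      Tendsto (fun N : ℕ => 1 / (N : ℝ) * GUE.structureFn N (GUE.bulkWave N τ)) atTop
        (𝓝 (2 / Real.pi * (τ * √(1 - τ ^ 2) + Real.arcsin τ)))) ∧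
    (∀ τ : ℝ, 1 < τ →
      Tendsto (fun N : ℕ => 1 / (N : ℝ) * GUE.structureFn N (GUE.bulkWave N τ)) atTop (𝓝 1)) ∧
    -- the covariance, for `γ ≠ 0`
    (∀ γ τ : ℝ, γ ≠ 0 → 0 < τ → τ < 1 →
      Tendsto (fun N : ℕ => 1 / (N : ℂ) * GUE.bulkCov N γ τ) atTop
        (𝓝 ((4 / (γ * Real.pi) * ∫ s in (0 : ℝ)..τ, Real.sinh (γ * √(1 - s ^ 2)) : ℝ) : ℂ))) ∧
    (∀ γ τ : ℝ, γ ≠ 0 → 1 < τ →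
      Tendsto (fun N : ℕ => 1 / (N : ℂ) * GUE.bulkCov N γ τ) atTop
        (𝓝 ((4 / (γ * Real.pi) * ∫ s in (0 : ℝ)..1, Real.sinh (γ * √(1 - s ^ 2)) : ℝ) : ℂ))) ∧
    -- the covariance, for `γ = 0`, where `sinh (γ u) / γ` stands for its limit `u`
    (∀ τ : ℝ, 0 < τ → τ < 1 →
      Tendsto (fun N : ℕ => 1 / (N : ℂ) * GUE.bulkCov N 0 τ) atTop
        (𝓝 ((4 / Real.pi * ∫ s in (0 : ℝ)..τ, √(1 - s ^ 2) : ℝ) : ℂ))) ∧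
    (∀ τ : ℝ, 1 < τ →
      Tendsto (fun N : ℕ => 1 / (N : ℂ) * GUE.bulkCov N 0 τ) atTop (𝓝 1)) := by
  refine ⟨fun τ h0 h1 => GUE.mean_expStat_bulk_asymptotic h0 h1, fun τ h0 h1 => ?_, fun τ h1 => ?_,
    fun γ τ hγ h0 _ => GUE.tendsto_bulkCov_of_ne_zero hγ h0, fun γ τ hγ h1 => ?_,
    fun τ h0 _ => GUE.tendsto_bulkCov_zero h0, fun τ h1 => ?_⟩
  · have h := GUE.tendsto_structureFn h0
    rw [GUE.integral_sqrt_one_sub_sq_zero_left h0 h1] at h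
    convert h using 2
    ring
  · have h := GUE.tendsto_structureFn (zero_lt_one.trans h1)
    rw [GUE.integral_comp_sqrt_one_sub_sq continuous_id' rfl h1.le,
      GUE.integral_sqrt_one_sub_sq_zero_one] at h
    convert h using 2
    field_simp
  · have h := GUE.tendsto_bulkCov_of_ne_zero hγ (zero_lt_one.trans h1)
    rwa [GUE.integral_comp_sqrt_one_sub_sq (g := fun u => Real.sinh (γ * u))
      (by fun_prop) (by simp) h1.le] at h
  · have h := GUE.tendsto_bulkCov_zero (zero_lt_one.trans h1)
    rw [GUE.integral_comp_sqrt_one_sub_sq continuous_id' rfl h1.le,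
      GUE.integral_sqrt_one_sub_sq_zero_one] at h
    convert h using 2
    push_cast
    field_simp
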